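/- Let $X$ be a compact metric space and let $r\colon X\to X$ be Borel measurable, onto and finite-to-one; write $\#r^{-1}(x)$ for the number of preimages of $x$. Let $\rho$ be a Borel probability measure on $X$ which is strongly invariant, i.e. $$\int_X f\,d\rho=\int_X\frac1{\#r^{-1}(x)}\sum_{r(y)=x}f(y)\,d\rho(x)\qquad(f\in L^\infty(X,\rho)).$$ A path starting at $x$ is a sequence $\omega=(z_1,z_2,\dots)$ with $r(z_1)=x$ and $r(z_{n+1})=z_n$; put $z_0:=x$. Let $X_\infty$ be the set of all paths $(x,\omega)$, with the $\sigma$-algebra generated by the coordinates, and let $\hat r(z_0,z_1,z_2,\dots)=(r(z_0),z_0,z_1,\dots)$. Let $C=\{x_0,\dots,x_{p-1}\}$ be a cycle of length $p\ge1$: the points $x_i$ are distinct and $r(x_{i+1})=x_i$, with indices modulo $p$. Let $\mathbf N_C(x)$ be the set of paths $\omega$ starting at $x$ for which $\lim_n z_{pn}$ exists and lies in $C$, and define $i(\omega)$ by $\lim_n z_{pn}=x_{i(\omega)}$. The measure $\lambda_C$ on $X_\infty$ is given by $\int f\,d\lambda_C=\int_X\sum_{\omega\in\mathbf N_C(x)}f(\omega)\,d\rho(x)$.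 Let $\alpha_0,\dots,\alpha_{p-1}$ be complex numbers of absolute value $1$ (indices modulo $p$). On $L^2(X_\infty,\lambda_C)$ put $$U\xi(x,\omega)=\alpha_{i(\omega)}\sqrt{\#r^{-1}(r(x))}\;\xi(\hat r(x,\omega)),\qquad \pi(f)\xi(x,\omega)=f(x)\,\xi(x,\omega)\quad(f\in L^\infty(X,\rho)).$$ Assume: * $C$ is repelling: for every $i$ there are $0<c<1$ and $\delta>0$ such that $d(r^p(x),x_i)>c^{-1}d(x,x_i)$ whenever $0<d(x,x_i)<\delta$; * $r$ and $x\mapsto\#r^{-1}(x)$ are continuous at the points of $C$; * $m_0\colon X\to\mathbb C$ lies in $L^\infty(X,\rho)$ and is $\beta$-Lipschitz at each point $x_i$ of $C$: there is a non-decreasing $\beta\colon[0,\infty)\to[0,\infty)$ with $\sum_{k\ge1}\beta(Ac^k)<\infty$ for all $A>0$, $0<c<1$, and $|m_0(x)-m_0(x_i)|\le\beta(d(x,x_i))$ for all $x$ in a neighborhood of $x_i$; * (quadrature condition) $\frac1{\#r^{-1}(x)}\sum_{r(y)=x}|m_0(y)|^2=1$ for all $x\in X$; * (low-pass condition) $m_0(x_i)=\alpha_i\sqrt{\#r^{-1}(r(x_i))}$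 for all $i$. Then every $\mathbf N_C(x)$ is countable, the measure $\lambda_C$ is well defined, $U$ is a well-defined unitary operator on $L^2(X_\infty,\lambda_C)$, and the following hold. 1. The infinite product $$\hat\varphi(x,\omega):=\prod_{k=1}^\infty\frac{\alpha_{i(\omega)+k}^{-1}\,m_0(z_k)}{\sqrt{\#r^{-1}(r(z_k))}}\qquad(x\in X,\ \omega=(z_k)_{k\ge1}\in\mathbf N_C(x))$$ converges for every $\omega\in\mathbf N_C(x)$, $\hat\varphi\in L^2(X_\infty,\lambda_C)$, and $U\hat\varphi=\pi(m_0)\hat\varphi$. 2. Let $W(x):=|m_0(x)|^2/\#r^{-1}(r(x))$. Then $C$ is a $W$-cycle, i.e. $W=1$ on $C$. Let $P_x$ be the probability measure on the paths starting at $x$ for which the set of paths with prescribed $z_1=a_1,\dots,z_n=a_n$ (where $r(a_1)=x$ and $r(a_{k+1})=a_k$) has measure $W(a_1)\cdots W(a_n)$, and let $h_C(x):=P_x(\mathbf N_C(x))$. Then for all $f\in L^\infty(X,\rho)$ the function $fh_C$ is $\rho$-integrable and $$\langle\pi(f)\hat\varphi,\hat\varphi\rangle=\int_X f\,h_C\,d\rho.$$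 3. Let $V_0$ be the closure in $L^2(X_\infty,\lambda_C)$ of $\{\pi(f)\hat\varphi : f\in L^\infty(X,\rho)\}$ and $V_n:=U^{-n}V_0$ for $n\in\mathbb Z$. Then $V_n\subset V_{n+1}$ for all $n$, and $\bigcup_{n\in\mathbb Z}V_n$ is dense in $L^2(X_\infty,\lambda_C)$. If moreover $\rho$ is ergodic for $r$ and $|m_0|\ne1$ on a set of positive $\rho$-measure, then $\bigcap_{n\in\mathbb Z}V_n=\{0\}$. -/

import Mathlib

open MeasureTheory ProbabilityTheory Filter Topology Set
open scoped ENNReal NNReal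

noncomputable section

namespace RepellingCycle

/-- `fiberCard r x` is the number `#r⁻¹(x)` of preimages of `x`. -/
def fiberCard {X : Type*} (r : X → X) (x : X) : ℕ := (r ⁻¹' {x}).ncard

/-- The probability measure `ρ` is strongly invariant:
`∫ f dρ = ∫ (1 / #r⁻¹(x)) ∑_{r y = x} f y dρ(x)` for all `f ∈ L^∞(ρ)`. -/
def IsStronglyInvariant {X : Type*} [MeasurableSpace X] (r : X → X) (ρ : Measure X) : Prop :=
  ∀ f : X → ℂ, MemLp f ∞ ρ →
    ∫ x, f x ∂ρ = ∫ x, (1 / (fiberCard r x : ℂ)) * ∑ᶠ y ∈ r ⁻¹' {x}, f y ∂ρ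

/-- `x₀, …, x_{p-1}`, indexed by the residues modulo `p`, are the distinct points of a cycle:
`r (x_{i+1}) = x_i`, and in particular `r (x_0) = x_{p-1}`. -/
def IsCycle {X : Type*} (r : X → X) {p : ℕ} (x : ZMod p → X) : Prop :=
  Function.Injective x ∧ ∀ i, r (x (i + 1)) = x i

/-- `x₀` is a repelling fixed point of `r`. -/
def IsRepellingFixedPt {X : Type*} [MetricSpace X] (r : X → X) (x₀ : X) : Prop :=
  r x₀ = x₀ ∧ ∃ c : ℝ, 0 < c ∧ c < 1 ∧ ∃ δ : ℝ, 0 < δ ∧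
    ∀ x, x ≠ x₀ → dist x x₀ < δ → c⁻¹ * dist x x₀ < dist (r x) x₀

/-- Every point of the cycle is a repelling fixed point of `r^p`. -/
def IsRepellingCycle {X : Type*} [MetricSpace X] (r : X → X) {p : ℕ} (x : ZMod p → X) : Prop :=
  IsCycle r x ∧ ∀ i, IsRepellingFixedPt (r^[p]) (x i)

/-- `f` is `β`-Lipschitz at `x₀`, for some non-decreasing `β : [0,∞) → [0,∞)` such that
`∑_{k ≥ 1} β (A c^k) < ∞` for all `A > 0` and `0 < c < 1`. -/
def IsBetaLipschitzAt {X : Type*} [MetricSpace X] (f : X → ℂ) (x₀ : X) : Prop :=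
  ∃ β : ℝ≥0 → ℝ≥0, Monotone β ∧
    (∀ A c : ℝ≥0, 0 < A → 0 < c → c < 1 → Summable fun k : ℕ => β (A * c ^ (k + 1))) ∧
    ∀ᶠ x in 𝓝 x₀, ‖f x - f x₀‖₊ ≤ β (nndist x x₀)

/-- The space `X_∞` of all paths. The path `(z₁, z₂, …)` starting at `x` is recorded as the
sequence `(z₀, z₁, z₂, …)` with `z₀ = x`. It carries the `σ`-algebra generated by the coordinates,
which is also generated by all coordinates `z_n`, `n ∈ ℤ`, since `z_{-n} = r^n z₀`. -/
abbrev PathSpace {X : Type*} (r : X → X) : Type _ := {z : ℕ → X // ∀ n, r (z (n + 1)) = z n}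

/-- The starting point `θ₀` of a path. -/
def start {X : Type*} {r : X → X} (ω : PathSpace r) : X := ω.1 0

/-- The automorphism `r̂ (z₀, z₁, z₂, …) = (r z₀, z₀, z₁, …)` of the path space. -/
def shift {X : Type*} {r : X → X} (ω : PathSpace r) : PathSpace r :=
  ⟨fun n => Nat.casesOn n (r (ω.1 0)) ω.1, by
    intro n
    cases n with
    | zero => rfl
    | succ n => exact ω.2 n⟩

/-- The set `N_C(x)` of paths that start at `x` and for which `lim z_{pn}` exists and lies in the
cycle. -/
def cyclePaths {X : Type*} [TopologicalSpace X] (r : X → X) {p : ℕ} (c : ZMod p → X) (x : X) :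
    Set (PathSpace r) :=
  {ω | start ω = x ∧ ∃ i, Tendsto (fun n : ℕ => ω.1 (p * n)) atTop (𝓝 (c i))}

open Classical in
/-- `i(ω)` is the index with `lim z_{pn} = x_{i(ω)}` (and `0` if there is none). -/
def cycleIndex {X : Type*} [TopologicalSpace X] {r : X → X} {p : ℕ} (c : ZMod p → X)
    (ω : PathSpace r) : ZMod p :=
  if h : ∃ i, Tendsto (fun n : ℕ => ω.1 (p * n)) atTop (𝓝 (c i)) then h.choose else 0

/-- The measure `λ_C` on the path space, `∫ f dλ_C = ∫ ∑_{ω ∈ N_C(x)} f ω dρ(x)`: the mixture over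
`ρ` of the counting measures of the sets `N_C(x)`. -/
def lambdaC {X : Type*} [TopologicalSpace X] [MeasurableSpace X] (ρ : Measure X) (r : X → X)
    {p : ℕ} (c : ZMod p → X) : Measure (PathSpace r) :=
  ρ.bind fun x => Measure.count.restrict (cyclePaths r c x)

lemma measurable_start {X : Type*} [MeasurableSpace X] {r : X → X} :
    Measurable (start : PathSpace r → X) :=
  (measurable_pi_apply 0).comp measurable_subtype_coe

lemma quasiMeasurePreserving_start {X : Type*} [TopologicalSpace X] [MeasurableSpace X]
    (ρ : Measure X) (r : X → X) {p : ℕ} (c : ZMod p → X) :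
    Measure.QuasiMeasurePreserving (start : PathSpace r → X) (lambdaC ρ r c) ρ := by
  refine ⟨measurable_start, Measure.AbsolutelyContinuous.mk fun A hA h0 => ?_⟩
  rw [Measure.map_apply measurable_start hA]
  refine le_antisymm ((Measure.bind_apply_le _ (measurable_start hA)).trans ?_) zero_le
  rw [nonpos_iff_eq_zero]
  refine lintegral_eq_zero_of_ae_eq_zero ?_
  filter_upwards [measure_eq_zero_iff_ae_notMem.1 h0] with x hx
  rw [Measure.restrict_apply (measurable_start hA)]
  have : start ⁻¹' A ∩ cyclePaths r c x = ∅ := by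
    ext ω
    simp only [mem_inter_iff, mem_preimage, mem_empty_iff_false, iff_false, not_and]
    rintro h1 ⟨h2, -⟩
    exact hx (h2 ▸ h1)
  simp [this]

/-- The Hilbert space `L²(X_∞, λ_C)`. -/
abbrev PathL2 {X : Type*} [TopologicalSpace X] [MeasurableSpace X] (ρ : Measure X) (r : X → X)
    {p : ℕ} (c : ZMod p → X) : Type _ :=
  Lp ℂ 2 (lambdaC ρ r c)

lemma memLp_comp_start {X : Type*} [TopologicalSpace X] [MeasurableSpace X] (ρ : Measure X)
    (r : X → X) {p : ℕ} (c : ZMod p → X) {f : X → ℂ} (hf : MemLp f ∞ ρ) :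
    MemLp (fun ω : PathSpace r => f (start ω)) ∞ (lambdaC ρ r c) := by
  have hq := quasiMeasurePreserving_start ρ r c
  have h0 : eLpNormEssSup f ρ ≠ ∞ := by
    have h := hf.2.ne
    rwa [eLpNorm_exponent_top] at h
  have h1 : ∀ᵐ x ∂ρ, ‖f x‖ ≤ (eLpNormEssSup f ρ).toReal := by
    filter_upwards [enorm_ae_le_eLpNormEssSup f ρ] with x hx
    rw [← toReal_enorm]
    exact ENNReal.toReal_mono h0 hx
  exact memLp_top_of_bound (hf.1.comp_quasiMeasurePreserving hq) _ (hq.ae h1)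

/-- The function `f ∘ θ₀ ∈ L^∞(X_∞, λ_C)` for `f ∈ L^∞(X, ρ)`. -/
def liftLinfty {X : Type*} [TopologicalSpace X] [MeasurableSpace X] (ρ : Measure X) (r : X → X)
    {p : ℕ} (c : ZMod p → X) (f : Lp ℂ ∞ ρ) : Lp ℂ ∞ (lambdaC ρ r c) :=
  MemLp.toLp (fun ω => f (start ω)) (memLp_comp_start ρ r c (Lp.memLp f))

/-- The operator `π(f)` on `L²(X_∞, λ_C)`: multiplication by `f ∘ θ₀`. -/
def piRep {X : Type*} [TopologicalSpace X] [MeasurableSpace X] (ρ : Measure X) (r : X → X)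
    {p : ℕ} (c : ZMod p → X) (f : Lp ℂ ∞ ρ) : PathL2 ρ r c →L[ℂ] PathL2 ρ r c :=
  (ContinuousLinearMap.mul ℂ ℂ).holderL (lambdaC ρ r c) ∞ 2 2 (liftLinfty ρ r c f)

lemma coeFn_piRep {X : Type*} [TopologicalSpace X] [MeasurableSpace X] (ρ : Measure X)
    (r : X → X) {p : ℕ} (c : ZMod p → X) (f : Lp ℂ ∞ ρ) (ξ : PathL2 ρ r c) :
    piRep ρ r c f ξ =ᵐ[lambdaC ρ r c] fun ω => f (start ω) * ξ ω := by
  have h1 := (ContinuousLinearMap.mul ℂ ℂ).coeFn_holder (r := 2) (liftLinfty ρ r c f) ξ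
  have h2 : liftLinfty ρ r c f =ᵐ[lambdaC ρ r c] fun ω => f (start ω) := MemLp.coeFn_toLp _
  filter_upwards [h1, h2] with ω h1 h2
  rw [← h2]
  exact h1

/-- The value at `ξ` of the operator `U`, as a function on the path space:
`ω ↦ α_{i(ω)} √(#r⁻¹(r x)) ξ (r̂ ω)`, where `x` is the starting point of `ω`. -/
def scaleFun {X : Type*} [TopologicalSpace X] {r : X → X} {p : ℕ} (c : ZMod p → X)
    (α : ZMod p → ℂ) (ξ : PathSpace r → ℂ) (ω : PathSpace r) : ℂ :=
  α (cycleIndex c ω) * (Real.sqrt (fiberCard r (r (start ω))) : ℂ) * ξ (shift ω)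

/-- The `k`-th factor `α_{i(ω)+k}⁻¹ m₀(z_k) / √(#r⁻¹(r z_k))` of the infinite product. -/
def phiFactor {X : Type*} [TopologicalSpace X] {r : X → X} {p : ℕ} (c : ZMod p → X)
    (α : ZMod p → ℂ) (m₀ : X → ℂ) (ω : PathSpace r) (k : ℕ) : ℂ :=
  (α (cycleIndex c ω + (k : ZMod p)))⁻¹ * m₀ (ω.1 k) / (Real.sqrt (fiberCard r (r (ω.1 k))) : ℂ)

/-- The infinite product `φ̂(ω) = ∏_{k ≥ 1} α_{i(ω)+k}⁻¹ m₀(z_k) / √(#r⁻¹(r z_k))`. -/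
def phiHat {X : Type*} [TopologicalSpace X] {r : X → X} {p : ℕ} (c : ZMod p → X)
    (α : ZMod p → ℂ) (m₀ : X → ℂ) (ω : PathSpace r) : ℂ :=
  ∏' k : ℕ, phiFactor c α m₀ ω (k + 1)

/-- The weight `W(x) = |m₀(x)|² / #r⁻¹(r x)`. -/
def filterWeight {X : Type*} (r : X → X) (m₀ : X → ℂ) (x : X) : ℝ :=
  ‖m₀ x‖ ^ 2 / (fiberCard r (r x) : ℝ)

/-- A `W`-cycle: a cycle on which `W = 1`. -/
def IsWCycle {X : Type*} (r : X → X) (W : X → ℝ) {p : ℕ} (c : ZMod p → X) : Prop :=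
  IsCycle r c ∧ ∀ i, W (c i) = 1

/-- A copy of `X` with the discrete `σ`-algebra. -/
def DiscreteCopy (X : Type*) : Type _ := X

instance {X : Type*} : MeasurableSpace (DiscreteCopy X) := ⊤

/-- The identity map from `X` to its discrete copy. -/
def toCopy {X : Type*} (x : X) : DiscreteCopy X := x

/-- The identity map from the discrete copy of `X` to `X`. -/
def ofCopy {X : Type*} (x : DiscreteCopy X) : X := x

open Classical in
/-- The law of a random preimage of `x` in which `y ∈ r⁻¹(x)` has probability `W(y)`
(a point mass at `x` if the weights `W(y)` do not sum up to `1`). -/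
def stepMeasure {X : Type*} (r : X → X) (W : X → ℝ) (x : X) : Measure (DiscreteCopy X) :=
  if ∑' y : r ⁻¹' {x}, ENNReal.ofReal (W y) = 1 then
    Measure.sum fun y : r ⁻¹' {x} =>
      ENNReal.ofReal (W y) • Measure.dirac (toCopy (y : X))
  else Measure.dirac (toCopy x)

instance {X : Type*} (r : X → X) (W : X → ℝ) (x : X) : IsProbabilityMeasure (stepMeasure r W x) := by
  unfold stepMeasure
  split_ifs with h
  · constructor
    rw [Measure.sum_apply _ MeasurableSet.univ]
    simpa using h
  · infer_instance

/-- The transition from `(z₀, …, z_n)` to `z_{n+1}`, chosen in `r⁻¹(z_n)` with probabilities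
`W(z_{n+1})`. -/
def stepKernel {X : Type*} (r : X → X) (W : X → ℝ) (n : ℕ) :
    Kernel ((i : Finset.Iic n) → DiscreteCopy X) (DiscreteCopy X) where
  toFun z := stepMeasure r W (ofCopy (z ⟨n, Finset.mem_Iic.2 le_rfl⟩))
  measurable' :=
    Measurable.comp (g := fun x : DiscreteCopy X => stepMeasure r W (ofCopy x)) measurable_from_top
      (measurable_pi_apply _)

instance {X : Type*} (r : X → X) (W : X → ℝ) (n : ℕ) : IsMarkovKernel (stepKernel r W n) :=
  ⟨fun z => inferInstanceAs
    (IsProbabilityMeasure (stepMeasure r W (ofCopy (z ⟨n, Finset.mem_Iic.2 le_rfl⟩))))⟩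

/-- The measure `P_x` on paths starting at `x`: the law of the Markov chain `z₀ = x, z₁, z₂, …`
in which `z_{n+1} ∈ r⁻¹(z_n)` is chosen with probability `W(z_{n+1})`, so that the set of the paths
with prescribed `z₁ = a₁, …, z_n = a_n` has measure `W(a₁) ⋯ W(a_n)`. -/
def pathMeasure {X : Type*} [MeasurableSpace X] (r : X → X) (W : X → ℝ) (x : X) :
    Measure (PathSpace r) :=
  ((Kernel.traj (X := fun _ => DiscreteCopy X) (stepKernel r W) 0 (fun _ => toCopy x)).map
    (fun z n => ofCopy (z n))).comap Subtype.val

/-- The harmonic function `h_C(x) = P_x(N_C(x))` associated to the cycle. -/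
def harmonicFun {X : Type*} [TopologicalSpace X] [MeasurableSpace X] (r : X → X) (W : X → ℝ)
    {p : ℕ} (c : ZMod p → X) (x : X) : ℝ :=
  (pathMeasure r W x (cyclePaths r c x)).toReal

/-- The cyclic subspace `V₀`, the closure of `{π(f) φ | f ∈ L^∞(X, ρ)}`. -/
def coreSpace {X : Type*} [TopologicalSpace X] [MeasurableSpace X] (ρ : Measure X) (r : X → X)
    {p : ℕ} (c : ZMod p → X) (φ : PathL2 ρ r c) : Set (PathL2 ρ r c) :=
  closure {η | ∃ f : Lp ℂ ∞ ρ, η = piRep ρ r c f φ}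

/-- The spaces `V_n = U^{-n} V₀`, `n ∈ ℤ`. -/
def resolutionSpace {X : Type*} [TopologicalSpace X] [MeasurableSpace X] (ρ : Measure X)
    (r : X → X) {p : ℕ} (c : ZMod p → X) (U : PathL2 ρ r c ≃ₗᵢ[ℂ] PathL2 ρ r c)
    (φ : PathL2 ρ r c) (n : ℤ) : Set (PathL2 ρ r c) :=
  (U ^ (-n)) '' coreSpace ρ r c φ

end RepellingCycle

end

/-! The weights `W` sum to one over every fibre and are close to one near the cycle, so `r` is
injective near the cycle. A path that tends to the cycle is therefore determined by one sufficiently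
late point. Hence N_C(x) is countable, and λ_C is computed by sums over fibres of iterates of `r`.
Since the cycle is repelling, such a path approaches it exponentially fast along each residue class
modulo `p`. With the low-pass and β-Lipschitz conditions, the factors of φ̂ differ from 1 by
summable errors (`summable_norm_phiFactor_sub_one`).

Strong invariance shows that r̂ carries λ_C to the measure with density 1 / #r⁻¹(θ₀)
(`map_shift_lambdaC`), which makes `U` unitary. The number |φ̂(ω)|² is the limit of W(z₁)⋯W(z_n),
that is, the P_x-mass of the single path ω (`pathMeasure_singleton`). Summing over the countable set
N_C(x) gives h_C(x) ≤ 1, hence φ̂ ∈ L² and the correlation formula.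

Density (`eq_zero_of_orthogonal`): U^{-m} π(f) U^m is multiplication by f(z_m). If ξ is orthogonal
to all V_n, the pointwise product of ξ with the conjugate of U^{-N} φ̂ has integral zero over every
set {z_m ∈ A} with m ≥ N. These sets form a generating π-system, so the product vanishes. But U^{-N}
φ̂(ω) is a nonzero multiple of a tail of the infinite product, which is nonzero for large N.

Trivial intersection: a vector in all V_n gives functions g_n with |g_n| = |m₀| |g_{n+1} ∘ r| where
h_C ≠ 0, and the fibre average of v_n = |g_n|² h_C is v_{n+1}. By Cauchy–Schwarz the fibre mean of
|m₀| √h_C is at most √h_C; let D be the defect. The integrals of |g_{n+1}| D have a finite sum. If D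
does not vanish almost everywhere, ergodicity makes v_n(r^n x) arbitrarily small along almost every
orbit, and the maximal inequality `setLIntegral_exists_lt_le` gives v_0 = 0. If D = 0, equality in
Cauchy–Schwarz gives h_C ∘ r = |m₀|² h_C, and an integral identity shows |m₀| = 1 where h_C ≠ 0.
Then h_C is invariant, hence constant, so either |m₀| = 1 almost everywhere or v_0 = 0. -/

namespace RepellingCycle

/-! ### Fibre averages and strong invariance. -/

section Transfer

variable {X : Type*} {r : X → X}

/-- The sum of `f` over the fibre `r⁻¹(x)`. -/
noncomputable def fiberSum (r : X → X) (f : X → ℝ≥0∞) (x : X) : ℝ≥0∞ := ∑' y : r ⁻¹' {x}, f y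

/-- The mean value of `f` over the fibre `r⁻¹(x)`. -/
noncomputable def fiberAvg (r : X → X) (f : X → ℝ≥0∞) (x : X) : ℝ≥0∞ :=
  (fiberCard r x : ℝ≥0∞)⁻¹ * fiberSum r f x

lemma fiberCard_pos (hs : Function.Surjective r) (hf : ∀ x, (r ⁻¹' {x}).Finite) (x : X) :
    0 < fiberCard r x := by
  rw [fiberCard, Set.ncard_pos (hf x)]
  exact (hs x).imp fun y hy => hy

lemma fiberCard_cast_ne_zero (hs : Function.Surjective r) (hf : ∀ x, (r ⁻¹' {x}).Finite) (x : X) :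
    (fiberCard r x : ℝ≥0∞) ≠ 0 := by
  exact_mod_cast (fiberCard_pos hs hf x).ne'

lemma fiberSum_mono {f g : X → ℝ≥0∞} (h : f ≤ g) (x : X) : fiberSum r f x ≤ fiberSum r g x :=
  ENNReal.tsum_le_tsum fun y => h y

lemma fiberSum_congr {f g : X → ℝ≥0∞} {x : X} (h : ∀ y, r y = x → f y = g y) :
    fiberSum r f x = fiberSum r g x :=
  tsum_congr fun y => h y y.2

lemma fiberSum_add (f g : X → ℝ≥0∞) (x : X) :
    fiberSum r (f + g) x = fiberSum r f x + fiberSum r g x :=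
  ENNReal.tsum_add

lemma fiberSum_const_mul (a : ℝ≥0∞) (f : X → ℝ≥0∞) (x : X) :
    fiberSum r (fun y => a * f y) x = a * fiberSum r f x :=
  ENNReal.tsum_mul_left

lemma fiberSum_comp_mul (f g : X → ℝ≥0∞) (x : X) :
    fiberSum r (fun y => g (r y) * f y) x = g x * fiberSum r f x := by
  rw [← fiberSum_const_mul]
  exact fiberSum_congr fun y hy => by rw [hy]

lemma fiberSum_eq_sum (hf : ∀ x, (r ⁻¹' {x}).Finite) (f : X → ℝ≥0∞) (x : X) :
    fiberSum r f x = ∑ y ∈ (hf x).toFinset, f y := by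
  have := (hf x).fintype
  rw [fiberSum, tsum_fintype, ← Finset.sum_coe_sort (hf x).toFinset]
  refine Finset.sum_bij' (fun y _ => ⟨y, by simp⟩) (fun y _ => ⟨y, by simpa using y.2⟩)
    ?_ ?_ ?_ ?_ ?_ <;> simp

lemma fiberCard_eq_card (hf : ∀ x, (r ⁻¹' {x}).Finite) (x : X) :
    fiberCard r x = (hf x).toFinset.card :=
  Set.ncard_eq_toFinset_card _ (hf x)

lemma fiberSum_one (hf : ∀ x, (r ⁻¹' {x}).Finite) (x : X) :
    fiberSum r (fun _ => 1) x = fiberCard r x := by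
  rw [fiberSum_eq_sum hf, fiberCard_eq_card hf]
  simp

lemma fiberSum_iSup (hf : ∀ x, (r ⁻¹' {x}).Finite) {f : ℕ → X → ℝ≥0∞} (hmono : Monotone f)
    (x : X) : fiberSum r (fun y => ⨆ n, f n y) x = ⨆ n, fiberSum r (f n) x := by
  simp only [fiberSum_eq_sum hf]
  exact ENNReal.finsetSum_iSup_of_monotone fun y _ _ h => hmono h y

lemma fiberAvg_mono {f g : X → ℝ≥0∞} (h : f ≤ g) (x : X) : fiberAvg r f x ≤ fiberAvg r g x := by
  unfold fiberAvg
  gcongr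
  exact fiberSum_mono h x

lemma fiberAvg_congr {f g : X → ℝ≥0∞} {x : X} (h : ∀ y, r y = x → f y = g y) :
    fiberAvg r f x = fiberAvg r g x := by
  rw [fiberAvg, fiberSum_congr h, fiberAvg]

lemma fiberAvg_add (f g : X → ℝ≥0∞) (x : X) :
    fiberAvg r (f + g) x = fiberAvg r f x + fiberAvg r g x := by
  simp only [fiberAvg, fiberSum_add, mul_add]

lemma fiberAvg_comp_mul (f g : X → ℝ≥0∞) (x : X) :
    fiberAvg r (fun y => g (r y) * f y) x = g x * fiberAvg r f x := by
  simp only [fiberAvg, fiberSum_comp_mul, mul_left_comm]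

lemma fiberAvg_const_mul (a : ℝ≥0∞) (f : X → ℝ≥0∞) (x : X) :
    fiberAvg r (fun y => a * f y) x = a * fiberAvg r f x := by
  simp only [fiberAvg, fiberSum_const_mul, mul_left_comm]

lemma fiberAvg_one (hs : Function.Surjective r) (hf : ∀ x, (r ⁻¹' {x}).Finite) (x : X) :
    fiberAvg r (fun _ => 1) x = 1 := by
  rw [fiberAvg, fiberSum_one hf]
  exact ENNReal.inv_mul_cancel (fiberCard_cast_ne_zero hs hf x) (ENNReal.natCast_ne_top _)

lemma fiberAvg_comp (hs : Function.Surjective r) (hf : ∀ x, (r ⁻¹' {x}).Finite)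
    (g : X → ℝ≥0∞) (x : X) : fiberAvg r (fun y => g (r y)) x = g x := by
  simpa [fiberAvg_one hs hf] using fiberAvg_comp_mul (r := r) (fun _ => 1) g x

lemma fiberSum_eq_card_mul_fiberAvg (hs : Function.Surjective r) (hf : ∀ x, (r ⁻¹' {x}).Finite)
    (f : X → ℝ≥0∞) (x : X) : fiberSum r f x = fiberCard r x * fiberAvg r f x := by
  rw [fiberAvg, ← mul_assoc, ENNReal.mul_inv_cancel (fiberCard_cast_ne_zero hs hf x)
    (ENNReal.natCast_ne_top _), one_mul]

lemma fiberAvg_iSup (hf : ∀ x, (r ⁻¹' {x}).Finite) {f : ℕ → X → ℝ≥0∞} (hmono : Monotone f)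
    (x : X) : fiberAvg r (fun y => ⨆ n, f n y) x = ⨆ n, fiberAvg r (f n) x := by
  simp only [fiberAvg, fiberSum_iSup hf hmono, ENNReal.mul_iSup]

lemma fiberAvg_eq_zero_iff {f : X → ℝ≥0∞} {x : X} :
    fiberAvg r f x = 0 ↔ ∀ y, r y = x → f y = 0 := by
  simp [fiberAvg, fiberSum, ENNReal.tsum_eq_zero]

open Classical in
lemma fiberAvg_indicator_toReal (hf : ∀ x, (r ⁻¹' {x}).Finite) (A : Set X) (x : X) :
    (1 / (fiberCard r x : ℂ)) * ∑ᶠ y ∈ r ⁻¹' {x}, A.indicator (fun _ => (1 : ℂ)) y =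
      ((fiberAvg r (A.indicator fun _ => 1) x).toReal : ℂ) := by
  rw [fiberAvg, fiberSum_eq_sum hf, finsum_mem_eq_finite_toFinset_sum _ (hf x)]
  simp only [Set.indicator_apply, Finset.sum_ite, Finset.sum_const_zero, add_zero,
    Finset.sum_const, nsmul_eq_mul, mul_one, ENNReal.toReal_mul, ENNReal.toReal_inv,
    ENNReal.toReal_natCast]
  push_cast
  rw [one_div]

lemma fiberAvg_indicator_le_one (hs : Function.Surjective r) (hf : ∀ x, (r ⁻¹' {x}).Finite)
    (A : Set X) (x : X) : fiberAvg r (A.indicator fun _ => 1) x ≤ 1 := by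
  refine (fiberAvg_mono (g := fun _ => 1) (fun y => ?_) x).trans_eq (fiberAvg_one hs hf x)
  exact Set.indicator_le_self' (fun _ _ => zero_le) y

lemma fiberAvg_indicator_add_compl (hs : Function.Surjective r)
    (hf : ∀ x, (r ⁻¹' {x}).Finite) (A : Set X) (x : X) :
    fiberAvg r (A.indicator fun _ => 1) x + fiberAvg r (Aᶜ.indicator fun _ => 1) x = 1 := by
  rw [← fiberAvg_add, Set.indicator_self_add_compl, fiberAvg_one hs hf x]

variable [MeasurableSpace X] {ρ : Measure X} [IsProbabilityMeasure ρ]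

namespace IsStronglyInvariant

variable (hρ : IsStronglyInvariant r ρ) (hs : Function.Surjective r)
  (hf : ∀ x, (r ⁻¹' {x}).Finite)

include hρ hf in
lemma integral_fiberAvg_indicator {A : Set X} (hA : MeasurableSet A) :
    ∫ x, ((fiberAvg r (A.indicator fun _ => 1) x).toReal : ℂ) ∂ρ = (ρ.real A : ℂ) := by
  have h := hρ (A.indicator fun _ => 1) (memLp_indicator_const _ hA _ (Or.inr (measure_ne_top ρ A)))
  simp only [fiberAvg_indicator_toReal hf] at h
  rw [← h, integral_indicator_const _ hA]
  simp

include hρ hs hf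

/-- Measurability is extracted from the convention that a nonintegrable function has Bochner
integral zero: a set of nonzero measure must have an integrable fibre average. For a null set one
passes to the complement. -/
lemma aemeasurable_fiberAvg_indicator {A : Set X} (hA : MeasurableSet A) :
    AEMeasurable (fiberAvg r (A.indicator fun _ => 1)) ρ := by
  have key : ∀ {B : Set X}, MeasurableSet B → ρ.real B ≠ 0 →
      AEMeasurable (fiberAvg r (B.indicator fun _ => 1)) ρ := by
    intro B hB hB0
    have h := hρ.integral_fiberAvg_indicator hf hB
    have hint : Integrable
        (fun x => ((fiberAvg r (B.indicator fun _ => 1) x).toReal : ℂ)) ρ := by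
      by_contra hn
      rw [integral_undef hn] at h
      exact hB0 (by exact_mod_cast h.symm)
    have h2 : AEMeasurable (fun x => ENNReal.ofReal
        ((fiberAvg r (B.indicator fun _ => 1) x).toReal : ℂ).re) ρ :=
      (Complex.measurable_re.comp_aemeasurable hint.aemeasurable).ennreal_ofReal
    refine h2.congr (Eventually.of_forall fun x => ?_)
    simp only [Complex.ofReal_re]
    exact ENNReal.ofReal_toReal
      (ne_top_of_le_ne_top ENNReal.one_ne_top (fiberAvg_indicator_le_one hs hf B x))
  by_cases h0 : ρ.real A = 0
  · have h1 : ρ.real Aᶜ ≠ 0 := by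
      rw [probReal_compl_eq_one_sub hA, h0]
      norm_num
    have h2 := key hA.compl h1
    have h3 : fiberAvg r (A.indicator fun _ => 1) =
        fun x => 1 - fiberAvg r (Aᶜ.indicator fun _ => 1) x := by
      funext x
      refine ENNReal.eq_sub_of_add_eq
        (ne_top_of_le_ne_top ENNReal.one_ne_top (fiberAvg_indicator_le_one hs hf _ x)) ?_
      exact fiberAvg_indicator_add_compl hs hf A x
    rw [h3]
    exact aemeasurable_const.sub h2
  · exact key hA h0

lemma lintegral_fiberAvg_indicator {A : Set X} (hA : MeasurableSet A) :
    ∫⁻ x, fiberAvg r (A.indicator fun _ => 1) x ∂ρ = ρ A := by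
  have h := hρ.integral_fiberAvg_indicator hf hA
  rw [integral_complex_ofReal] at h
  have h' : ∫ x, (fiberAvg r (A.indicator fun _ => 1) x).toReal ∂ρ = ρ.real A := by
    exact_mod_cast h
  rw [integral_toReal (hρ.aemeasurable_fiberAvg_indicator hs hf hA)
    (Eventually.of_forall fun x => (fiberAvg_indicator_le_one hs hf A x).trans_lt
      ENNReal.one_lt_top)] at h'
  refine (ENNReal.toReal_eq_toReal_iff' ?_ (measure_ne_top _ _)).1 h'
  refine ne_top_of_le_ne_top ENNReal.one_ne_top
    ((lintegral_mono fun x => fiberAvg_indicator_le_one hs hf A x).trans ?_)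
  simp

lemma aemeasurable_and_lintegral_fiberAvg {f : X → ℝ≥0∞} (hfm : Measurable f) :
    AEMeasurable (fiberAvg r f) ρ ∧ ∫⁻ x, fiberAvg r f x ∂ρ = ∫⁻ x, f x ∂ρ := by
  refine Measurable.ennreal_induction (motive := fun f => AEMeasurable (fiberAvg r f) ρ ∧
    ∫⁻ x, fiberAvg r f x ∂ρ = ∫⁻ x, f x ∂ρ) ?_ ?_ ?_ hfm
  · intro a s hsm
    have h1 : fiberAvg r (s.indicator fun _ => a) =
        fun x => a * fiberAvg r (s.indicator fun _ => 1) x := by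
      funext x
      rw [← fiberAvg_const_mul]
      refine fiberAvg_congr fun y _ => ?_
      by_cases hy : y ∈ s <;> simp [hy]
    have h2 := hρ.aemeasurable_fiberAvg_indicator hs hf hsm
    rw [h1]
    refine ⟨h2.const_mul a, ?_⟩
    rw [lintegral_const_mul'' _ h2, hρ.lintegral_fiberAvg_indicator hs hf hsm,
      lintegral_indicator_const hsm]
  · intro f g _ hfm hgm hf' hg'
    have h1 : fiberAvg r (f + g) = fiberAvg r f + fiberAvg r g := funext fun x => fiberAvg_add f g x
    rw [h1]
    refine ⟨hf'.1.add hg'.1, ?_⟩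
    simp only [Pi.add_apply]
    rw [lintegral_add_left' hf'.1, lintegral_add_left hfm, hf'.2, hg'.2]
  · intro f hfm hmono hf'
    have h1 : fiberAvg r (fun x => ⨆ n, f n x) = fun x => ⨆ n, fiberAvg r (f n) x :=
      funext fun x => fiberAvg_iSup hf hmono x
    rw [h1]
    refine ⟨AEMeasurable.iSup fun n => (hf' n).1, ?_⟩
    rw [lintegral_iSup' (fun n => (hf' n).1)
      (Eventually.of_forall fun x m n hmn => fiberAvg_mono (hmono hmn) x),
      lintegral_iSup hfm hmono]
    exact iSup_congr fun n => (hf' n).2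

/-- A `ρ`-null set meets almost no fibre. -/
lemma ae_fiber {P : X → Prop} (h : ∀ᵐ y ∂ρ, P y) : ∀ᵐ x ∂ρ, ∀ y, r y = x → P y := by
  obtain ⟨N, hN, hNm, hN0⟩ := exists_measurable_superset_of_null (ae_iff.1 h)
  have h1 := hρ.aemeasurable_fiberAvg_indicator hs hf hNm
  have h2 := hρ.lintegral_fiberAvg_indicator hs hf hNm
  rw [hN0, lintegral_eq_zero_iff' h1] at h2
  filter_upwards [h2] with x hx y hy
  have h3 := fiberAvg_eq_zero_iff.1 hx y hy
  by_contra hP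
  have : y ∈ N := hN hP
  simp [this] at h3

lemma fiberAvg_ae_eq {f g : X → ℝ≥0∞} (h : f =ᵐ[ρ] g) : fiberAvg r f =ᵐ[ρ] fiberAvg r g := by
  filter_upwards [hρ.ae_fiber hs hf h] with x hx
  exact fiberAvg_congr hx

lemma aemeasurable_fiberAvg {f : X → ℝ≥0∞} (hfm : AEMeasurable f ρ) :
    AEMeasurable (fiberAvg r f) ρ :=
  (hρ.aemeasurable_and_lintegral_fiberAvg hs hf hfm.measurable_mk).1.congr
    (hρ.fiberAvg_ae_eq hs hf hfm.ae_eq_mk.symm)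

lemma lintegral_fiberAvg {f : X → ℝ≥0∞} (hfm : AEMeasurable f ρ) :
    ∫⁻ x, fiberAvg r f x ∂ρ = ∫⁻ x, f x ∂ρ := by
  rw [lintegral_congr_ae (hρ.fiberAvg_ae_eq hs hf hfm.ae_eq_mk), lintegral_congr_ae hfm.ae_eq_mk]
  exact (hρ.aemeasurable_and_lintegral_fiberAvg hs hf hfm.measurable_mk).2

lemma measurePreserving (hr : Measurable r) : MeasurePreserving r ρ ρ := by
  refine ⟨hr, Measure.ext fun A hA => ?_⟩
  rw [Measure.map_apply hr hA, ← hρ.lintegral_fiberAvg_indicator hs hf (hr hA),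
    ← lintegral_indicator_one hA]
  refine lintegral_congr fun x => ?_
  exact fiberAvg_comp hs hf (A.indicator 1) x

end IsStronglyInvariant

end Transfer

/-! ### Measurability of the number of preimages. -/

section TransferTopological

variable {X : Type*} {r : X → X} [TopologicalSpace X] [T2Space X] [SecondCountableTopology X]
  [MeasurableSpace X] [BorelSpace X] {ρ : Measure X} [IsProbabilityMeasure ρ]

open Classical in
omit [MeasurableSpace X] [BorelSpace X] in
-- A nonzero average of an indicator is at least `1 / #r⁻¹(x)`, and some basic open set meets the
-- finite fibre in exactly one point. The value `∞` discards the sets that miss the fibre. The point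
-- is that only countably many almost everywhere measurable functions occur.
lemma inv_fiberCard_eq_iInf (hs : Function.Surjective r) (hf : ∀ x, (r ⁻¹' {x}).Finite) (x : X) :
    (fiberCard r x : ℝ≥0∞)⁻¹ = ⨅ U : TopologicalSpace.countableBasis X,
      if fiberAvg r ((U : Set X).indicator fun _ => 1) x = 0 then ∞
      else fiberAvg r ((U : Set X).indicator fun _ => 1) x := by
  apply le_antisymm
  · refine le_iInf fun U => ?_
    split_ifs with h
    · exact le_top
    · rw [fiberAvg_eq_zero_iff] at h
      push Not at h
      obtain ⟨y, hy, hy0⟩ := h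
      rw [fiberAvg]
      refine le_mul_of_one_le_right' ?_
      refine le_trans ?_ (ENNReal.le_tsum (⟨y, hy⟩ : r ⁻¹' {x}))
      by_cases hU : y ∈ (U : Set X)
      · simp [hU]
      · simp [hU] at hy0
  · obtain ⟨y, hy⟩ := hs x
    have hopen : IsOpen (r ⁻¹' {x} \ {y})ᶜ := ((hf x).sdiff).isClosed.isOpen_compl
    obtain ⟨U, hU, hyU, hUsub⟩ := (TopologicalSpace.isBasis_countableBasis X).exists_subset_of_mem_open
      (show y ∈ (r ⁻¹' {x} \ {y})ᶜ by simp) hopen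
    refine (iInf_le _ ⟨U, hU⟩).trans ?_
    have h1 : fiberAvg r (U.indicator fun _ => 1) x = (fiberCard r x : ℝ≥0∞)⁻¹ := by
      rw [fiberAvg, fiberSum, tsum_eq_single (⟨y, hy⟩ : r ⁻¹' {x})]
      · simp [hyU]
      · rintro ⟨z, hz⟩ hzy
        refine Set.indicator_of_notMem (fun hzU => hUsub hzU ⟨hz, ?_⟩) _
        exact fun h => hzy (Subtype.ext h)
    simp only [h1]
    split_ifs with h
    · simp at h
    · exact le_rfl

lemma IsStronglyInvariant.aemeasurable_fiberCard (hρ : IsStronglyInvariant r ρ)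
    (hs : Function.Surjective r) (hf : ∀ x, (r ⁻¹' {x}).Finite) :
    AEMeasurable (fun x => (fiberCard r x : ℝ≥0∞)) ρ := by
  classical
  have h1 : AEMeasurable (fun x => (fiberCard r x : ℝ≥0∞)⁻¹) ρ := by
    simp only [inv_fiberCard_eq_iInf hs hf]
    refine AEMeasurable.iInf fun U => ?_
    have h2 := hρ.aemeasurable_fiberAvg_indicator hs hf
      (TopologicalSpace.isOpen_of_mem_countableBasis U.2).measurableSet
    have h3 : Measurable fun t : ℝ≥0∞ => if t = 0 then ∞ else t :=
      Measurable.ite (measurableSet_singleton 0) measurable_const measurable_id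
    exact h3.comp_aemeasurable h2
  exact h1.inv.congr (Eventually.of_forall fun x => inv_inv _)

lemma IsStronglyInvariant.aemeasurable_fiberSum (hρ : IsStronglyInvariant r ρ)
    (hs : Function.Surjective r) (hf : ∀ x, (r ⁻¹' {x}).Finite) {f : X → ℝ≥0∞}
    (hfm : AEMeasurable f ρ) : AEMeasurable (fiberSum r f) ρ := by
  have : fiberSum r f = fun x => (fiberCard r x : ℝ≥0∞) * fiberAvg r f x :=
    funext fun x => fiberSum_eq_card_mul_fiberAvg hs hf f x
  rw [this]
  exact (hρ.aemeasurable_fiberCard hs hf).mul (hρ.aemeasurable_fiberAvg hs hf hfm)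

end TransferTopological


/-! ### Fibre sums of iterates. -/

section FiberIterate

/-- Sums over the preimage of a set, fibre by fibre. -/
lemma ENNReal_tsum_preimage {α β : Type*} (s : α → β) (S : Set β) (f : α → ℝ≥0∞) :
    ∑' a : s ⁻¹' S, f a = ∑' b : S, ∑' a : s ⁻¹' {(b : β)}, f a := by
  rw [← ENNReal.tsum_sigma' (fun q : (b : S) × (s ⁻¹' {(b : β)}) => f q.2)]
  let e : ((b : S) × (s ⁻¹' {(b : β)})) ≃ s ⁻¹' S :=
    { toFun := fun q => ⟨q.2, by
        have h := q.2.2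
        simp only [mem_preimage, mem_singleton_iff] at h
        simp [h]⟩
      invFun := fun a => ⟨⟨s a, a.2⟩, ⟨a, rfl⟩⟩
      left_inv := by
        rintro ⟨⟨b, hb⟩, ⟨a, ha⟩⟩
        simp only [mem_preimage, mem_singleton_iff] at ha
        subst ha
        rfl
      right_inv := fun _ => rfl }
  exact (e.tsum_eq (fun a : s ⁻¹' S => f a)).symm

lemma fiberSum_comp {X : Type*} (r s : X → X) (f : X → ℝ≥0∞) (x : X) :
    fiberSum (r ∘ s) f x = fiberSum r (fiberSum s f) x := by
  unfold fiberSum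
  rw [preimage_comp]
  exact ENNReal_tsum_preimage s _ f

lemma finite_iterate_fiber {X : Type*} {r : X → X} (hf : ∀ x, (r ⁻¹' {x}).Finite) (n : ℕ) (x : X) :
    (r^[n] ⁻¹' {x}).Finite := by
  induction n generalizing x with
  | zero => simp
  | succ n ih =>
    rw [Function.iterate_succ, preimage_comp]
    exact (ih x).preimage' fun y _ => hf y

lemma IsStronglyInvariant.aemeasurable_fiberSum_iterate {X : Type*} {r : X → X}
    [TopologicalSpace X] [T2Space X] [SecondCountableTopology X] [MeasurableSpace X] [BorelSpace X]
    {ρ : Measure X} [IsProbabilityMeasure ρ] (hρ : IsStronglyInvariant r ρ)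
    (hs : Function.Surjective r) (hf : ∀ x, (r ⁻¹' {x}).Finite) (n : ℕ) {f : X → ℝ≥0∞}
    (hfm : AEMeasurable f ρ) : AEMeasurable (fiberSum (r^[n]) f) ρ := by
  induction n with
  | zero =>
    refine hfm.congr (Eventually.of_forall fun x => ?_)
    simp only [fiberSum, Function.iterate_zero, preimage_id]
    exact (tsum_singleton x f).symm
  | succ n ih =>
    have : fiberSum (r^[n + 1]) f = fiberSum r (fiberSum (r^[n]) f) := by
      funext x
      rw [Function.iterate_succ', fiberSum_comp]
    rw [this]
    exact hρ.aemeasurable_fiberSum hs hf ih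

end FiberIterate

/-! ### The path space and the inverse of the shift. -/

section Paths

variable {X : Type*} {r : X → X}

/-- The inverse `(z₀, z₁, …) ↦ (z₁, z₂, …)` of `shift`. -/
def unshift (ω : PathSpace r) : PathSpace r := ⟨fun n => ω.1 (n + 1), fun n => ω.2 (n + 1)⟩

lemma shift_apply (ω : PathSpace r) (n : ℕ) : (shift ω).1 n = r (ω.1 n) := by
  cases n with
  | zero => rfl
  | succ n => exact (ω.2 n).symm

lemma shift_apply_succ (ω : PathSpace r) (n : ℕ) : (shift ω).1 (n + 1) = ω.1 n := rfl

lemma unshift_apply (ω : PathSpace r) (n : ℕ) : (unshift ω).1 n = ω.1 (n + 1) := rfl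

@[simp] lemma start_shift (ω : PathSpace r) : start (shift ω) = r (start ω) := rfl

@[simp] lemma unshift_shift (ω : PathSpace r) : unshift (shift ω) = ω := rfl

@[simp] lemma shift_unshift (ω : PathSpace r) : shift (unshift ω) = ω := by
  apply Subtype.ext
  funext n
  rw [shift_apply, unshift_apply, ω.2]

lemma r_start_unshift (ω : PathSpace r) : r (start (unshift ω)) = start ω := ω.2 0

lemma iterate_unshift_apply (ω : PathSpace r) (n k : ℕ) : (unshift^[n] ω).1 k = ω.1 (k + n) := by
  induction n generalizing k with
  | zero => rfl
  | succ n ih => 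
    rw [Function.iterate_succ_apply', unshift_apply, ih, show k + 1 + n = k + (n + 1) by omega]

lemma iterate_path (ω : PathSpace r) (n k : ℕ) : r^[k] (ω.1 (n + k)) = ω.1 n := by
  induction k with
  | zero => rfl
  | succ k ih => rw [Function.iterate_succ_apply, ← add_assoc, ω.2, ih]

lemma iterate_eq_start (ω : PathSpace r) (k : ℕ) : r^[k] (ω.1 k) = start ω := by
  simpa [start] using iterate_path ω 0 k

variable [MeasurableSpace X]

lemma measurable_path_apply (n : ℕ) : Measurable fun ω : PathSpace r => ω.1 n :=
  (measurable_pi_apply n).comp measurable_subtype_coe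

lemma measurable_unshift : Measurable (unshift : PathSpace r → PathSpace r) :=
  (measurable_pi_lambda _ fun n => measurable_path_apply (n + 1)).subtype_mk

lemma measurable_shift (hr : Measurable r) : Measurable (shift : PathSpace r → PathSpace r) := by
  refine Measurable.subtype_mk (measurable_pi_lambda _ fun n => ?_)
  cases n with
  | zero => exact hr.comp (measurable_path_apply 0)
  | succ n => exact measurable_path_apply n

lemma measurableSet_pathSpace [MeasurableEq X] (hr : Measurable r) :
    MeasurableSet {z : ℕ → X | ∀ n, r (z (n + 1)) = z n} := by
  simp only [ofPred_forall]
  exact MeasurableSet.iInter fun n =>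
    measurableSet_eq_fun (hr.comp (measurable_pi_apply _)) (measurable_pi_apply _)

lemma standardBorelSpace_pathSpace [StandardBorelSpace X] (hr : Measurable r) :
    StandardBorelSpace (PathSpace r) :=
  (measurableSet_pathSpace hr).standardBorel

end Paths

/-! ### Paths that tend to the cycle. -/

section CyclePaths

variable {X : Type*} {r : X → X} {p : ℕ}

/-- The set of all paths that tend to the cycle. -/
def pathsToCycle [TopologicalSpace X] (r : X → X) (c : ZMod p → X) : Set (PathSpace r) :=
  {ω | ∃ i, Tendsto (fun n : ℕ => ω.1 (p * n)) atTop (𝓝 (c i))}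

lemma cyclePaths_eq [TopologicalSpace X] (c : ZMod p → X) (x : X) :
    cyclePaths r c x = start ⁻¹' {x} ∩ pathsToCycle r c := rfl

lemma cycleIndex_spec [TopologicalSpace X] {c : ZMod p → X} {ω : PathSpace r}
    (h : ω ∈ pathsToCycle r c) :
    Tendsto (fun n : ℕ => ω.1 (p * n)) atTop (𝓝 (c (cycleIndex c ω))) := by
  have h' : ∃ i, Tendsto (fun n : ℕ => ω.1 (p * n)) atTop (𝓝 (c i)) := h
  rw [cycleIndex, dif_pos h']
  exact h'.choose_spec

lemma cycleIndex_of_notMem [TopologicalSpace X] {c : ZMod p → X} {ω : PathSpace r}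
    (h : ω ∉ pathsToCycle r c) : cycleIndex c ω = 0 :=
  dif_neg h

lemma cycleIndex_eq [TopologicalSpace X] [T2Space X] {c : ZMod p → X} (hc : IsCycle r c)
    {ω : PathSpace r} {i : ZMod p} (h : Tendsto (fun n : ℕ => ω.1 (p * n)) atTop (𝓝 (c i))) :
    cycleIndex c ω = i :=
  hc.1 (tendsto_nhds_unique (cycleIndex_spec ⟨i, h⟩) h)

lemma IsCycle.map {c : ZMod p → X} (hc : IsCycle r c) (i : ZMod p) : r (c i) = c (i - 1) := by
  simpa using hc.2 (i - 1)

section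

variable [TopologicalSpace X] {c : ZMod p → X} (hc : IsCycle r c)
  (hr_cont : ∀ i, ContinuousAt r (c i))

include hc hr_cont

lemma tendsto_iterate_cycle {ι : Type*} {l : Filter ι} {u : ι → X} {i : ZMod p}
    (h : Tendsto u l (𝓝 (c i))) (k : ℕ) :
    Tendsto (fun n => r^[k] (u n)) l (𝓝 (c (i - k))) := by
  induction k with
  | zero => simpa using h
  | succ k ih =>
    simp only [Function.iterate_succ_apply']
    have h1 := (hr_cont (i - k)).tendsto.comp ih
    rw [hc.map] at h1
    have h2 : i - ((k + 1 : ℕ) : ZMod p) = i - k - 1 := by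
      rw [Nat.cast_succ, sub_sub]
    rw [h2]
    exact h1

/-- The points with index off the multiples of `p` are images of later points with index on them,
`z_{pn+j} = r^{pj-j}(z_{p(n+j)})`, so continuity at the cycle transports the limit. -/
lemma tendsto_path_residue [NeZero p] {ω : PathSpace r} {i : ZMod p}
    (h : Tendsto (fun n : ℕ => ω.1 (p * n)) atTop (𝓝 (c i))) (j : ℕ) :
    Tendsto (fun n : ℕ => ω.1 (p * n + j)) atTop (𝓝 (c (i + j))) := by
  have hp : 1 ≤ p := NeZero.one_le
  have hj : j ≤ p * j := Nat.le_mul_of_pos_left j hp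
  have h1 := tendsto_iterate_cycle hc hr_cont (h.comp (tendsto_add_atTop_nat j)) (p * j - j)
  have h2 : i - ((p * j - j : ℕ) : ZMod p) = i + j := by
    rw [Nat.cast_sub hj]
    simp
  rw [h2] at h1
  refine h1.congr fun n => ?_
  have h3 : p * (n + j) = p * n + j + (p * j - j) := by
    rw [mul_add, add_assoc, Nat.add_sub_cancel' hj]
  rw [← iterate_path ω (p * n + j) (p * j - j), Function.comp_apply, h3]

lemma mem_pathsToCycle_shift {ω : PathSpace r} (h : ω ∈ pathsToCycle r c) :
    Tendsto (fun n : ℕ => (shift ω).1 (p * n)) atTop (𝓝 (c (cycleIndex c ω - 1))) := by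
  simpa [shift_apply] using tendsto_iterate_cycle hc hr_cont (cycleIndex_spec h) 1

lemma mem_pathsToCycle_unshift [NeZero p] {ω : PathSpace r} (h : ω ∈ pathsToCycle r c) :
    Tendsto (fun n : ℕ => (unshift ω).1 (p * n)) atTop (𝓝 (c (cycleIndex c ω + 1))) := by
  have h1 := tendsto_path_residue hc hr_cont (cycleIndex_spec h) 1
  rwa [Nat.cast_one] at h1

lemma shift_mem_pathsToCycle_iff [NeZero p] {ω : PathSpace r} :
    shift ω ∈ pathsToCycle r c ↔ ω ∈ pathsToCycle r c :=
  ⟨fun h => ⟨_, mem_pathsToCycle_unshift hc hr_cont h⟩,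
    fun h => ⟨_, mem_pathsToCycle_shift hc hr_cont h⟩⟩

lemma unshift_mem_pathsToCycle_iff [NeZero p] {ω : PathSpace r} :
    unshift ω ∈ pathsToCycle r c ↔ ω ∈ pathsToCycle r c := by
  rw [← shift_mem_pathsToCycle_iff hc hr_cont, shift_unshift]

lemma cycleIndex_shift [T2Space X] {ω : PathSpace r} (h : ω ∈ pathsToCycle r c) :
    cycleIndex c (shift ω) = cycleIndex c ω - 1 :=
  cycleIndex_eq hc (mem_pathsToCycle_shift hc hr_cont h)

omit hc hr_cont in
lemma eventually_of_residues [NeZero p] {P : ℕ → Prop}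
    (h : ∀ j : ℕ, ∀ᶠ n in atTop, P (p * n + j)) : ∀ᶠ n in atTop, P n := by
  have h1 : ∀ᶠ n in atTop, ∀ j ∈ Finset.range p, P (p * n + j) :=
    (eventually_all_finset _).2 fun j _ => h j
  filter_upwards [(Nat.tendsto_div_const_atTop (NeZero.ne p)).eventually h1] with n hn
  simpa [Nat.div_add_mod] using hn (n % p) (Finset.mem_range.2 (Nat.mod_lt _ (NeZero.pos p)))

lemma eventually_mem_of_pathsToCycle [NeZero p] {ω : PathSpace r} (h : ω ∈ pathsToCycle r c)
    {B : Set X} (hB : ∀ i, B ∈ 𝓝 (c i)) : ∀ᶠ n in atTop, ω.1 n ∈ B :=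
  eventually_of_residues fun j =>
    (tendsto_path_residue hc hr_cont (cycleIndex_spec h) j).eventually (hB _)

/-- Sums over `N_C(x)`, decomposed according to the first step of the paths. -/
lemma tsum_cyclePaths [NeZero p] (F : PathSpace r → ℝ≥0∞) (x : X) :
    ∑' ω : cyclePaths r c x, F ω =
      fiberSum r (fun y => ∑' ω : cyclePaths r c y, F (shift ω)) x := by
  let e : ((start : PathSpace r → X) ⁻¹' (r ⁻¹' {x}) ∩ pathsToCycle r c : Set _) ≃
      cyclePaths r c x :=
    { toFun := fun ω => ⟨shift ω, ω.2.1, (shift_mem_pathsToCycle_iff hc hr_cont).2 ω.2.2⟩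
      invFun := fun ω => ⟨unshift ω, (r_start_unshift _).trans ω.2.1,
        (unshift_mem_pathsToCycle_iff hc hr_cont).2 ω.2.2⟩
      left_inv := fun ω => rfl
      right_inv := fun ω => Subtype.ext (shift_unshift _) }
  have ind : ∀ (S : Set X) (G : PathSpace r → ℝ≥0∞),
      ∑' ω : ((start : PathSpace r → X) ⁻¹' S ∩ pathsToCycle r c : Set _), G ω =
      ∑' ω : ((start : PathSpace r → X) ⁻¹' S), (pathsToCycle r c).indicator G ω := by
    intro S G
    rw [tsum_subtype _ G, tsum_subtype _ ((pathsToCycle r c).indicator G), indicator_indicator]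
  rw [← e.tsum_eq (fun ω : cyclePaths r c x => F ω)]
  refine (ind (r ⁻¹' {x}) (fun ω => F (shift ω))).trans ?_
  rw [ENNReal_tsum_preimage]
  exact tsum_congr fun y => (ind {(y : X)} _).symm

end

/-- The paths that tend to the cycle and stay in `B` from time `n + 1` on. -/
def eventualPaths [TopologicalSpace X] (r : X → X) (c : ZMod p → X) (B : Set X) (n : ℕ) :
    Set (PathSpace r) :=
  pathsToCycle r c ∩ {ω | ∀ k, n < k → ω.1 k ∈ B}

/-- After time `n` injectivity of `r` on `B` leaves no choice of preimage; before time `n` the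
points are images under iterates of `r`. -/
lemma injOn_eventualPaths [TopologicalSpace X] {c : ZMod p → X} {B : Set X} (hB : InjOn r B)
    (n : ℕ) : InjOn (fun ω : PathSpace r => ω.1 n) (eventualPaths r c B n) := by
  intro ω hω ω' hω' h
  have h1 : ∀ k, n ≤ k → ω.1 k = ω'.1 k := by
    intro k hk
    induction k, hk using Nat.le_induction with
    | base => exact h
    | succ k hk ih =>
      refine hB (hω.2 _ (by omega)) (hω'.2 _ (by omega)) ?_
      rw [ω.2, ω'.2, ih]
  apply Subtype.ext
  funext k
  rw [← iterate_path ω k n, ← iterate_path ω' k n, h1 _ (by omega)]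

lemma iUnion_eventualPaths [TopologicalSpace X] [NeZero p] {c : ZMod p → X} (hc : IsCycle r c)
    (hr_cont : ∀ i, ContinuousAt r (c i)) {B : Set X} (hB : ∀ i, B ∈ 𝓝 (c i)) :
    ⋃ n, eventualPaths r c B n = pathsToCycle r c := by
  refine subset_antisymm (iUnion_subset fun n => inter_subset_left) fun ω hω => ?_
  obtain ⟨n, hn⟩ := eventually_atTop.1 (eventually_mem_of_pathsToCycle hc hr_cont hω hB)
  exact mem_iUnion.2 ⟨n, hω, fun k hk => hn k hk.le⟩

lemma finite_start_inter_eventualPaths [TopologicalSpace X] {c : ZMod p → X} {B : Set X}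
    (hf : ∀ x, (r ⁻¹' {x}).Finite) (hB : InjOn r B) (n : ℕ) (x : X) :
    (start ⁻¹' {x} ∩ eventualPaths r c B n).Finite := by
  refine Set.Finite.of_finite_image ((finite_iterate_fiber hf n x).subset ?_)
    ((injOn_eventualPaths (c := c) hB n).mono inter_subset_right)
  rintro _ ⟨ω, hω, rfl⟩
  exact (iterate_eq_start ω n).trans hω.1

lemma countable_cyclePaths [TopologicalSpace X] [NeZero p] {c : ZMod p → X} (hc : IsCycle r c)
    (hr_cont : ∀ i, ContinuousAt r (c i)) (hf : ∀ x, (r ⁻¹' {x}).Finite) {B : Set X}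
    (hB : ∀ i, B ∈ 𝓝 (c i)) (hBinj : InjOn r B) (x : X) : (cyclePaths r c x).Countable := by
  rw [cyclePaths_eq, ← iUnion_eventualPaths hc hr_cont hB, inter_iUnion]
  exact countable_iUnion fun n => (finite_start_inter_eventualPaths hf hBinj n x).countable

variable [MeasurableSpace X] [TopologicalSpace X] [TopologicalSpace.MetrizableSpace X]
  [BorelSpace X]

lemma measurableSet_tendsto_path (c : ZMod p → X) (i : ZMod p) :
    MeasurableSet {ω : PathSpace r | Tendsto (fun n : ℕ => ω.1 (p * n)) atTop (𝓝 (c i))} :=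
  measurableSet_tendsto _ fun n => measurable_path_apply (p * n)

lemma measurableSet_pathsToCycle [NeZero p] (c : ZMod p → X) :
    MeasurableSet (pathsToCycle r c) := by
  simp only [pathsToCycle, ofPred_exists]
  exact MeasurableSet.iUnion fun i => measurableSet_tendsto_path c i

lemma measurable_cycleIndex [NeZero p] [MeasurableSpace (ZMod p)] {c : ZMod p → X}
    (hc : IsCycle r c) : Measurable (cycleIndex c : PathSpace r → ZMod p) := by
  refine measurable_to_countable' fun i => ?_
  -- The second set accounts for the default index `0` of the paths that do not tend to the cycle.
  have : cycleIndex c ⁻¹' {i} =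
      {ω : PathSpace r | Tendsto (fun n : ℕ => ω.1 (p * n)) atTop (𝓝 (c i))} ∪
        {ω | ω ∉ pathsToCycle r c ∧ (0 : ZMod p) = i} := by
    ext ω
    simp only [mem_preimage, mem_singleton_iff, mem_union, mem_ofPred_eq]
    constructor
    · intro h
      by_cases hω : ω ∈ pathsToCycle r c
      · exact Or.inl (h ▸ cycleIndex_spec hω)
      · refine Or.inr ⟨hω, ?_⟩
        rw [← h, cycleIndex_of_notMem hω]
    · rintro (h | ⟨h, rfl⟩)
      · exact cycleIndex_eq hc h
      · exact cycleIndex_of_notMem h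
  rw [this]
  refine (measurableSet_tendsto_path c i).union ?_
  exact (measurableSet_pathsToCycle c).compl.inter (MeasurableSet.const _)

lemma measurableSet_eventualPaths [NeZero p] (c : ZMod p → X) {B : Set X} (hB : IsOpen B) (n : ℕ) :
    MeasurableSet (eventualPaths r c B n) := by
  refine (measurableSet_pathsToCycle c).inter ?_
  simp only [ofPred_forall]
  exact MeasurableSet.iInter fun k => MeasurableSet.iInter fun _ =>
    measurable_path_apply k hB.measurableSet

end CyclePaths


/-! ### Almost everywhere measurable families of measures. -/

section MeasureValued

variable {α β : Type*} [MeasurableSpace α] [MeasurableSpace β]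

/-- A finite-measure-valued function is almost everywhere measurable as soon as all its
evaluations are. -/
lemma aemeasurable_measure_of_forall [MeasurableSpace.CountablyGenerated β] {μ : Measure α}
    {κ : α → Measure β} [∀ a, IsFiniteMeasure (κ a)]
    (h : ∀ s, MeasurableSet s → AEMeasurable (fun a => κ a s) μ) : AEMeasurable κ μ := by
  classical
  -- The exceptional null set depends on the measured set. A countable generating algebra, which is
  -- a π-system, allows one null set `N` to serve for all its members and for the total mass.
  set 𝒜 := generateSetAlgebra (MeasurableSpace.countableGeneratingSet β)
  have h𝒜c : 𝒜.Countable :=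
    countable_generateSetAlgebra (MeasurableSpace.countable_countableGeneratingSet)
  have h𝒜 : (‹_› : MeasurableSpace β) = MeasurableSpace.generateFrom 𝒜 := by
    rw [generateFrom_generateSetAlgebra_eq, MeasurableSpace.generateFrom_countableGeneratingSet]
  have hm : ∀ s ∈ 𝒜, MeasurableSet s := fun s hs => by
    rw [h𝒜]
    exact MeasurableSpace.measurableSet_generateFrom hs
  have h1 : ∀ᵐ a ∂μ, ∀ s (hs : s ∈ 𝒜), κ a s = (h s (hm s hs)).mk _ a :=
    (ae_ball_iff h𝒜c).2 fun s hs => (h s (hm s hs)).ae_eq_mk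
  have h2 := (h univ MeasurableSet.univ).ae_eq_mk
  obtain ⟨N, hN, hNm, hN0⟩ := exists_measurable_superset_of_null (ae_iff.1 (h1.and h2))
  have hmem : ∀ a, a ∉ N → (∀ s (hs : s ∈ 𝒜), κ a s = (h s (hm s hs)).mk _ a) ∧
      κ a univ = (h univ MeasurableSet.univ).mk _ a := by
    intro a ha
    by_contra hcon
    exact ha (hN hcon)
  let g : α → Measure β := fun a => if a ∈ N then 0 else κ a
  have hfin : ∀ a, IsFiniteMeasure (g a) := by
    intro a
    by_cases ha : a ∈ N <;> simp only [g, ha, if_true, if_false] <;> infer_instance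
  have heval : ∀ s, (hs : MeasurableSet s) → (∀ a, a ∉ N → κ a s = (h s hs).mk _ a) →
      Measurable fun a => g a s := by
    intro s hs hsa
    have : (fun a => g a s) = fun a => if a ∈ N then 0 else (h s hs).mk _ a := by
      funext a
      by_cases ha : a ∈ N
      · simp [g, ha]
      · simp [g, ha, hsa a ha]
    rw [this]
    exact Measurable.ite hNm measurable_const (h s hs).measurable_mk
  refine ⟨g, Measurable.measure_of_isPiSystem h𝒜 isSetAlgebra_generateSetAlgebra.isSetRing.isSetSemiring.isPiSystem ?_ ?_, ?_⟩
  · exact fun s hs => heval s (hm s hs) fun a ha => (hmem a ha).1 s hs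
  · exact heval univ MeasurableSet.univ fun a ha => (hmem a ha).2
  · have : ∀ᵐ a ∂μ, a ∉ N := measure_eq_zero_iff_ae_notMem.1 hN0
    filter_upwards [this] with a ha
    simp [g, ha]

lemma aemeasurable_measure_sum {ι : Type*} [Countable ι] {μ : Measure α}
    {κ : ι → α → Measure β} (h : ∀ i, AEMeasurable (κ i) μ) :
    AEMeasurable (fun a => Measure.sum fun i => κ i a) μ := by
  refine ⟨fun a => Measure.sum fun i => (h i).mk _ a, ?_, ?_⟩
  · refine Measure.measurable_of_measurable_coe _ fun s hs => ?_
    simp only [Measure.sum_apply _ hs]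
    exact Measurable.tsum fun i =>
      (Measure.measurable_coe hs).comp (h i).measurable_mk
  · filter_upwards [ae_all_iff.2 fun i => (h i).ae_eq_mk] with a ha
    simp only [ha]

end MeasureValued

/-! ### The measure λ_C and its behaviour under the shift. -/

/-- A Borel, onto, finite-to-one map with a strongly invariant measure and a cycle at which the map
is continuous, such that the map is injective near the cycle. -/
structure CycleSystem {X : Type*} [TopologicalSpace X] [MeasurableSpace X] (r : X → X)
    (ρ : Measure X) {p : ℕ} (c : ZMod p → X) : Prop where
  measurable : Measurable r
  surjective : Function.Surjective r
  finite_fiber : ∀ x, (r ⁻¹' {x}).Finite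
  invariant : IsStronglyInvariant r ρ
  cycle : IsCycle r c
  continuousAt : ∀ i, ContinuousAt r (c i)
  exists_injOn : ∃ B, IsOpen B ∧ (∀ i, c i ∈ B) ∧ InjOn r B

namespace CycleSystem

variable {X : Type*} [TopologicalSpace X] [PolishSpace X] [MeasurableSpace X]
  [BorelSpace X] {r : X → X} {ρ : Measure X} [IsProbabilityMeasure ρ] {p : ℕ} [NeZero p]
  {c : ZMod p → X} (S : CycleSystem r ρ c)

include S

omit [PolishSpace X] [BorelSpace X] [IsProbabilityMeasure ρ] in
lemma countable (x : X) : (cyclePaths r c x).Countable := by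
  obtain ⟨B, hBo, hBc, hB⟩ := S.exists_injOn
  exact countable_cyclePaths S.cycle S.continuousAt S.finite_fiber
    (fun i => hBo.mem_nhds (hBc i)) hB x

/-- N_C(x) is cut into pieces `D n` on which a path is determined by its point at time `n`. Counting
paths from `x` in such a piece amounts to counting points of a fixed set in the fibre of `r^[n]`
over `x`, and this is a fibre sum of an indicator. -/
lemma aemeasurable_count_restrict :
    AEMeasurable (fun x => Measure.count.restrict (cyclePaths r c x)) ρ := by
  have := standardBorelSpace_pathSpace S.measurable
  obtain ⟨B, hBo, hBc, hB⟩ := S.exists_injOn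
  set D := disjointed (eventualPaths r c B) with hD
  have hDm : ∀ n, MeasurableSet (D n) := fun n =>
    MeasurableSet.disjointed (fun k => measurableSet_eventualPaths c hBo k) n
  have hDsub : ∀ n, D n ⊆ eventualPaths r c B n := fun n => disjointed_subset _ n
  have hDU : ⋃ n, D n = pathsToCycle r c := by
    rw [hD, iUnion_disjointed,
      iUnion_eventualPaths S.cycle S.continuousAt fun i => hBo.mem_nhds (hBc i)]
  have hsm : ∀ x, MeasurableSet ((start : PathSpace r → X) ⁻¹' {x}) := fun x =>
    measurable_start (measurableSet_singleton x)
  have hsum : ∀ x, Measure.count.restrict (cyclePaths r c x) =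
      Measure.sum fun n => Measure.count.restrict (start ⁻¹' {x} ∩ D n) := by
    intro x
    rw [cyclePaths_eq, ← hDU, inter_iUnion, Measure.restrict_iUnion]
    · intro m n hmn
      exact (disjoint_disjointed _ hmn).mono inter_subset_right inter_subset_right
    · exact fun n => (hsm x).inter (hDm n)
  simp only [hsum]
  refine aemeasurable_measure_sum fun n => ?_
  have hfin : ∀ x, IsFiniteMeasure
      ((Measure.count : Measure (PathSpace r)).restrict (start ⁻¹' {x} ∩ D n)) := by
    intro x
    rw [isFiniteMeasure_restrict]
    refine (Measure.count_apply_lt_top.2 ?_).ne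
    exact (finite_start_inter_eventualPaths S.finite_fiber hB n x).subset
      (inter_subset_inter_right _ (hDsub n))
  refine aemeasurable_measure_of_forall fun A hA => ?_
  have hinj : InjOn (fun ω : PathSpace r => ω.1 n) (A ∩ D n) :=
    (injOn_eventualPaths hB n).mono (inter_subset_right.trans (hDsub n))
  -- Lusin–Souslin: an injective measurable image of a Borel set in a standard Borel space is Borel.
  have hZ : MeasurableSet ((fun ω : PathSpace r => ω.1 n) '' (A ∩ D n)) :=
    (hA.inter (hDm n)).image_of_measurable_injOn (measurable_path_apply n) hinj
  refine (S.invariant.aemeasurable_fiberSum_iterate S.surjective S.finite_fiber n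
    (f := ((fun ω : PathSpace r => ω.1 n) '' (A ∩ D n)).indicator fun _ => 1)
    (measurable_const.indicator hZ).aemeasurable).congr (Eventually.of_forall fun x => ?_)
  dsimp only
  have hfib : MeasurableSet (r^[n] ⁻¹' {x}) := S.measurable.iterate n (measurableSet_singleton x)
  have himg : (fun ω : PathSpace r => ω.1 n) '' (A ∩ D n) ∩ r^[n] ⁻¹' {x} =
      (fun ω : PathSpace r => ω.1 n) '' (A ∩ (start ⁻¹' {x} ∩ D n)) := by
    ext y
    constructor
    · rintro ⟨⟨ω, hω, rfl⟩, hy⟩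
      exact ⟨ω, ⟨hω.1, (iterate_eq_start ω n).symm.trans hy, hω.2⟩, rfl⟩
    · rintro ⟨ω, hω, rfl⟩
      exact ⟨⟨ω, ⟨hω.1, hω.2.2⟩, rfl⟩, (iterate_eq_start ω n).trans hω.2.1⟩
  have hcount : Measure.count (A ∩ (start ⁻¹' {x} ∩ D n)) =
      Measure.count ((fun ω : PathSpace r => ω.1 n) '' (A ∩ D n) ∩ r^[n] ⁻¹' {x}) := by
    rw [Measure.count_apply (hA.inter ((hsm x).inter (hDm n))),
      Measure.count_apply (hZ.inter hfib), himg,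
      (hinj.mono (inter_subset_inter_right _ inter_subset_right)).encard_image]
  rw [Measure.restrict_apply hA, hcount, fiberSum]
  have h1 := lintegral_countable (μ := Measure.count)
    (((fun ω : PathSpace r => ω.1 n) '' (A ∩ D n)).indicator fun _ => (1 : ℝ≥0∞))
    (finite_iterate_fiber S.finite_fiber n x).countable
  simp only [Measure.count_singleton, mul_one] at h1
  rw [← h1, lintegral_indicator hZ, lintegral_one, Measure.restrict_apply MeasurableSet.univ,
    univ_inter, Measure.restrict_apply hZ]

omit [IsProbabilityMeasure ρ] in
lemma setLIntegral_count (F : PathSpace r → ℝ≥0∞) (x : X) :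
    ∫⁻ ω in cyclePaths r c x, F ω ∂Measure.count = ∑' ω : cyclePaths r c x, F ω := by
  rw [lintegral_countable F (S.countable x)]
  simp

lemma lintegral_lambdaC {F : PathSpace r → ℝ≥0∞} (hF : AEMeasurable F (lambdaC ρ r c)) :
    ∫⁻ ω, F ω ∂(lambdaC ρ r c) = ∫⁻ x, ∑' ω : cyclePaths r c x, F ω ∂ρ := by
  rw [lambdaC, Measure.lintegral_bind S.aemeasurable_count_restrict hF]
  simp only [S.setLIntegral_count]

lemma ae_cyclePaths {P : PathSpace r → Prop} (h : ∀ᵐ ω ∂(lambdaC ρ r c), P ω) :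
    ∀ᵐ x ∂ρ, ∀ ω ∈ cyclePaths r c x, P ω := by
  filter_upwards [Measure.ae_ae_of_ae_bind S.aemeasurable_count_restrict h] with x hx ω hω
  rw [ae_restrict_iff' ] at hx
  · exact Measure.ae_count_iff.1 hx ω hω
  · rw [cyclePaths_eq]
    exact (measurable_start (measurableSet_singleton x)).inter (measurableSet_pathsToCycle c)

lemma aemeasurable_tsum {F : PathSpace r → ℝ≥0∞} (hF : AEMeasurable F (lambdaC ρ r c)) :
    AEMeasurable (fun x => ∑' ω : cyclePaths r c x, F ω) ρ := by
  have h1 : AEMeasurable (fun x => ∑' ω : cyclePaths r c x, hF.mk F ω) ρ := by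
    simp only [← S.setLIntegral_count]
    exact (Measure.measurable_lintegral hF.measurable_mk).comp_aemeasurable
      S.aemeasurable_count_restrict
  refine h1.congr ?_
  filter_upwards [S.ae_cyclePaths hF.ae_eq_mk] with x hx
  exact tsum_congr fun ω => (hx ω ω.2).symm

lemma ae_mem_pathsToCycle : ∀ᵐ ω ∂(lambdaC ρ r c), ω ∈ pathsToCycle r c := by
  have hm : MeasurableSet (pathsToCycle r c)ᶜ := (measurableSet_pathsToCycle c).compl
  rw [ae_iff]
  change lambdaC ρ r c (pathsToCycle r c)ᶜ = 0
  rw [← lintegral_indicator_one hm,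
    S.lintegral_lambdaC (measurable_one.indicator hm).aemeasurable]
  refine (lintegral_congr fun x => ?_).trans lintegral_zero
  refine ENNReal.tsum_eq_zero.2 fun ω => ?_
  have : (ω : PathSpace r) ∈ pathsToCycle r c := ω.2.2
  simp [this]

lemma ae_of_forall_mem {P : PathSpace r → Prop} (h : ∀ ω ∈ pathsToCycle r c, P ω) :
    ∀ᵐ ω ∂(lambdaC ρ r c), P ω :=
  S.ae_mem_pathsToCycle.mono h

omit [NeZero p] in
lemma aemeasurable_inv_fiberCard_start :
    AEMeasurable (fun ω : PathSpace r => (fiberCard r (start ω) : ℝ≥0∞)⁻¹) (lambdaC ρ r c) :=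
  ((S.invariant.aemeasurable_fiberCard S.surjective S.finite_fiber).comp_quasiMeasurePreserving
    (quasiMeasurePreserving_start ρ r c)).inv

/-- The shift matches the paths from `x` with the paths from the points of `r⁻¹(x)`. Strong
invariance replaces a sum over paths from `x` by its average over this fibre, whence the factor `1 /
#r⁻¹(x)`. -/
lemma map_shift_lambdaC : (lambdaC ρ r c).map shift =
    (lambdaC ρ r c).withDensity fun ω => (fiberCard r (start ω) : ℝ≥0∞)⁻¹ := by
  refine Measure.ext fun A hA => ?_
  have hm := measurable_shift (r := r) S.measurable
  have hi : Measurable (A.indicator (1 : PathSpace r → ℝ≥0∞)) := measurable_one.indicator hA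
  rw [Measure.map_apply hm hA, withDensity_apply _ hA, ← lintegral_indicator_one (hm hA),
    ← lintegral_indicator hA]
  have h1 : (shift ⁻¹' A).indicator (1 : PathSpace r → ℝ≥0∞) = fun ω => A.indicator 1 (shift ω) :=
    rfl
  have h2 : A.indicator (fun ω : PathSpace r => (fiberCard r (start ω) : ℝ≥0∞)⁻¹) =
      fun ω => (fiberCard r (start ω) : ℝ≥0∞)⁻¹ * A.indicator 1 ω := by
    funext ω
    by_cases hω : ω ∈ A <;> simp [hω]
  have h3 : AEMeasurable (fun ω => A.indicator 1 (shift ω)) (lambdaC ρ r c) :=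
    (hi.comp hm).aemeasurable
  have h4 : AEMeasurable (fun ω : PathSpace r => (fiberCard r (start ω) : ℝ≥0∞)⁻¹ *
      A.indicator 1 ω) (lambdaC ρ r c) :=
    S.aemeasurable_inv_fiberCard_start.mul hi.aemeasurable
  rw [h1, h2, S.lintegral_lambdaC h3,
    S.lintegral_lambdaC h4,
    ← S.invariant.lintegral_fiberAvg S.surjective S.finite_fiber
      (S.aemeasurable_tsum h3)]
  refine lintegral_congr fun x => ?_
  rw [fiberAvg]
  refine (congrArg _ (tsum_cyclePaths S.cycle S.continuousAt _ x).symm).trans ?_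
  rw [← ENNReal.tsum_mul_left]
  refine tsum_congr fun ω => ?_
  have : start (ω : PathSpace r) = x := ω.2.1
  rw [this]

lemma quasiMeasurePreserving_shift :
    Measure.QuasiMeasurePreserving shift (lambdaC ρ r c) (lambdaC ρ r c) := by
  refine ⟨measurable_shift S.measurable, ?_⟩
  rw [S.map_shift_lambdaC]
  exact withDensity_absolutelyContinuous _ _

/-- The density `1 / #r⁻¹` vanishes nowhere, so λ_C is also absolutely continuous with respect to
its image under the shift. -/
lemma quasiMeasurePreserving_unshift :
    Measure.QuasiMeasurePreserving unshift (lambdaC ρ r c) (lambdaC ρ r c) := by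
  refine ⟨measurable_unshift, ?_⟩
  have h1 : lambdaC ρ r c ≪ (lambdaC ρ r c).map shift := by
    rw [S.map_shift_lambdaC]
    refine withDensity_absolutelyContinuous' S.aemeasurable_inv_fiberCard_start
      (Eventually.of_forall fun ω => ?_)
    simp
  have h2 := h1.map (measurable_unshift (r := r))
  rw [Measure.map_map measurable_unshift (measurable_shift S.measurable)] at h2
  have h3 : (unshift ∘ shift : PathSpace r → PathSpace r) = id := rfl
  rwa [h3, Measure.map_id] at h2

/-- The change of variables `ω ↦ r̂ ω`. -/
lemma lintegral_comp_shift {F : PathSpace r → ℝ≥0∞} (hF : AEMeasurable F (lambdaC ρ r c)) :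
    ∫⁻ ω, F (shift ω) ∂(lambdaC ρ r c) =
      ∫⁻ ω, (fiberCard r (start ω) : ℝ≥0∞)⁻¹ * F ω ∂(lambdaC ρ r c) := by
  have h := lintegral_withDensity_eq_lintegral_mul₀ S.aemeasurable_inv_fiberCard_start hF
  rw [← S.map_shift_lambdaC, lintegral_map' ?_ (measurable_shift S.measurable).aemeasurable] at h
  · exact h
  · rw [S.map_shift_lambdaC]
    exact hF.mono_ac (withDensity_absolutelyContinuous _ _)

lemma quasiMeasurePreserving_path_apply (n : ℕ) :
    Measure.QuasiMeasurePreserving (fun ω : PathSpace r => ω.1 n) (lambdaC ρ r c) ρ := by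
  have h := (quasiMeasurePreserving_start ρ r c).comp (S.quasiMeasurePreserving_unshift.iterate n)
  convert h using 1
  funext ω
  simp [start, iterate_unshift_apply]

end CycleSystem


/-! ### Absolutely convergent infinite products. -/

section InfiniteProducts

lemma summable_of_residues {p : ℕ} [NeZero p] {f : ℕ → ℝ} (hf : ∀ n, 0 ≤ f n)
    (h : ∀ j : ℕ, Summable fun n => f (p * n + j)) : Summable f := by
  rw [← ((Equiv.prodComm _ _).trans (Nat.divModEquiv p).symm).summable_iff,
    summable_prod_of_nonneg (f := f ∘ _) (fun _ => hf _)]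
  refine ⟨fun j => (h j).congr fun n => ?_, Summable.of_finite⟩
  simp [Nat.divModEquiv, mul_comm, add_comm]

lemma norm_tprod_one_add_sub_one_le {a : ℕ → ℂ} (ha : Summable fun k => ‖a k‖) :
    ‖∏' k, (1 + a k) - 1‖ ≤ Real.exp (∑' k, ‖a k‖) - 1 := by
  have h1 := (multipliable_one_add_of_summable ha).hasProd.tendsto_prod_nat
  refine le_of_tendsto (h1.sub_const 1).norm (Eventually.of_forall fun n => ?_)
  refine (Finset.norm_prod_one_add_sub_one_le _ _).trans ?_
  gcongr
  exact ha.sum_le_tsum _ fun _ _ => norm_nonneg _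

/-- A tail product differs from 1 by at most the exponential of the tail sum minus one, which is
eventually below 1. Individual factors may vanish, so only late tails are covered. -/
lemma eventually_tprod_nat_add_ne_zero {a : ℕ → ℂ} (ha : Summable fun k => ‖a k‖) :
    ∀ᶠ n in atTop, ∏' k, (1 + a (k + n)) ≠ 0 := by
  have h1 : Tendsto (fun n => Real.exp (∑' k, ‖a (k + n)‖) - 1) atTop (𝓝 0) := by
    have h2 := (tendsto_sum_nat_add fun k => ‖a k‖).rexp.sub_const 1
    simpa using h2
  filter_upwards [h1.eventually (gt_mem_nhds one_pos)] with n hn h0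
  have h3 := norm_tprod_one_add_sub_one_le (a := fun k => a (k + n))
    ((summable_nat_add_iff n).2 ha)
  rw [h0] at h3
  simp only [zero_sub, norm_neg, norm_one] at h3
  linarith

end InfiniteProducts

/-! ### The filter near the repelling cycle. -/

section LowPass

variable {X : Type*} {r : X → X} {p : ℕ} {α : ZMod p → ℂ} {m₀ : X → ℂ}

lemma filterWeight_nonneg (x : X) : 0 ≤ filterWeight r m₀ x := by
  unfold filterWeight
  positivity

lemma fiberSum_filterWeight (hf : ∀ x, (r ⁻¹' {x}).Finite)
    (hqmf : ∀ x, (1 / (fiberCard r x : ℝ)) * ∑ᶠ y ∈ r ⁻¹' {x}, ‖m₀ y‖ ^ 2 = 1) (x : X) :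
    fiberSum r (fun y => ENNReal.ofReal (filterWeight r m₀ y)) x = 1 := by
  rw [fiberSum_eq_sum hf, ← ENNReal.ofReal_sum_of_nonneg fun y _ => filterWeight_nonneg y,
    ENNReal.ofReal_eq_one, ← hqmf x, finsum_mem_eq_finite_toFinset_sum _ (hf x), Finset.mul_sum]
  refine Finset.sum_congr rfl fun y hy => ?_
  have : r y = x := by simpa using hy
  rw [filterWeight, this, div_eq_inv_mul, one_div]

/-- Two distinct points of one fibre with weights above `1/2` would have total weight above 1. -/
lemma injOn_of_half_lt_filterWeight
    (h : ∀ x, fiberSum r (fun y => ENNReal.ofReal (filterWeight r m₀ y)) x = 1) :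
    InjOn r {y | 1 / 2 < filterWeight r m₀ y} := by
  intro y hy z hz hyz
  by_contra hne
  classical
  have h1 := ENNReal.sum_le_tsum (f := fun w : r ⁻¹' {r y} =>
    ENNReal.ofReal (filterWeight r m₀ w)) 
    ({⟨y, rfl⟩, ⟨z, hyz.symm⟩} : Finset (r ⁻¹' {r y}))
  rw [Finset.sum_pair (fun h => hne (congrArg Subtype.val h))] at h1
  have h2 := h1.trans_eq (h (r y))
  dsimp only at h2
  rw [← ENNReal.ofReal_add (filterWeight_nonneg _) (filterWeight_nonneg _),
    ENNReal.ofReal_le_one] at h2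
  simp only [mem_ofPred_eq] at hy hz
  linarith

variable [MetricSpace X] {c : ZMod p → X}

/-- Summability along one geometric sequence makes `β` arbitrarily small at some positive arguments,
and monotonicity extends this to all smaller arguments. -/
lemma IsBetaLipschitzAt.continuousAt {f : X → ℂ} {x₀ : X} (h : IsBetaLipschitzAt f x₀) :
    ContinuousAt f x₀ := by
  obtain ⟨β, hβ, hsum, hnear⟩ := h
  obtain ⟨κ, hκ0, hκ1⟩ : ∃ κ : ℝ≥0, 0 < κ ∧ κ < 1 := exists_between one_pos
  have h0 := NNReal.tendsto_atTop_zero_of_summable (hsum 1 κ one_pos hκ0 hκ1)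
  rw [Metric.continuousAt_iff']
  intro ε hε
  obtain ⟨k, hk⟩ := (h0.eventually (gt_mem_nhds (Real.toNNReal_pos.2 hε))).exists
  have hpos : 0 < 1 * κ ^ (k + 1) := by positivity
  have hball : ∀ᶠ x in 𝓝 x₀, nndist x x₀ ≤ 1 * κ ^ (k + 1) := by
    filter_upwards [Metric.ball_mem_nhds x₀ (NNReal.coe_pos.2 hpos)] with x hx
    exact NNReal.coe_le_coe.1 (Metric.mem_ball.1 hx).le
  filter_upwards [hnear, hball] with x hx1 hx2
  rw [dist_eq_norm]
  exact Real.lt_toNNReal_iff_coe_lt.1 ((hx1.trans (hβ hx2)).trans_lt hk)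

omit [MetricSpace X] in
lemma filterWeight_cycle (hs : Function.Surjective r) (hf : ∀ x, (r ⁻¹' {x}).Finite)
    (hα : ∀ i, ‖α i‖ = 1)
    (hlow : ∀ i, m₀ (c i) = α i * (Real.sqrt (fiberCard r (r (c i))) : ℂ)) (i : ZMod p) :
    filterWeight r m₀ (c i) = 1 := by
  have h0 : (0 : ℝ) < fiberCard r (r (c i)) := by exact_mod_cast fiberCard_pos hs hf _
  rw [filterWeight, hlow, norm_mul, hα, one_mul, Complex.norm_real, Real.norm_eq_abs, sq_abs,
    Real.sq_sqrt h0.le, div_self h0.ne']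

lemma continuousAt_filterWeight (hs : Function.Surjective r) (hf : ∀ x, (r ⁻¹' {x}).Finite)
    (hc : IsCycle r c) (hr_cont : ∀ i, ContinuousAt r (c i))
    (hcard_cont : ∀ i, ContinuousAt (fiberCard r) (c i))
    (hm₀ : ∀ i, ContinuousAt m₀ (c i)) (i : ZMod p) :
    ContinuousAt (filterWeight r m₀) (c i) := by
  have h1 : ContinuousAt (fun x => (fiberCard r (r x) : ℝ)) (c i) := by
    have h2 : ContinuousAt (fun n : ℕ => (n : ℝ)) (fiberCard r (r (c i))) :=
      continuous_of_discreteTopology.continuousAt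
    have h3 : ContinuousAt (fiberCard r) (r (c i)) := by
      rw [hc.map]
      exact hcard_cont _
    exact h2.comp (f := fun x => fiberCard r (r x)) (h3.comp (hr_cont i))
  exact ((hm₀ i).norm.pow 2).div h1 (by exact_mod_cast (fiberCard_pos hs hf _).ne')

/-- Expansion by `s` is contraction along a backward orbit: inside the `δ`-ball each step multiplies
the distance by at most `κ`. -/
lemma IsRepellingFixedPt.exists_dist_le {s : X → X} {x₀ : X} (h : IsRepellingFixedPt s x₀)
    {a : ℕ → X} (ha : Tendsto a atTop (𝓝 x₀)) (hs : ∀ n, s (a (n + 1)) = a n) :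
    ∃ κ : ℝ≥0, 0 < κ ∧ κ < 1 ∧ ∃ D : ℝ≥0, 0 < D ∧ ∃ N, ∀ n, nndist (a (N + n)) x₀ ≤ D * κ ^ n := by
  obtain ⟨-, κ, hκ0, hκ1, δ, hδ, hexp⟩ := h
  lift κ to ℝ≥0 using hκ0.le
  obtain ⟨N, hN⟩ := eventually_atTop.1 (ha.eventually (Metric.ball_mem_nhds x₀ hδ))
  -- The summand `1` only makes the constant `D` positive, as the condition on `β` requires.
  refine ⟨κ, by exact_mod_cast hκ0, by exact_mod_cast hκ1, nndist (a N) x₀ + 1, by positivity, N,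
    fun n => ?_⟩
  induction n with
  | zero => simp
  | succ n ih =>
    have h1 : nndist (a (N + n + 1)) x₀ ≤ κ * nndist (a (N + n)) x₀ := by
      by_cases h0 : a (N + n + 1) = x₀
      · simp [h0]
      · have h2 := hexp _ h0 (Metric.mem_ball.1 (hN (N + n + 1) (by omega)))
        rw [hs, inv_mul_lt_iff₀ hκ0] at h2
        exact_mod_cast h2.le
    calc nndist (a (N + (n + 1))) x₀ ≤ κ * nndist (a (N + n)) x₀ := h1
      _ ≤ κ * ((nndist (a N) x₀ + 1) * κ ^ n) := by gcongr
      _ = _ := by ring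

/-- Each residue class modulo `p` is a backward orbit of `r^[p]` tending to one repelling point `c
q`. Along it the number of preimages is eventually constant, being continuous with discrete values.
The low-pass condition then bounds the factor minus one by `‖m₀ (a n) - m₀ (c q)‖`, and `β` of a
geometric sequence is summable. -/
lemma summable_norm_phiFactor_sub_one [NeZero p] (hs : Function.Surjective r)
    (hf : ∀ x, (r ⁻¹' {x}).Finite) (hc : IsRepellingCycle r c)
    (hr_cont : ∀ i, ContinuousAt r (c i))
    (hcard_cont : ∀ i, ContinuousAt (fiberCard r) (c i)) (hα : ∀ i, ‖α i‖ = 1)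
    (hm₀_lip : ∀ i, IsBetaLipschitzAt m₀ (c i))
    (hlow : ∀ i, m₀ (c i) = α i * (Real.sqrt (fiberCard r (r (c i))) : ℂ))
    {ω : PathSpace r} (hω : ω ∈ pathsToCycle r c) :
    Summable fun k => ‖phiFactor c α m₀ ω (k + 1) - 1‖ := by
  refine summable_of_residues (p := p) (fun _ => norm_nonneg _) fun j => ?_
  set q : ZMod p := cycleIndex c ω + (j + 1 : ℕ) with hq
  set a : ℕ → X := fun n => ω.1 (p * n + (j + 1)) with ha
  have hlim : Tendsto a atTop (𝓝 (c q)) :=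
    tendsto_path_residue hc.1 hr_cont (cycleIndex_spec hω) (j + 1)
  have hstep : ∀ n, r^[p] (a (n + 1)) = a n := fun n => by
    rw [ha]
    dsimp only
    rw [show p * (n + 1) + (j + 1) = p * n + (j + 1) + p by ring]
    exact iterate_path ω _ p
  obtain ⟨κ, hκ0, hκ1, D, hD, N, hdist⟩ := (hc.2 q).exists_dist_le hlim hstep
  obtain ⟨β, hβ, hsum, hnear⟩ := hm₀_lip q
  have hcard : ∀ᶠ n in atTop, fiberCard r (r (a n)) = fiberCard r (r (c q)) := by
    have h3 : ContinuousAt (fiberCard r) (r (c q)) := by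
      rw [hc.1.map]
      exact hcard_cont _
    have h4 := (h3.comp (hr_cont q)).tendsto.comp hlim
    simpa [nhds_discrete] using h4
  have hfac : ∀ n, fiberCard r (r (a n)) = fiberCard r (r (c q)) →
      ‖phiFactor c α m₀ ω (p * n + j + 1) - 1‖ ≤ ‖m₀ (a n) - m₀ (c q)‖ := by
    intro n hn
    have hN1 : 1 ≤ Real.sqrt (fiberCard r (r (c q))) := by
      rw [Real.one_le_sqrt]
      exact_mod_cast fiberCard_pos hs hf _
    have hN0 : (Real.sqrt (fiberCard r (r (c q))) : ℂ) ≠ 0 := by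
      exact_mod_cast (one_pos.trans_le hN1).ne'
    have hα0 : α q ≠ 0 := norm_ne_zero_iff.1 (by rw [hα]; exact one_ne_zero)
    have hidx : cycleIndex c ω + ((p * n + j + 1 : ℕ) : ZMod p) = q := by
      rw [hq]
      push_cast
      simp
    have h5 : phiFactor c α m₀ ω (p * n + j + 1) - 1 =
        (α q)⁻¹ * (m₀ (a n) - m₀ (c q)) / (Real.sqrt (fiberCard r (r (c q))) : ℂ) := by
      rw [phiFactor, hidx, hlow q]
      change (α q)⁻¹ * m₀ (a n) / (Real.sqrt (fiberCard r (r (a n))) : ℂ) - 1 = _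
      rw [hn]
      field_simp
    rw [h5, norm_div, norm_mul, norm_inv, hα, inv_one, one_mul, Complex.norm_real,
      Real.norm_of_nonneg (Real.sqrt_nonneg _)]
    exact div_le_self (norm_nonneg _) hN1
  -- Besides the offset `N` of the distance estimate, one more step produces the exponent `k + 1` of
  -- the summability condition.
  have hshift := (tendsto_add_atTop_nat (N + 1))
  rw [← summable_nat_add_iff (N + 1)]
  have hs' : Summable fun k : ℕ => ((β (D * κ ^ (k + 1)) : ℝ≥0) : ℝ) :=
    NNReal.summable_coe.2 (hsum D κ hD hκ0 hκ1)
  refine Summable.of_norm_bounded_eventually_nat hs' ?_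
  filter_upwards [hshift.eventually hcard, hshift.eventually (hlim.eventually hnear)] with n h6 h7
  rw [norm_norm]
  refine (hfac _ h6).trans ?_
  have h8 := h7.trans (hβ ((hdist (n + 1)).trans_eq' (by congr 2; omega)))
  exact_mod_cast h8

end LowPass


/-- A cycle system with a filter `m₀` such that the weights sum up to one over the fibres and the
infinite product of the normalized filter converges absolutely along the paths that tend to the
cycle. -/
structure LowPassSystem {X : Type*} [TopologicalSpace X] [MeasurableSpace X] (r : X → X)
    (ρ : Measure X) {p : ℕ} (c : ZMod p → X) (α : ZMod p → ℂ) (m₀ : X → ℂ) : Prop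
    extends CycleSystem r ρ c where
  norm_phase : ∀ i, ‖α i‖ = 1
  memLp : MemLp m₀ ∞ ρ
  sum_weight : ∀ x, fiberSum r (fun y => ENNReal.ofReal (filterWeight r m₀ y)) x = 1
  summable : ∀ ω ∈ pathsToCycle r c, Summable fun k => ‖phiFactor c α m₀ ω (k + 1) - 1‖

/-! ### The unitary operator and the scaling function. -/

section Measurability

lemma enorm_sqrt_fiberCard_sq {X : Type*} (r : X → X) (x : X) :
    ‖(Real.sqrt (fiberCard r x) : ℂ)‖ₑ ^ (2 : ℝ) = fiberCard r x := by
  rw [← ofReal_norm, Complex.norm_real, Real.norm_of_nonneg (Real.sqrt_nonneg _),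
    ENNReal.ofReal_rpow_of_nonneg (Real.sqrt_nonneg _) two_pos.le, Real.rpow_two,
    Real.sq_sqrt (Nat.cast_nonneg _), ENNReal.ofReal_natCast]

variable {X : Type*} [TopologicalSpace X] [PolishSpace X] [MeasurableSpace X]
  [BorelSpace X] {r : X → X} {ρ : Measure X} [IsProbabilityMeasure ρ] {p : ℕ} [NeZero p]
  {c : ZMod p → X}

namespace CycleSystem

variable (S : CycleSystem r ρ c)

include S

omit [IsProbabilityMeasure ρ] in
lemma measurable_comp_cycleIndex {β : Type*} [MeasurableSpace β] (g : ZMod p → β) :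
    Measurable fun ω : PathSpace r => g (cycleIndex c ω) := by
  let _ : MeasurableSpace (ZMod p) := ⊤
  exact measurable_from_top.comp (measurable_cycleIndex S.cycle)

omit [NeZero p] in
lemma aemeasurable_sqrt_fiberCard :
    AEMeasurable (fun x => (Real.sqrt (fiberCard r x) : ℂ)) ρ := by
  have h := (S.invariant.aemeasurable_fiberCard S.surjective S.finite_fiber).ennreal_toReal
  simp only [ENNReal.toReal_natCast] at h
  exact Complex.measurable_ofReal.comp_aemeasurable (Real.continuous_sqrt.measurable.comp_aemeasurable h)

omit [NeZero p] in
lemma aemeasurable_sqrt_fiberCard_map :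
    AEMeasurable (fun x => (Real.sqrt (fiberCard r (r x)) : ℂ)) ρ :=
  S.aemeasurable_sqrt_fiberCard.comp_quasiMeasurePreserving
    (S.invariant.measurePreserving S.surjective S.finite_fiber S.measurable).quasiMeasurePreserving

end CycleSystem

lemma eLpNorm_two_congr {Y : Type*} [MeasurableSpace Y] {μ : Measure Y} {f g : Y → ℂ}
    (h : ∫⁻ y, ‖f y‖ₑ ^ (2 : ℝ) ∂μ = ∫⁻ y, ‖g y‖ₑ ^ (2 : ℝ) ∂μ) :
    eLpNorm f 2 μ = eLpNorm g 2 μ := by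
  simp only [eLpNorm_eq_lintegral_rpow_enorm_toReal two_ne_zero ENNReal.ofNat_ne_top,
    ENNReal.toReal_ofNat, h]

variable {α : ZMod p → ℂ}

namespace CycleSystem

variable (S : CycleSystem r ρ c)

include S

lemma aestronglyMeasurable_scaleFun {ξ : PathSpace r → ℂ}
    (hξ : AEStronglyMeasurable ξ (lambdaC ρ r c)) :
    AEStronglyMeasurable (scaleFun c α ξ) (lambdaC ρ r c) := by
  refine AEStronglyMeasurable.mul (AEStronglyMeasurable.mul ?_ ?_) ?_
  · exact (S.measurable_comp_cycleIndex α).aestronglyMeasurable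
  · exact (S.aemeasurable_sqrt_fiberCard_map.comp_quasiMeasurePreserving
      (quasiMeasurePreserving_start ρ r c)).aestronglyMeasurable
  · exact hξ.comp_quasiMeasurePreserving S.quasiMeasurePreserving_shift

/-- The factor `#r⁻¹` in the squared modulus cancels the density produced by the change of variables
ω ↦ r̂ω. -/
lemma eLpNorm_scaleFun (hα : ∀ i, ‖α i‖ = 1) {ξ : PathSpace r → ℂ}
    (hξ : AEStronglyMeasurable ξ (lambdaC ρ r c)) :
    eLpNorm (scaleFun c α ξ) 2 (lambdaC ρ r c) = eLpNorm ξ 2 (lambdaC ρ r c) := by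
  refine eLpNorm_two_congr ?_
  have h1 : ∀ ω : PathSpace r, ‖scaleFun c α ξ ω‖ₑ ^ (2 : ℝ) =
      (fiberCard r (start (shift ω)) : ℝ≥0∞) * ‖ξ (shift ω)‖ₑ ^ (2 : ℝ) := by
    intro ω
    have h2 : ‖α (cycleIndex c ω)‖ₑ = 1 := by rw [← ofReal_norm, hα, ENNReal.ofReal_one]
    rw [scaleFun, enorm_mul, enorm_mul, h2, one_mul, ENNReal.mul_rpow_of_nonneg _ _ two_pos.le,
      enorm_sqrt_fiberCard_sq, start_shift]
  have hm : AEMeasurable (fun ω : PathSpace r =>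
      (fiberCard r (start ω) : ℝ≥0∞) * ‖ξ ω‖ₑ ^ (2 : ℝ)) (lambdaC ρ r c) :=
    ((S.invariant.aemeasurable_fiberCard S.surjective S.finite_fiber).comp_quasiMeasurePreserving
      (quasiMeasurePreserving_start ρ r c)).mul (hξ.enorm.pow_const 2)
  simp only [h1]
  rw [S.lintegral_comp_shift hm]
  refine lintegral_congr fun ω => ?_
  rw [← mul_assoc, ENNReal.inv_mul_cancel (fiberCard_cast_ne_zero S.surjective S.finite_fiber _)
    (ENNReal.natCast_ne_top _), one_mul]

lemma scaleFun_congr {ξ η : PathSpace r → ℂ} (h : ξ =ᵐ[lambdaC ρ r c] η) :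
    scaleFun c α ξ =ᵐ[lambdaC ρ r c] scaleFun c α η := by
  filter_upwards [S.quasiMeasurePreserving_shift.ae h] with ω hω
  rw [scaleFun, scaleFun, hω]

lemma memLp_scaleFun (hα : ∀ i, ‖α i‖ = 1) {ξ : PathSpace r → ℂ}
    (hξ : MemLp ξ 2 (lambdaC ρ r c)) : MemLp (scaleFun c α ξ) 2 (lambdaC ρ r c) :=
  ⟨S.aestronglyMeasurable_scaleFun hξ.1, by rw [S.eLpNorm_scaleFun hα hξ.1]; exact hξ.2⟩

lemma exists_scale_preimage (hα : ∀ i, ‖α i‖ = 1) {η : PathSpace r → ℂ}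
    (hη : MemLp η 2 (lambdaC ρ r c)) :
    ∃ ξ : PathSpace r → ℂ, MemLp ξ 2 (lambdaC ρ r c) ∧ scaleFun c α ξ = η := by
  set ξ : PathSpace r → ℂ := fun ω => (α (cycleIndex c (unshift ω)))⁻¹ *
    (Real.sqrt (fiberCard r (start ω)) : ℂ)⁻¹ * η (unshift ω) with hξ
  have h1 : scaleFun c α ξ = η := by
    funext ω
    have h2 : α (cycleIndex c ω) ≠ 0 := norm_ne_zero_iff.1 (by rw [hα]; exact one_ne_zero)
    have h3 : (Real.sqrt (fiberCard r (r (start ω))) : ℂ) ≠ 0 := by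
      have := fiberCard_pos S.surjective S.finite_fiber (r (start ω))
      exact_mod_cast (Real.sqrt_pos.2 (by exact_mod_cast this)).ne'
    rw [scaleFun, hξ]
    simp only [start_shift, unshift_shift]
    field_simp
  have hm : AEStronglyMeasurable ξ (lambdaC ρ r c) := by
    refine AEStronglyMeasurable.mul (AEStronglyMeasurable.mul ?_ ?_) ?_
    · exact ((S.measurable_comp_cycleIndex fun i => (α i)⁻¹).comp
        measurable_unshift).aestronglyMeasurable
    · exact (S.aemeasurable_sqrt_fiberCard.comp_quasiMeasurePreserving
        (quasiMeasurePreserving_start ρ r c)).inv.aestronglyMeasurable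
    · exact hη.1.comp_quasiMeasurePreserving S.quasiMeasurePreserving_unshift
  refine ⟨ξ, ⟨hm, ?_⟩, h1⟩
  rw [← S.eLpNorm_scaleFun hα hm, h1]
  exact hη.2

/-- The unitary operator `U`. -/
lemma exists_scale_unitary (hα : ∀ i, ‖α i‖ = 1) :
    ∃ U : PathL2 ρ r c ≃ₗᵢ[ℂ] PathL2 ρ r c, ∀ ξ : PathL2 ρ r c,
      U ξ =ᵐ[lambdaC ρ r c] scaleFun c α ξ := by
  let V : PathL2 ρ r c →ₗᵢ[ℂ] PathL2 ρ r c :=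
    { toFun := fun ξ => (S.memLp_scaleFun hα (Lp.memLp ξ)).toLp
      map_add' := fun ξ η => by
        rw [← MemLp.toLp_add, MemLp.toLp_eq_toLp_iff]
        refine (S.scaleFun_congr (Lp.coeFn_add ξ η)).trans (Eventually.of_forall fun ω => ?_)
        simp only [scaleFun, Pi.add_apply]
        ring
      map_smul' := fun a ξ => by
        rw [RingHom.id_apply, ← MemLp.toLp_const_smul, MemLp.toLp_eq_toLp_iff]
        refine (S.scaleFun_congr (Lp.coeFn_smul a ξ)).trans (Eventually.of_forall fun ω => ?_)
        simp only [scaleFun, Pi.smul_apply, smul_eq_mul]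
        ring
      norm_map' := fun ξ => by
        simp only [LinearMap.coe_mk, AddHom.coe_mk]
        rw [Lp.norm_toLp, S.eLpNorm_scaleFun hα (Lp.aestronglyMeasurable ξ), Lp.norm_def] }
  have hV : ∀ ξ : PathL2 ρ r c, V ξ =ᵐ[lambdaC ρ r c] scaleFun c α ξ := fun ξ =>
    MemLp.coeFn_toLp (S.memLp_scaleFun hα (Lp.memLp ξ))
  have hsurj : Function.Surjective V := by
    intro η
    obtain ⟨ξ, hξ, hξη⟩ := S.exists_scale_preimage hα (Lp.memLp η)
    refine ⟨hξ.toLp, Lp.ext ((hV _).trans ?_)⟩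
    refine (S.scaleFun_congr hξ.coeFn_toLp).trans ?_
    rw [hξη]
  exact ⟨LinearIsometryEquiv.ofSurjective V hsurj, hV⟩

end CycleSystem

namespace LowPassSystem

variable {m₀ : X → ℂ} (S : LowPassSystem r ρ c α m₀)

include S

omit [PolishSpace X] [BorelSpace X] [IsProbabilityMeasure ρ] [NeZero p] in
lemma multipliable_phiFactor {ω : PathSpace r} (hω : ω ∈ pathsToCycle r c) :
    Multipliable fun k : ℕ => phiFactor c α m₀ ω (k + 1) := by
  simpa using multipliable_one_add_of_summable (S.summable ω hω)

omit [BorelSpace X] [IsProbabilityMeasure ρ] [NeZero p] in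
-- The shift lowers the limit index by one and raises the position of each point by one, so the
-- phase attached to a point stays the same.
lemma phiFactor_shift {ω : PathSpace r} (hω : ω ∈ pathsToCycle r c) (k : ℕ) :
    phiFactor c α m₀ (shift ω) (k + 1) = phiFactor c α m₀ ω k := by
  rw [phiFactor, phiFactor, cycleIndex_shift S.cycle S.continuousAt hω, shift_apply_succ]
  congr 4
  push_cast
  ring

omit [BorelSpace X] [IsProbabilityMeasure ρ] [NeZero p] in
lemma phiHat_shift {ω : PathSpace r} (hω : ω ∈ pathsToCycle r c) :
    phiHat c α m₀ (shift ω) = phiFactor c α m₀ ω 0 * phiHat c α m₀ ω := by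
  simp only [phiHat, S.phiFactor_shift hω]
  exact tprod_eq_zero_mul' (S.multipliable_phiFactor hω)

omit [BorelSpace X] [IsProbabilityMeasure ρ] [NeZero p] in
lemma scaleFun_phiHat {ω : PathSpace r} (hω : ω ∈ pathsToCycle r c) :
    scaleFun c α (phiHat c α m₀) ω = m₀ (start ω) * phiHat c α m₀ ω := by
  have h2 : α (cycleIndex c ω) ≠ 0 := norm_ne_zero_iff.1 (by rw [S.norm_phase]; exact one_ne_zero)
  have h3 : (Real.sqrt (fiberCard r (r (start ω))) : ℂ) ≠ 0 := by
    have := fiberCard_pos S.surjective S.finite_fiber (r (start ω))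
    exact_mod_cast (Real.sqrt_pos.2 (by exact_mod_cast this)).ne'
  rw [scaleFun, S.phiHat_shift hω, phiFactor, Nat.cast_zero, add_zero]
  change _ * _ * ((α (cycleIndex c ω))⁻¹ * m₀ (start ω) /
    (Real.sqrt (fiberCard r (r (start ω))) : ℂ) * _) = _
  field_simp

omit [PolishSpace X] [BorelSpace X] [IsProbabilityMeasure ρ] [NeZero p] in
lemma norm_phiFactor_sq (ω : PathSpace r) (k : ℕ) :
    ‖phiFactor c α m₀ ω k‖ ^ 2 = filterWeight r m₀ (ω.1 k) := by
  rw [phiFactor, norm_div, norm_mul, norm_inv, S.norm_phase, inv_one, one_mul, Complex.norm_real,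
    Real.norm_of_nonneg (Real.sqrt_nonneg _), div_pow, Real.sq_sqrt (Nat.cast_nonneg _),
    filterWeight]

omit [PolishSpace X] [BorelSpace X] [IsProbabilityMeasure ρ] [NeZero p] in
lemma tendsto_prod_filterWeight {ω : PathSpace r} (hω : ω ∈ pathsToCycle r c) :
    Tendsto (fun n => ∏ k ∈ Finset.range n, filterWeight r m₀ (ω.1 (k + 1))) atTop
      (𝓝 (‖phiHat c α m₀ ω‖ ^ 2)) := by
  have h := (S.multipliable_phiFactor hω).hasProd.tendsto_prod_nat.norm.pow 2
  simp only [norm_prod, ← Finset.prod_pow, S.norm_phiFactor_sq] at h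
  exact h

omit [BorelSpace X] [IsProbabilityMeasure ρ] [NeZero p] in
lemma enorm_phiHat_shift_sq {ω : PathSpace r} (hω : ω ∈ pathsToCycle r c) :
    ‖phiHat c α m₀ (shift ω)‖ₑ ^ 2 =
      ENNReal.ofReal (filterWeight r m₀ (start ω)) * ‖phiHat c α m₀ ω‖ₑ ^ 2 := by
  rw [S.phiHat_shift hω, enorm_mul, mul_pow, ← ofReal_norm (phiFactor c α m₀ ω 0),
    ← ENNReal.ofReal_pow (norm_nonneg _), S.norm_phiFactor_sq]
  rfl

omit [BorelSpace X] [IsProbabilityMeasure ρ] in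
-- Dropping the first `n` points of a path replaces φ̂ by the corresponding tail of the same
-- product.
lemma eventually_phiHat_iterate_unshift_ne_zero {ω : PathSpace r} (hω : ω ∈ pathsToCycle r c) :
    ∀ᶠ n in atTop, phiHat c α m₀ (unshift^[n] ω) ≠ 0 := by
  have h1 : ∀ n, unshift^[n] ω ∈ pathsToCycle r c ∧
      ∀ k, phiFactor c α m₀ (unshift^[n] ω) (k + 1) = phiFactor c α m₀ ω (k + n + 1) := by
    intro n
    induction n with
    | zero => exact ⟨hω, fun k => rfl⟩
    | succ n ih =>
      rw [Function.iterate_succ_apply']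
      have h2 := (unshift_mem_pathsToCycle_iff S.cycle S.continuousAt).2 ih.1
      refine ⟨h2, fun k => ?_⟩
      rw [← S.phiFactor_shift h2, shift_unshift, ih.2 (k + 1)]
      congr 1
      omega
  filter_upwards [eventually_tprod_nat_add_ne_zero (S.summable ω hω)] with n hn
  simp only [phiHat, (h1 n).2]
  simpa using hn

lemma aestronglyMeasurable_phiFactor (k : ℕ) :
    AEStronglyMeasurable (fun ω : PathSpace r => phiFactor c α m₀ ω k) (lambdaC ρ r c) := by
  have hq := S.quasiMeasurePreserving_path_apply k
  refine (AEMeasurable.div (AEMeasurable.mul ?_ ?_) ?_).aestronglyMeasurable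
  · exact (S.measurable_comp_cycleIndex fun i => (α (i + k))⁻¹).aemeasurable
  · exact (S.memLp.1.comp_quasiMeasurePreserving hq).aemeasurable
  · exact S.aemeasurable_sqrt_fiberCard_map.comp_quasiMeasurePreserving hq

lemma aestronglyMeasurable_phiHat :
    AEStronglyMeasurable (phiHat (r := r) c α m₀) (lambdaC ρ r c) := by
  refine aestronglyMeasurable_of_tendsto_ae (u := atTop) (f := fun n ω =>
    ∏ k ∈ Finset.range n, phiFactor c α m₀ ω (k + 1)) (fun n => ?_)
    (S.ae_of_forall_mem fun ω hω => (S.multipliable_phiFactor hω).hasProd.tendsto_prod_nat)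
  exact Finset.aestronglyMeasurable_fun_prod _ fun k _ => S.aestronglyMeasurable_phiFactor (k + 1)

end LowPassSystem

end Measurability


/-! ### The path measures P_x on single paths. -/

section PathMeasure

variable {X : Type*} {r : X → X} {W : X → ℝ}

instance : MeasurableSingletonClass (DiscreteCopy X) := ⟨fun _ => MeasurableSpace.measurableSet_top⟩

lemma stepMeasure_singleton
    (hW : ∀ x, fiberSum r (fun y => ENNReal.ofReal (W y)) x = 1) (y : X) :
    stepMeasure r W (r y) {toCopy y} = ENNReal.ofReal (W y) := by
  have h : ∑' z : r ⁻¹' {r y}, ENNReal.ofReal (W z) = 1 := hW (r y)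
  rw [stepMeasure, if_pos h, Measure.sum_apply _ (measurableSet_singleton _),
    tsum_eq_single (⟨y, rfl⟩ : r ⁻¹' {r y})]
  · simp
  · rintro ⟨z, hz⟩ hzy
    have : (toCopy z) ∉ ({toCopy y} : Set (DiscreteCopy X)) := fun h => hzy (Subtype.ext h)
    simp [this]

/-- The first `n + 1` points of a path, in the discrete copy of the space. -/
def initialCopy (ω : PathSpace r) (n : ℕ) (i : Finset.Iic n) : DiscreteCopy X := toCopy (ω.1 i)

/-- Chain rule for the Markov chain. The discrete σ-algebra makes every finite history a measurable
singleton. -/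
lemma partialTraj_stepKernel_singleton
    (hW : ∀ x, fiberSum r (fun y => ENNReal.ofReal (W y)) x = 1) (ω : PathSpace r) (n : ℕ) :
    Kernel.partialTraj (X := fun _ => DiscreteCopy X) (stepKernel r W) 0 n
      (fun _ => toCopy (start ω)) {initialCopy ω n} =
      ∏ k ∈ Finset.range n, ENNReal.ofReal (W (ω.1 (k + 1))) := by
  induction n with
  | zero =>
    rw [Kernel.partialTraj_self, Kernel.id_apply, Finset.prod_range_zero,
      Measure.dirac_apply_of_mem]
    rw [mem_singleton_iff]
    funext i
    have : (i : ℕ) = 0 := Nat.le_zero.1 (Finset.mem_Iic.1 i.2)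
    simp [initialCopy, start, this]
  | succ n ih =>
    have hm : Measurable (IicProdIoc (X := fun _ => DiscreteCopy X) n (n + 1)) :=
      measurable_IicProdIoc
    rw [Kernel.partialTraj_succ_of_le n.zero_le,
      Kernel.map_apply' _ hm _ (measurableSet_singleton _),
      Kernel.comp_apply' _ _ _ (hm (measurableSet_singleton _))]
    let v₀ : Finset.Ioc n (n + 1) → DiscreteCopy X := fun i => toCopy (ω.1 i)
    have hpre : (IicProdIoc (X := fun _ => DiscreteCopy X) n (n + 1)) ⁻¹'
        {initialCopy ω (n + 1)} =
        {initialCopy ω n} ×ˢ {v₀} := by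
      ext ⟨u, v⟩
      simp only [mem_preimage, mem_singleton_iff, mem_prod]
      constructor
      · intro h
        constructor
        · funext i
          have := congrFun h ⟨i, Finset.mem_Iic.2 ((Finset.mem_Iic.1 i.2).trans n.le_succ)⟩
          simpa [initialCopy, IicProdIoc, Finset.mem_Iic.1 i.2] using this
        · funext i
          have := congrFun h ⟨i, Finset.mem_Iic.2 (Finset.mem_Ioc.1 i.2).2⟩
          simpa [initialCopy, IicProdIoc, not_le.2 (Finset.mem_Ioc.1 i.2).1, v₀] using this
      · rintro ⟨rfl, rfl⟩
        funext i
        simp [v₀, initialCopy, IicProdIoc]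
    -- Only the history of `ω` itself contributes, and from it the next point is chosen with
    -- probability `W (ω.1 (n + 1))`.
    have hint : ∀ w : (i : Finset.Iic n) → DiscreteCopy X,
        (Kernel.id ×ₖ (stepKernel r W n).map
          (MeasurableEquiv.piSingleton (X := fun _ => DiscreteCopy X) n)) w
          ((IicProdIoc (X := fun _ => DiscreteCopy X) n (n + 1)) ⁻¹'
            {initialCopy ω (n + 1)}) =
        ({initialCopy ω n} : Set ((i : Finset.Iic n) → DiscreteCopy X)).indicator
          (fun _ => ENNReal.ofReal (W (ω.1 (n + 1)))) w := by
      intro w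
      rw [hpre, Kernel.prod_apply, Measure.prod_prod, Kernel.id_apply,
        Kernel.map_apply' _ (MeasurableEquiv.measurable _) _ (measurableSet_singleton _)]
      by_cases hw : w ∈ ({initialCopy ω n} : Set ((i : Finset.Iic n) → DiscreteCopy X))
      · rw [indicator_of_mem hw, Measure.dirac_apply_of_mem hw, one_mul]
        have h1 : (MeasurableEquiv.piSingleton (X := fun _ => DiscreteCopy X) n) ⁻¹'
            {v₀} = {toCopy (ω.1 (n + 1))} := by
          ext y
          simp only [mem_preimage, mem_singleton_iff]
          constructor
          · intro h
            have := congrFun h ⟨n + 1, Finset.right_mem_Ioc.2 n.lt_succ_self⟩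
            simpa [v₀, MeasurableEquiv.piSingleton] using this
          · rintro rfl
            funext i
            have : (i : ℕ) = n + 1 := Nat.mem_Ioc_succ.1 i.2
            simp [v₀, MeasurableEquiv.piSingleton, this]
        rw [h1, mem_singleton_iff.1 hw]
        change stepMeasure r W (ω.1 n) _ = _
        rw [← ω.2 n, stepMeasure_singleton hW]
      · rw [indicator_of_notMem hw, Measure.dirac_apply' _ (measurableSet_singleton _),
          indicator_of_notMem hw, zero_mul]
    simp only [hint]
    rw [lintegral_indicator_const (measurableSet_singleton _), ih, Finset.prod_range_succ, mul_comm]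

/-- A trajectory is the decreasing intersection of its cylinders, so continuity from above applies.
-/
lemma tendsto_prod_traj_singleton
    (hW : ∀ x, fiberSum r (fun y => ENNReal.ofReal (W y)) x = 1) (ω : PathSpace r) :
    Tendsto (fun n => ∏ k ∈ Finset.range n, ENNReal.ofReal (W (ω.1 (k + 1)))) atTop
      (𝓝 (Kernel.traj (X := fun _ => DiscreteCopy X) (stepKernel r W) 0
        (fun _ => toCopy (start ω)) {fun n => toCopy (ω.1 n)})) := by
  set μ := Kernel.traj (X := fun _ => DiscreteCopy X) (stepKernel r W) 0
    (fun _ => toCopy (start ω)) with hμ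
  let C : ℕ → Set (ℕ → DiscreteCopy X) := fun n =>
    Preorder.frestrictLe (π := fun _ => DiscreteCopy X) n ⁻¹' {initialCopy ω n}
  have hm : ∀ n, Measurable (Preorder.frestrictLe (α := ℕ) (π := fun _ => DiscreteCopy X) n) :=
    fun n => Preorder.measurable_frestrictLe (X := fun _ => DiscreteCopy X) n
  have hCm : ∀ n, MeasurableSet (C n) := fun n => hm n (measurableSet_singleton _)
  have hCa : Antitone C := by
    intro m n hmn w hw
    have hw' : Preorder.frestrictLe (π := fun _ => DiscreteCopy X) n w =
      initialCopy ω n := hw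
    refine mem_singleton_iff.2 (funext fun i => ?_)
    exact congrFun hw' ⟨i, Finset.mem_Iic.2 ((Finset.mem_Iic.1 i.2).trans hmn)⟩
  have hCi : ⋂ n, C n = {fun n => toCopy (ω.1 n)} := by
    ext w
    simp only [mem_iInter, mem_singleton_iff]
    constructor
    · intro h
      funext n
      have hw' : Preorder.frestrictLe (π := fun _ => DiscreteCopy X) n w =
        initialCopy ω n := h n
      exact congrFun hw' ⟨n, Finset.mem_Iic.2 le_rfl⟩
    · rintro rfl n
      exact rfl
  rw [← hCi]
  refine (tendsto_measure_iInter_atTop (fun n => (hCm n).nullMeasurableSet) hCa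
    ⟨0, measure_ne_top _ _⟩).congr fun n => ?_
  rw [← partialTraj_stepKernel_singleton hW ω n, ← Kernel.traj_map_frestrictLe,
    Kernel.map_apply' _ (hm n) _ (measurableSet_singleton _)]
  rfl

variable [MeasurableSpace X]

lemma measurable_ofCopy_comp :
    Measurable fun (z : ℕ → DiscreteCopy X) n => ofCopy (z n) :=
  measurable_pi_lambda _ fun n => (measurable_from_top (f := ofCopy)).comp (measurable_pi_apply n)

lemma measurableEmbedding_pathSpace_val [MeasurableEq X] (hr : Measurable r) :
    MeasurableEmbedding (Subtype.val : PathSpace r → ℕ → X) :=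
  MeasurableEmbedding.subtype_coe (measurableSet_pathSpace hr)

/-- Restriction to the path space could a priori lose mass; the upper bound is all that the estimate
of h_C needs. -/
lemma pathMeasure_univ_le [MeasurableEq X] (hr : Measurable r) (x : X) :
    pathMeasure r W x univ ≤ 1 := by
  rw [pathMeasure, (measurableEmbedding_pathSpace_val hr).comap_apply,
    Measure.map_apply measurable_ofCopy_comp]
  · exact prob_le_one
  · rw [image_univ]
    exact (measurableEmbedding_pathSpace_val hr).measurableSet_range

lemma tendsto_pathMeasure_singleton [MeasurableEq X] [MeasurableSingletonClass X]
    (hr : Measurable r)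
    (hW : ∀ x, fiberSum r (fun y => ENNReal.ofReal (W y)) x = 1) (ω : PathSpace r) :
    Tendsto (fun n => ∏ k ∈ Finset.range n, ENNReal.ofReal (W (ω.1 (k + 1)))) atTop
      (𝓝 (pathMeasure r W (start ω) {ω})) := by
  rw [pathMeasure, (measurableEmbedding_pathSpace_val hr).comap_apply,
    image_singleton, Measure.map_apply measurable_ofCopy_comp (measurableSet_singleton _)]
  exact tendsto_prod_traj_singleton hW ω

end PathMeasure

/-! ### The harmonic function h_C as a sum of |φ̂|². -/

namespace LowPassSystem

variable {X : Type*} [TopologicalSpace X] [PolishSpace X] [MeasurableSpace X]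
  [BorelSpace X] {r : X → X} {ρ : Measure X} [IsProbabilityMeasure ρ] {p : ℕ} [NeZero p]
  {c : ZMod p → X} {α : ZMod p → ℂ} {m₀ : X → ℂ} (S : LowPassSystem r ρ c α m₀)

include S

omit [IsProbabilityMeasure ρ] [NeZero p] in
-- Both sides are limits of the products W(z₁)⋯W(z_n). This is the link between φ̂ and h_C.
lemma pathMeasure_singleton {ω : PathSpace r} (hω : ω ∈ pathsToCycle r c) :
    pathMeasure r (filterWeight r m₀) (start ω) {ω} = ‖phiHat c α m₀ ω‖ₑ ^ 2 := by
  refine tendsto_nhds_unique (tendsto_pathMeasure_singleton S.measurable S.sum_weight ω) ?_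
  have h := ENNReal.tendsto_ofReal (S.tendsto_prod_filterWeight hω)
  rw [ENNReal.ofReal_pow (norm_nonneg _), ofReal_norm] at h
  refine h.congr fun n => ?_
  rw [ENNReal.ofReal_prod_of_nonneg fun _ _ => filterWeight_nonneg _]

omit [IsProbabilityMeasure ρ] in
lemma pathMeasure_cyclePaths (x : X) :
    pathMeasure r (filterWeight r m₀) x (cyclePaths r c x) =
      ∑' ω : cyclePaths r c x, ‖phiHat (r := r) c α m₀ ω‖ₑ ^ 2 := by
  rw [← setLIntegral_one, lintegral_countable _ (S.countable x)]
  refine tsum_congr fun ω => ?_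
  rw [one_mul, ← S.pathMeasure_singleton ω.2.2]
  have : start (ω : PathSpace r) = x := ω.2.1
  rw [this]

omit [IsProbabilityMeasure ρ] in
lemma tsum_phiHat_le_one (x : X) :
    ∑' ω : cyclePaths r c x, ‖phiHat (r := r) c α m₀ ω‖ₑ ^ 2 ≤ 1 := by
  rw [← S.pathMeasure_cyclePaths]
  exact (measure_mono (subset_univ _)).trans (pathMeasure_univ_le S.measurable x)

omit [IsProbabilityMeasure ρ] in
lemma ofReal_harmonicFun (x : X) : ENNReal.ofReal (harmonicFun r (filterWeight r m₀) c x) =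
    ∑' ω : cyclePaths r c x, ‖phiHat (r := r) c α m₀ ω‖ₑ ^ 2 := by
  rw [harmonicFun, S.pathMeasure_cyclePaths, ENNReal.ofReal_toReal
    (ne_top_of_le_ne_top ENNReal.one_ne_top (S.tsum_phiHat_le_one x))]

omit [PolishSpace X] [BorelSpace X] [IsProbabilityMeasure ρ] [NeZero p] S in
lemma harmonicFun_nonneg (x : X) : 0 ≤ harmonicFun r (filterWeight r m₀) c x :=
  ENNReal.toReal_nonneg

omit [IsProbabilityMeasure ρ] in
lemma harmonicFun_le_one (x : X) : harmonicFun r (filterWeight r m₀) c x ≤ 1 := by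
  have h := S.tsum_phiHat_le_one x
  rwa [← S.ofReal_harmonicFun, ENNReal.ofReal_le_one] at h

lemma aemeasurable_enorm_phiHat_sq :
    AEMeasurable (fun ω : PathSpace r => ‖phiHat c α m₀ ω‖ₑ ^ 2) (lambdaC ρ r c) :=
  S.aestronglyMeasurable_phiHat.enorm.pow_const 2

lemma aemeasurable_harmonicFun : AEMeasurable (harmonicFun r (filterWeight r m₀) c) ρ := by
  have h := (S.aemeasurable_tsum S.aemeasurable_enorm_phiHat_sq).ennreal_toReal
  refine h.congr (Eventually.of_forall fun x => ?_)
  dsimp only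
  rw [harmonicFun, S.pathMeasure_cyclePaths]

omit [IsProbabilityMeasure ρ] in
/-- The function `h_C` is harmonic for the transfer operator with the weight `W`. -/
lemma fiberSum_weight_mul_harmonicFun (x : X) :
    fiberSum r (fun y => ENNReal.ofReal (filterWeight r m₀ y) *
      ENNReal.ofReal (harmonicFun r (filterWeight r m₀) c y)) x =
      ENNReal.ofReal (harmonicFun r (filterWeight r m₀) c x) := by
  rw [S.ofReal_harmonicFun, tsum_cyclePaths S.cycle S.continuousAt
    (fun ω => ‖phiHat (r := r) c α m₀ ω‖ₑ ^ 2)]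
  refine fiberSum_congr fun y _ => ?_
  rw [S.ofReal_harmonicFun, ← ENNReal.tsum_mul_left]
  refine tsum_congr fun ω => ?_
  rw [S.enorm_phiHat_shift_sq ω.2.2]
  have : start (ω : PathSpace r) = y := ω.2.1
  rw [this]

lemma memLp_phiHat : MemLp (phiHat (r := r) c α m₀) 2 (lambdaC ρ r c) := by
  refine ⟨S.aestronglyMeasurable_phiHat, ?_⟩
  rw [eLpNorm_lt_top_iff_lintegral_rpow_enorm_lt_top two_ne_zero ENNReal.ofNat_ne_top]
  simp only [ENNReal.toReal_ofNat, ENNReal.rpow_two]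
  rw [S.lintegral_lambdaC S.aemeasurable_enorm_phiHat_sq]
  refine (lintegral_mono fun x => S.tsum_phiHat_le_one x).trans_lt ?_
  simp

end LowPassSystem


/-! ### Algebra of the representation π. -/

section Representation

variable {X : Type*} [TopologicalSpace X] [MeasurableSpace X] {ρ : Measure X} {r : X → X} {p : ℕ}
  {c : ZMod p → X}

lemma piRep_ae_eq {f : Lp ℂ ∞ ρ} {g : X → ℂ} (hfg : f =ᵐ[ρ] g) {ξ : PathL2 ρ r c}
    {η : PathSpace r → ℂ} (hξ : ξ =ᵐ[lambdaC ρ r c] η) :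
    piRep ρ r c f ξ =ᵐ[lambdaC ρ r c] fun ω => g (start ω) * η ω := by
  filter_upwards [coeFn_piRep ρ r c f ξ, (quasiMeasurePreserving_start ρ r c).ae hfg, hξ]
    with ω h1 h2 h3
  rw [h1, h2, h3]

lemma piRep_add (f g : Lp ℂ ∞ ρ) (ξ : PathL2 ρ r c) :
    piRep ρ r c (f + g) ξ = piRep ρ r c f ξ + piRep ρ r c g ξ := by
  refine Lp.ext ((piRep_ae_eq (Lp.coeFn_add f g) (ae_eq_refl _)).trans ?_)
  filter_upwards [Lp.coeFn_add (piRep ρ r c f ξ) (piRep ρ r c g ξ), coeFn_piRep ρ r c f ξ,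
    coeFn_piRep ρ r c g ξ] with ω h1 h2 h3
  rw [h1, Pi.add_apply, Pi.add_apply, h2, h3, add_mul]

lemma piRep_smul (a : ℂ) (f : Lp ℂ ∞ ρ) (ξ : PathL2 ρ r c) :
    piRep ρ r c (a • f) ξ = a • piRep ρ r c f ξ := by
  refine Lp.ext ((piRep_ae_eq (Lp.coeFn_smul a f) (ae_eq_refl _)).trans ?_)
  filter_upwards [Lp.coeFn_smul a (piRep ρ r c f ξ), coeFn_piRep ρ r c f ξ] with ω h1 h2
  rw [h1, Pi.smul_apply, Pi.smul_apply, h2, smul_mul_assoc]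

lemma exists_piRep_mul (f g : Lp ℂ ∞ ρ) :
    ∃ k : Lp ℂ ∞ ρ, ∀ ξ : PathL2 ρ r c, piRep ρ r c f (piRep ρ r c g ξ) = piRep ρ r c k ξ := by
  have hk : MemLp (fun x => f x * g x) ∞ ρ := (Lp.memLp g).mul (Lp.memLp f)
  refine ⟨hk.toLp, fun ξ => Lp.ext ?_⟩
  refine (piRep_ae_eq (ae_eq_refl _) (coeFn_piRep ρ r c g ξ)).trans ?_
  refine (EventuallyEq.of_eq ?_).trans (piRep_ae_eq hk.coeFn_toLp (ae_eq_refl _)).symm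
  funext ω
  rw [mul_assoc]

/-- The vectors `π(f) φ`. -/
def cyclicSubmodule (φ : PathL2 ρ r c) : Submodule ℂ (PathL2 ρ r c) where
  carrier := {η | ∃ f : Lp ℂ ∞ ρ, η = piRep ρ r c f φ}
  add_mem' := by
    rintro _ _ ⟨f, rfl⟩ ⟨g, rfl⟩
    exact ⟨f + g, (piRep_add f g φ).symm⟩
  zero_mem' := ⟨0, by simpa using (piRep_smul 0 (0 : Lp ℂ ∞ ρ) φ).symm⟩
  smul_mem' := by
    rintro a _ ⟨f, rfl⟩
    exact ⟨a • f, (piRep_smul a f φ).symm⟩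

/-- The spaces `V_n` as submodules. -/
noncomputable def resolutionSubmodule (U : PathL2 ρ r c ≃ₗᵢ[ℂ] PathL2 ρ r c) (φ : PathL2 ρ r c)
    (n : ℤ) : Submodule ℂ (PathL2 ρ r c) :=
  (cyclicSubmodule φ).topologicalClosure.map (U ^ (-n)).toLinearEquiv.toLinearMap

end Representation

/-! ### Generating the path σ-algebra by late coordinates. -/

section MeasurableStructure

variable {X : Type*} [MeasurableSpace X] {r : X → X}

/-- The sets of paths that are determined by one coordinate of index at least `N`. -/
def coordinateSets (r : X → X) (N : ℕ) : Set (Set (PathSpace r)) :=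
  {s | ∃ m, N ≤ m ∧ ∃ A, MeasurableSet A ∧ s = (fun ω : PathSpace r => ω.1 m) ⁻¹' A}

omit [MeasurableSpace X] in
lemma preimage_path_apply (m k : ℕ) (A : Set X) :
    (fun ω : PathSpace r => ω.1 m) ⁻¹' A = (fun ω : PathSpace r => ω.1 (m + k)) ⁻¹' (r^[k] ⁻¹' A) := by
  ext ω
  simp only [mem_preimage, iterate_path]

/-- Earlier coordinates are functions of later ones, so conditions on coordinates `m` and `n`
combine into one condition on coordinate `m + n`. -/
lemma isPiSystem_coordinateSets (hr : Measurable r) (N : ℕ) : IsPiSystem (coordinateSets r N) := by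
  rintro _ ⟨m, hm, A, hA, rfl⟩ _ ⟨n, hn, B, hB, rfl⟩ -
  refine ⟨m + n, by omega, r^[n] ⁻¹' A ∩ r^[m] ⁻¹' B,
    (hr.iterate n hA).inter (hr.iterate m hB), ?_⟩
  rw [preimage_path_apply m n, preimage_path_apply n m, add_comm n m, preimage_inter]

lemma generateFrom_coordinateSets (hr : Measurable r) (N : ℕ) :
    (inferInstance : MeasurableSpace (PathSpace r)) =
      MeasurableSpace.generateFrom (coordinateSets r N) := by
  apply le_antisymm
  · have h : @Measurable _ _ (MeasurableSpace.generateFrom (coordinateSets r N)) _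
        (id : PathSpace r → PathSpace r) := by
      refine @Measurable.subtype_mk _ _ (MeasurableSpace.generateFrom (coordinateSets r N)) _ _
        (fun ω : PathSpace r => ω.1) ?_ _
      refine @measurable_pi_lambda _ _ _ (MeasurableSpace.generateFrom (coordinateSets r N)) _ _
        fun n A hA => MeasurableSpace.measurableSet_generateFrom ?_
      exact ⟨n + N, by omega, r^[N] ⁻¹' A, hr.iterate N hA, preimage_path_apply n N A⟩
    exact fun s hs => h hs
  · refine MeasurableSpace.generateFrom_le ?_
    rintro _ ⟨m, -, A, hA, rfl⟩
    exact measurable_path_apply m hA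

/-- An integrable function on the path space vanishes if its integrals over the sets given by one
late coordinate vanish. -/
lemma ae_eq_zero_of_setIntegral_coordinate (hr : Measurable r) {μ : Measure (PathSpace r)}
    {u : PathSpace r → ℂ} (hu : Integrable u μ) (N : ℕ)
    (h : ∀ m, N ≤ m → ∀ A, MeasurableSet A →
      ∫ ω in (fun ω : PathSpace r => ω.1 m) ⁻¹' A, u ω ∂μ = 0) : u =ᵐ[μ] 0 := by
  have htot : ∫ ω, u ω ∂μ = 0 := by
    simpa using h N le_rfl univ MeasurableSet.univ
  refine hu.ae_eq_zero_of_forall_setIntegral_eq_zero fun s hs _ => ?_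
  refine MeasurableSpace.induction_on_inter (C := fun s _ => ∫ ω in s, u ω ∂μ = 0)
    (generateFrom_coordinateSets hr N) (isPiSystem_coordinateSets hr N) ?_ ?_ ?_ ?_ s hs
  · simp
  · rintro _ ⟨m, hm, A, hA, rfl⟩
    exact h m hm A hA
  · intro t ht h0
    rw [setIntegral_compl ht hu, htot, h0, sub_zero]
  · intro f hd hfm h0
    rw [integral_iUnion hfm hd hu.integrableOn]
    simp [h0]

end MeasurableStructure

/-! ### Correlation formula, scaling equation and density of the union. -/

namespace LowPassSystem

variable {X : Type*} [TopologicalSpace X] [PolishSpace X] [MeasurableSpace X]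
  [BorelSpace X] {r : X → X} {ρ : Measure X} [IsProbabilityMeasure ρ] {p : ℕ} [NeZero p]
  {c : ZMod p → X} {α : ZMod p → ℂ} {m₀ : X → ℂ} (S : LowPassSystem r ρ c α m₀)

include S

/-- The sum of |φ̂|² over the paths from `x` is h_C(x). The correlation formula is the integral form
of this identity of measures. -/
lemma map_start_withDensity :
    ((lambdaC ρ r c).withDensity fun ω => ‖phiHat c α m₀ ω‖ₑ ^ 2).map start =
      ρ.withDensity fun x => ENNReal.ofReal (harmonicFun r (filterWeight r m₀) c x) := by
  refine Measure.ext fun A hA => ?_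
  rw [Measure.map_apply measurable_start hA, withDensity_apply _ (measurable_start hA),
    withDensity_apply _ hA, ← lintegral_indicator (measurable_start hA), ← lintegral_indicator hA,
    S.lintegral_lambdaC (S.aemeasurable_enorm_phiHat_sq.indicator (measurable_start hA))]
  refine lintegral_congr fun x => ?_
  by_cases hx : x ∈ A
  · rw [indicator_of_mem hx, S.ofReal_harmonicFun]
    refine tsum_congr fun ω => indicator_of_mem ?_ _
    have : start (ω : PathSpace r) = x := ω.2.1
    simpa [this] using hx
  · rw [indicator_of_notMem hx]
    refine ENNReal.tsum_eq_zero.2 fun ω => indicator_of_notMem ?_ _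
    have : start (ω : PathSpace r) = x := ω.2.1
    simpa [this] using hx

lemma integrable_mul_harmonicFun (f : Lp ℂ ∞ ρ) :
    Integrable (fun x => f x * (harmonicFun r (filterWeight r m₀) c x : ℂ)) ρ := by
  have h1 : MemLp (fun x => (harmonicFun r (filterWeight r m₀) c x : ℂ)) ∞ ρ := by
    refine memLp_top_of_bound (Complex.measurable_ofReal.comp_aemeasurable
      S.aemeasurable_harmonicFun).aestronglyMeasurable 1 (Eventually.of_forall fun x => ?_)
    rw [Complex.norm_real, Real.norm_of_nonneg (harmonicFun_nonneg x)]
    exact S.harmonicFun_le_one x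
  have h2 : MemLp (fun x => f x * (harmonicFun r (filterWeight r m₀) c x : ℂ)) ∞ ρ :=
    h1.mul (Lp.memLp f)
  exact h2.integrable le_top

lemma inner_piRep_phiHat (f : Lp ℂ ∞ ρ) :
    inner ℂ S.memLp_phiHat.toLp (piRep ρ r c f S.memLp_phiHat.toLp) =
      ∫ x, f x * (harmonicFun r (filterWeight r m₀) c x : ℂ) ∂ρ := by
  have h1 : inner ℂ S.memLp_phiHat.toLp (piRep ρ r c f S.memLp_phiHat.toLp) =
      ∫ ω, (‖phiHat c α m₀ ω‖ₑ ^ 2).toReal • f (start ω) ∂(lambdaC ρ r c) := by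
    rw [L2.inner_def]
    refine integral_congr_ae ?_
    filter_upwards [S.memLp_phiHat.coeFn_toLp,
      piRep_ae_eq (ae_eq_refl f) S.memLp_phiHat.coeFn_toLp] with ω h2 h3
    rw [h2, h3, RCLike.inner_apply, ENNReal.toReal_pow, toReal_enorm, Complex.real_smul,
      mul_assoc, RCLike.mul_conj, mul_comm]
    push_cast
    rfl
  rw [h1, ← integral_withDensity_eq_integral_toReal_smul₀ S.aemeasurable_enorm_phiHat_sq
    (Eventually.of_forall fun ω => by simp),
    ← integral_map (φ := start) (f := f) measurable_start.aemeasurable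
      (Lp.stronglyMeasurable f).aestronglyMeasurable,
    S.map_start_withDensity, integral_withDensity_eq_integral_toReal_smul₀
      S.aemeasurable_harmonicFun.ennreal_ofReal (Eventually.of_forall fun x => by simp)]
  refine integral_congr_ae (Eventually.of_forall fun x => ?_)
  dsimp only
  rw [ENNReal.toReal_ofReal (harmonicFun_nonneg x), Complex.real_smul, mul_comm]

variable {U : PathL2 ρ r c ≃ₗᵢ[ℂ] PathL2 ρ r c}
  (hU : ∀ ξ : PathL2 ρ r c, U ξ =ᵐ[lambdaC ρ r c] scaleFun c α ξ)

include hU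

lemma scaling_equation :
    U S.memLp_phiHat.toLp = piRep ρ r c S.memLp.toLp S.memLp_phiHat.toLp := by
  refine Lp.ext ((hU _).trans ?_)
  refine (S.scaleFun_congr S.memLp_phiHat.coeFn_toLp).trans ?_
  refine EventuallyEq.trans ?_
    (piRep_ae_eq S.memLp.coeFn_toLp S.memLp_phiHat.coeFn_toLp).symm
  exact S.ae_of_forall_mem fun ω hω => S.scaleFun_phiHat hω

/-- The covariance relation `U π(f) = π(f ∘ r) U`. -/
lemma exists_covariance (f : Lp ℂ ∞ ρ) :
    ∃ g : Lp ℂ ∞ ρ, g =ᵐ[ρ] f ∘ r ∧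
      ∀ ξ : PathL2 ρ r c, U (piRep ρ r c f ξ) = piRep ρ r c g (U ξ) := by
  have hr := S.invariant.measurePreserving S.surjective S.finite_fiber S.measurable
  have hg : MemLp (f ∘ r) ∞ ρ := (Lp.memLp f).comp_measurePreserving hr
  refine ⟨hg.toLp, hg.coeFn_toLp, fun ξ => Lp.ext ?_⟩
  refine (hU _).trans ((S.scaleFun_congr (coeFn_piRep ρ r c f ξ)).trans ?_)
  refine EventuallyEq.trans (EventuallyEq.of_eq ?_) (piRep_ae_eq hg.coeFn_toLp (hU ξ)).symm
  funext ω
  simp only [scaleFun, start_shift, Function.comp_apply]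
  ring

/-- Covariance and the scaling equation give U π(f) φ̂ = π(f ∘ r) π(m₀) φ̂. After taking closures
this is the nesting of the V_n. -/
lemma map_mem_cyclicSubmodule {η : PathL2 ρ r c}
    (hη : η ∈ cyclicSubmodule S.memLp_phiHat.toLp) :
    U η ∈ cyclicSubmodule S.memLp_phiHat.toLp := by
  obtain ⟨f, rfl⟩ := hη
  obtain ⟨g, -, hg⟩ := S.exists_covariance hU f
  obtain ⟨k, hk⟩ := exists_piRep_mul (r := r) (c := c) g S.memLp.toLp
  exact ⟨k, by rw [hg, S.scaling_equation hU, hk]⟩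

lemma map_mem_coreSpace {η : PathL2 ρ r c} (hη : η ∈ coreSpace ρ r c S.memLp_phiHat.toLp) :
    U η ∈ coreSpace ρ r c S.memLp_phiHat.toLp :=
  map_mem_closure U.continuous hη fun _ h => S.map_mem_cyclicSubmodule hU h

lemma resolutionSpace_subset (n : ℤ) :
    resolutionSpace ρ r c U S.memLp_phiHat.toLp n ⊆
      resolutionSpace ρ r c U S.memLp_phiHat.toLp (n + 1) := by
  rintro _ ⟨η, hη, rfl⟩
  refine ⟨U η, S.map_mem_coreSpace hU hη, ?_⟩
  have : U ^ (-n) = U ^ (-(n + 1)) * U := by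
    rw [← zpow_add_one]
    congr 1
    ring
  rw [this]
  rfl

omit [PolishSpace X] [BorelSpace X] [IsProbabilityMeasure ρ] [NeZero p] S hU in
lemma inv_pow_succ_apply (n : ℕ) (η : PathL2 ρ r c) :
    (U⁻¹ ^ (n + 1)) η = U.symm ((U⁻¹ ^ n) η) := by
  rw [pow_succ']
  rfl

omit [PolishSpace X] [BorelSpace X] [IsProbabilityMeasure ρ] [NeZero p] hU in
lemma phase_ne_zero (ω : PathSpace r) : α (cycleIndex c (unshift ω)) *
    (Real.sqrt (fiberCard r (r (start (unshift ω)))) : ℂ) ≠ 0 := by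
  refine mul_ne_zero (norm_ne_zero_iff.1 (by rw [S.norm_phase]; exact one_ne_zero)) ?_
  have := fiberCard_pos S.surjective S.finite_fiber (r (start (unshift ω)))
  exact_mod_cast (Real.sqrt_pos.2 (by exact_mod_cast this)).ne'

lemma apply_unshift_ae (η : PathL2 ρ r c) : ∀ᵐ ω ∂(lambdaC ρ r c), η (unshift ω) =
    α (cycleIndex c (unshift ω)) * (Real.sqrt (fiberCard r (r (start (unshift ω)))) : ℂ) *
      U.symm η ω := by
  have h := hU (U.symm η)
  rw [U.apply_symm_apply] at h
  filter_upwards [S.quasiMeasurePreserving_unshift.ae h] with ω hω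
  rw [hω, scaleFun, shift_unshift]

/-- Each application of U⁻¹ moves the argument of the multiplier to the next coordinate. Thus the
V_n see functions of arbitrarily late coordinates. -/
lemma symm_pow_piRep_ae (f : Lp ℂ ∞ ρ) {g : X → ℂ} (hfg : f =ᵐ[ρ] g) (η : PathL2 ρ r c) (n : ℕ) :
    (U⁻¹ ^ n) (piRep ρ r c f η) =ᵐ[lambdaC ρ r c] fun ω => g (ω.1 n) * (U⁻¹ ^ n) η ω := by
  induction n with
  | zero => exact piRep_ae_eq hfg (ae_eq_refl _)
  | succ n ih =>
    rw [inv_pow_succ_apply, inv_pow_succ_apply]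
    filter_upwards [S.apply_unshift_ae hU ((U⁻¹ ^ n) (piRep ρ r c f η)),
      S.apply_unshift_ae hU ((U⁻¹ ^ n) η), S.quasiMeasurePreserving_unshift.ae ih] with ω h1 h2 h3
    refine mul_left_cancel₀ (S.phase_ne_zero ω) ?_
    rw [← h1, h3, h2, unshift_apply]
    ring

lemma apply_iterate_unshift_eq_zero (η : PathL2 ρ r c) (n : ℕ) :
    ∀ᵐ ω ∂(lambdaC ρ r c), (U⁻¹ ^ n) η ω = 0 → η (unshift^[n] ω) = 0 := by
  induction n with
  | zero => exact Eventually.of_forall fun ω h => h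
  | succ n ih =>
    rw [inv_pow_succ_apply]
    filter_upwards [S.apply_unshift_ae hU ((U⁻¹ ^ n) η),
      S.quasiMeasurePreserving_unshift.ae ih] with ω h1 h2 h3
    rw [Function.iterate_succ_apply]
    exact h2 (by rw [h1, h3, mul_zero])

lemma pow_mem_cyclicSubmodule (k : ℕ) :
    (U ^ k) S.memLp_phiHat.toLp ∈ cyclicSubmodule S.memLp_phiHat.toLp := by
  induction k with
  | zero =>
    have h1 : MemLp (fun _ : X => (1 : ℂ)) ∞ ρ := memLp_const 1
    refine ⟨h1.toLp, Lp.ext ?_⟩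
    refine EventuallyEq.trans (EventuallyEq.of_eq ?_)
      (piRep_ae_eq h1.coeFn_toLp (ae_eq_refl _)).symm
    funext ω
    rw [one_mul]
    rfl
  | succ k ih =>
    rw [pow_succ']
    exact S.map_mem_cyclicSubmodule hU ih

omit [PolishSpace X] [BorelSpace X] [IsProbabilityMeasure ρ] [NeZero p] S hU in
lemma inv_pow_mem_resolutionSpace {φ η : PathL2 ρ r c} (hη : η ∈ cyclicSubmodule φ) (n : ℕ) :
    (U⁻¹ ^ n) η ∈ resolutionSpace ρ r c U φ n := by
  refine ⟨η, subset_closure hη, ?_⟩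
  rw [zpow_neg, zpow_natCast, inv_pow]

/-- A vector that is orthogonal to all the spaces `V_n` vanishes. -/
lemma eq_zero_of_orthogonal {ξ : PathL2 ρ r c}
    (hξ : ∀ n : ℕ, ∀ η ∈ resolutionSpace ρ r c U S.memLp_phiHat.toLp n, inner ℂ η ξ = 0) :
    ξ = 0 := by
  set Φ := S.memLp_phiHat.toLp with hΦ
  -- For m ≥ N the vector U^{-m} π(1_A) U^{m-N} φ̂ lies in V_m and equals 1_A(z_m) U^{-N} φ̂. Its
  -- inner product with ξ is the integral of the pointwise inner product over {z_m ∈ A}.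
  have key : ∀ N : ℕ, ∀ᵐ ω ∂(lambdaC ρ r c), inner ℂ ((U⁻¹ ^ N) Φ ω) (ξ ω) = 0 := by
    intro N
    refine ae_eq_zero_of_setIntegral_coordinate S.measurable
      (L2.integrable_inner ((U⁻¹ ^ N) Φ) ξ) N fun m hm A hA => ?_
    have hmA : MemLp (A.indicator fun _ => (1 : ℂ)) ∞ ρ :=
      memLp_indicator_const _ hA _ (Or.inr (measure_ne_top _ _))
    obtain ⟨g, hg⟩ := S.pow_mem_cyclicSubmodule hU (m - N)
    obtain ⟨k, hk⟩ := exists_piRep_mul (r := r) (c := c) hmA.toLp g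
    have hmem : (U⁻¹ ^ m) (piRep ρ r c hmA.toLp ((U ^ (m - N)) Φ)) ∈
        resolutionSpace ρ r c U Φ m := by
      refine inv_pow_mem_resolutionSpace ⟨k, ?_⟩ m
      rw [hg, hk]
    have hpow : (U⁻¹ ^ m) ((U ^ (m - N)) Φ) = (U⁻¹ ^ N) Φ := by
      have : U⁻¹ ^ m * U ^ (m - N) = U⁻¹ ^ N := by
        have h := fun k => show U⁻¹ ^ (N + k) * U ^ k = U⁻¹ ^ N by
          rw [pow_add, mul_assoc, inv_pow U k, inv_mul_cancel, mul_one]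
        have h' := h (m - N)
        rwa [Nat.add_sub_cancel' hm] at h'
      rw [← this]
      rfl
    have hae := S.symm_pow_piRep_ae hU hmA.toLp hmA.coeFn_toLp ((U ^ (m - N)) Φ) m
    rw [hpow] at hae
    rw [← hξ m _ hmem, L2.inner_def, ← integral_indicator (measurable_path_apply m hA)]
    refine integral_congr_ae ?_
    filter_upwards [hae] with ω hω
    rw [hω]
    by_cases hωA : ω.1 m ∈ A
    · rw [indicator_of_mem (show ω ∈ (fun ω : PathSpace r => ω.1 m) ⁻¹' A from hωA),
        indicator_of_mem hωA, one_mul]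
    · rw [indicator_of_notMem (show ω ∉ (fun ω : PathSpace r => ω.1 m) ⁻¹' A from hωA),
        indicator_of_notMem hωA, zero_mul, inner_zero_left]
  refine Lp.ext ?_
  have hphi : ∀ᵐ ω ∂(lambdaC ρ r c), ∀ N : ℕ, Φ (unshift^[N] ω) =
      phiHat c α m₀ (unshift^[N] ω) := ae_all_iff.2 fun N =>
    (S.quasiMeasurePreserving_unshift.iterate N).ae S.memLp_phiHat.coeFn_toLp
  filter_upwards [ae_all_iff.2 key, ae_all_iff.2 (S.apply_iterate_unshift_eq_zero hU Φ), hphi,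
    S.ae_mem_pathsToCycle, Lp.coeFn_zero ℂ 2 (lambdaC ρ r c)] with ω h1 h2 h3 h4 h5
  rw [h5]
  -- `N` depends on `ω`, which is why the almost everywhere statements were collected for all `N`
  -- beforehand.
  obtain ⟨N, hN⟩ := (S.eventually_phiHat_iterate_unshift_ne_zero h4).exists
  have h6 : (U⁻¹ ^ N) Φ ω ≠ 0 := fun h0 => hN ((h3 N).symm.trans (h2 N h0))
  have h7 := h1 N
  rw [RCLike.inner_apply, mul_eq_zero] at h7
  exact h7.resolve_right fun h => h6 (by simpa using h)

lemma closure_iUnion_resolutionSpace :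
    closure (⋃ n : ℤ, resolutionSpace ρ r c U S.memLp_phiHat.toLp n) = univ := by
  set V := resolutionSubmodule U S.memLp_phiHat.toLp with hV
  have hmono : Monotone V := monotone_int_of_le_succ fun n => S.resolutionSpace_subset hU n
  have h1 : (⋃ n : ℤ, resolutionSpace ρ r c U S.memLp_phiHat.toLp n) =
      ((⨆ n, V n : Submodule ℂ (PathL2 ρ r c)) : Set (PathL2 ρ r c)) := by
    rw [Submodule.coe_iSup_of_directed _ hmono.directed_le]
    rfl
  rw [h1, ← Submodule.topologicalClosure_coe, (Submodule.topologicalClosure_eq_top_iff).2 ?_,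
    Submodule.top_coe]
  rw [Submodule.eq_bot_iff]
  intro ξ hξ
  refine S.eq_zero_of_orthogonal hU fun n η hη => ?_
  exact (Submodule.mem_orthogonal _ _).1 hξ η (Submodule.mem_iSup_of_mem (n : ℤ) hη)

end LowPassSystem


/-! ### Recurrence for ergodic maps. -/

section Recurrence

variable {X : Type*} [MeasurableSpace X] {r : X → X} {ρ : Measure X} [IsProbabilityMeasure ρ]

/-- Almost every orbit of an ergodic map visits a set of positive measure infinitely often. -/
lemma _root_.Ergodic.ae_frequently_mem (he : Ergodic r ρ) {B : Set X} (hB : NullMeasurableSet B ρ)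
    (hB0 : ρ B ≠ 0) : ∀ᵐ x ∂ρ, ∃ᶠ n in atTop, r^[n] x ∈ B := by
  set F : Set X := {x | ∃ᶠ n in atTop, r^[n] x ∈ B} with hF
  have hFm : NullMeasurableSet F ρ := by
    have : F = ⋂ N : ℕ, ⋃ n : ℕ, ⋃ _ : N ≤ n, r^[n] ⁻¹' B := by
      ext x
      simp [hF, frequently_atTop]
    rw [this]
    exact NullMeasurableSet.iInter fun N => NullMeasurableSet.iUnion fun n =>
      NullMeasurableSet.iUnion fun _ =>
        hB.preimage (he.toMeasurePreserving.iterate n).quasiMeasurePreserving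
  have hFinv : F ⊆ r ⁻¹' F := by
    intro x hx
    have hx' : ∃ᶠ n in map (fun n => n + 1) atTop, r^[n] x ∈ B := by
      rw [map_add_atTop_eq_nat]
      exact hx
    exact hx'
  -- Poincaré recurrence puts almost all of `B` into `F`, which excludes the null case of the
  -- zero-one alternative for `F`.
  have hBF : ∀ᵐ x ∂ρ, x ∈ B → x ∈ F :=
    he.toMeasurePreserving.conservative.ae_mem_imp_frequently_image_mem hB
  rcases he.ae_empty_or_univ_of_ae_le_preimage hFm hFinv.eventuallyLE with h | h
  · refine absurd ?_ hB0
    refine measure_eq_zero_iff_ae_notMem.2 ?_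
    filter_upwards [hBF, h.mem_iff] with x h1 h2 h3
    exact h2.1 (h1 h3)
  · filter_upwards [h.mem_iff] with x hx
    exact hx.2 (mem_univ x)

end Recurrence

/-! ### Mean and variance on fibres. -/

section Mean

variable {X : Type*} {r : X → X} (hs : Function.Surjective r) (hf : ∀ x, (r ⁻¹' {x}).Finite)

/-- The mean value over the fibre `r⁻¹(x)` of a real function. -/
noncomputable def fiberMean (hf : ∀ x, (r ⁻¹' {x}).Finite) (f : X → ℝ) (x : X) : ℝ :=
  (fiberCard r x : ℝ)⁻¹ * ∑ y ∈ (hf x).toFinset, f y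

include hs in
lemma fiberAvg_ofReal {f : X → ℝ} (h0 : ∀ y, 0 ≤ f y) (x : X) :
    fiberAvg r (fun y => ENNReal.ofReal (f y)) x = ENNReal.ofReal (fiberMean hf f x) := by
  have hpos : (0 : ℝ) < fiberCard r x := by exact_mod_cast fiberCard_pos hs hf x
  rw [fiberAvg, fiberSum_eq_sum hf, fiberMean, ENNReal.ofReal_mul (by positivity),
    ENNReal.ofReal_sum_of_nonneg fun y _ => h0 y, ENNReal.ofReal_inv_of_pos hpos,
    ENNReal.ofReal_natCast]

lemma fiberMean_nonneg {f : X → ℝ} (h0 : ∀ y, 0 ≤ f y) (x : X) : 0 ≤ fiberMean hf f x :=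
  mul_nonneg (by positivity) (Finset.sum_nonneg fun y _ => h0 y)

include hs in
/-- The variance of `f` on a fibre. -/
lemma fiberMean_sub_sq (f : X → ℝ) (a : ℝ) (x : X) :
    fiberMean hf (fun y => (f y - a) ^ 2) x =
      fiberMean hf (fun y => f y ^ 2) x - 2 * a * fiberMean hf f x + a ^ 2 := by
  have hpos : (0 : ℝ) < fiberCard r x := by exact_mod_cast fiberCard_pos hs hf x
  have h1 : ∑ y ∈ (hf x).toFinset, (f y - a) ^ 2 = ∑ y ∈ (hf x).toFinset, f y ^ 2 -
      2 * a * ∑ y ∈ (hf x).toFinset, f y + fiberCard r x * a ^ 2 := by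
    rw [fiberCard_eq_card hf, Finset.mul_sum, ← Finset.sum_sub_distrib, ← nsmul_eq_mul,
      ← Finset.sum_const, ← Finset.sum_add_distrib]
    exact Finset.sum_congr rfl fun y _ => by ring
  simp only [fiberMean, h1]
  field_simp

include hs in
-- The variance about the mean is nonnegative.
lemma fiberMean_sq_le (f : X → ℝ) (x : X) :
    fiberMean hf f x ^ 2 ≤ fiberMean hf (fun y => f y ^ 2) x := by
  have h1 := fiberMean_sub_sq hs hf f (fiberMean hf f x) x
  have h2 := fiberMean_nonneg hf (f := fun y => (f y - fiberMean hf f x) ^ 2)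
    (fun y => sq_nonneg _) x
  nlinarith

include hs in
-- The variance is zero, so every deviation on the finite fibre vanishes.
lemma eq_of_fiberMean_sq_eq {f : X → ℝ} {a : ℝ} {x : X} (h1 : fiberMean hf f x = a)
    (h2 : fiberMean hf (fun y => f y ^ 2) x = a ^ 2) {y : X} (hy : r y = x) : f y = a := by
  have hpos : (0 : ℝ) < fiberCard r x := by exact_mod_cast fiberCard_pos hs hf x
  have h3 := fiberMean_sub_sq hs hf f a x
  rw [h1, h2, fiberMean, show a ^ 2 - 2 * a * a + a ^ 2 = 0 by ring,
    mul_eq_zero_iff_left (inv_ne_zero hpos.ne'),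
    Finset.sum_eq_zero_iff_of_nonneg fun y _ => sq_nonneg _] at h3
  have h4 := h3 y (by simpa using hy)
  exact sub_eq_zero.1 (pow_eq_zero_iff two_ne_zero |>.1 h4)

end Mean

/-! ### A maximal inequality along orbits. -/

namespace IsStronglyInvariant

variable {X : Type*} [MeasurableSpace X] {r : X → X} {ρ : Measure X} [IsProbabilityMeasure ρ]
  (hρ : IsStronglyInvariant r ρ) (hs : Function.Surjective r)
  (hf : ∀ x, (r ⁻¹' {x}).Finite)

include hρ hs hf

/-- A maximal inequality for the densities of a measure along the orbits of `r`. -/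
lemma setLIntegral_exists_lt_le (hr : Measurable r) {v : ℕ → X → ℝ≥0∞}
    (hv : ∀ n, AEMeasurable (v n) ρ) (hstep : ∀ n, fiberAvg r (v n) =ᵐ[ρ] v (n + 1)) (ε : ℝ≥0∞)
    (N k : ℕ) :
    ∫⁻ x in {x | ∃ n ≤ N, v (n + k) (r^[n] x) < ε}, v k x ∂ρ ≤
      ε * ρ {x | ∃ n ≤ N, v (n + k) (r^[n] x) < ε} := by
  have hp := hρ.measurePreserving hs hf hr
  have hlow : ∀ k, NullMeasurableSet {x | v k x < ε} ρ := fun k =>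
    nullMeasurableSet_lt (hv k) aemeasurable_const
  have hsmall : ∀ k, ∀ A, A ⊆ {x | v k x < ε} → NullMeasurableSet A ρ →
      ∫⁻ x in A, v k x ∂ρ ≤ ε * ρ A := by
    intro k A hA hAm
    rw [← setLIntegral_const]
    refine lintegral_mono_ae ?_
    rw [ae_restrict_iff'₀ hAm]
    exact Eventually.of_forall fun x hx => (hA hx).le
  have hnull : ∀ N k, NullMeasurableSet {x | ∃ n ≤ N, v (n + k) (r^[n] x) < ε} ρ := by
    intro N k
    have : {x | ∃ n ≤ N, v (n + k) (r^[n] x) < ε} =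
        ⋃ n : ℕ, ⋃ _ : n ≤ N, r^[n] ⁻¹' {x | v (n + k) x < ε} := by
      ext x
      simp
    rw [this]
    exact NullMeasurableSet.iUnion fun n => NullMeasurableSet.iUnion fun _ =>
      (hlow _).preimage (hp.iterate n).quasiMeasurePreserving
  -- The event for `N + 1` at level `k` splits into the preimage under `r` of the event `E` for `N`
  -- at level `k + 1` and the set `L` of remaining points, where `v k` itself is below `ε`. The
  -- level must therefore stay free.
  induction N generalizing k with
  | zero =>
    refine hsmall k _ ?_ (hnull 0 k)
    rintro x ⟨n, hn, hx⟩
    obtain rfl : n = 0 := by omega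
    simpa using hx
  | succ N ih =>
    set E := {x | ∃ n ≤ N, v (n + (k + 1)) (r^[n] x) < ε} with hE
    set L := {x | v k x < ε} \ r ⁻¹' E with hL
    have hEm : NullMeasurableSet E ρ := hnull N (k + 1)
    have hrEm : NullMeasurableSet (r ⁻¹' E) ρ := hEm.preimage hp.quasiMeasurePreserving
    have hLm : NullMeasurableSet L ρ := (hlow k).diff hrEm
    have hsplit : {x | ∃ n ≤ N + 1, v (n + k) (r^[n] x) < ε} = r ⁻¹' E ∪ L := by
      ext x
      simp only [hL, hE, mem_ofPred_eq, mem_union, Set.mem_sdiff, mem_preimage]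
      constructor
      · rintro ⟨n, hn, hx⟩
        by_cases hxE : ∃ n ≤ N, v (n + (k + 1)) (r^[n] (r x)) < ε
        · exact Or.inl hxE
        · refine Or.inr ⟨?_, hxE⟩
          cases n with
          | zero => simpa using hx
          | succ n =>
            refine absurd ⟨n, by omega, ?_⟩ hxE
            rw [← Function.iterate_succ_apply, show n + (k + 1) = n + 1 + k by omega]
            exact hx
      · rintro (⟨n, hn, hx⟩ | ⟨hx, -⟩)
        · refine ⟨n + 1, by omega, ?_⟩
          rw [Function.iterate_succ_apply, show n + 1 + k = n + (k + 1) by omega]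
          exact hx
        · exact ⟨0, by omega, by simpa using hx⟩
    -- Each fibre lies inside or outside `r ⁻¹' E` as a whole, so averaging `v k` over fibres turns
    -- the left side into the right.
    have hshift : ∫⁻ x in r ⁻¹' E, v k x ∂ρ = ∫⁻ x in E, v (k + 1) x ∂ρ := by
      rw [← lintegral_indicator₀ hrEm, ← lintegral_indicator₀ hEm,
        ← hρ.lintegral_fiberAvg hs hf ((hv k).indicator₀ hrEm)]
      refine lintegral_congr_ae ?_
      filter_upwards [hstep k] with x hx
      by_cases hxE : x ∈ E
      · rw [indicator_of_mem hxE, ← hx]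
        exact fiberAvg_congr fun y hy => indicator_of_mem (by simpa [hy] using hxE) _
      · rw [indicator_of_notMem hxE, fiberAvg_eq_zero_iff]
        exact fun y hy => indicator_of_notMem (by simpa [hy] using hxE) _
    have hdisj : Disjoint (r ⁻¹' E) L := disjoint_sdiff_right
    rw [hsplit, measure_union₀ hLm hdisj.aedisjoint, mul_add]
    calc ∫⁻ x in r ⁻¹' E ∪ L, v k x ∂ρ
        ≤ ∫⁻ x in r ⁻¹' E, v k x ∂ρ + ∫⁻ x in L, v k x ∂ρ := lintegral_union_le _ _ _
      _ ≤ _ := by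
        gcongr
        · rw [hshift, hp.measure_preimage hEm]
          exact ih (k + 1)
        · exact hsmall k L sdiff_subset hLm

/-- Where the densities of a measure along the orbits of `r` are not bounded below, the measure
vanishes. -/
lemma ae_eq_zero_of_forall_exists_lt (hr : Measurable r) {v : ℕ → X → ℝ≥0∞}
    (hv : ∀ n, AEMeasurable (v n) ρ) (hstep : ∀ n, fiberAvg r (v n) =ᵐ[ρ] v (n + 1))
    (h : ∀ᵐ x ∂ρ, ∀ ε : ℝ≥0∞, 0 < ε → ∃ n, v n (r^[n] x) < ε) : v 0 =ᵐ[ρ] 0 := by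
  have hbound : ∀ ε : ℝ≥0∞, 0 < ε → ∫⁻ x, v 0 x ∂ρ ≤ ε := by
    intro ε hε
    have hmono : Monotone fun N : ℕ => {x | ∃ n ≤ N, v (n + 0) (r^[n] x) < ε} :=
      fun M N hMN x ⟨n, hn, hx⟩ => ⟨n, hn.trans hMN, hx⟩
    have huniv : ρ.restrict (⋃ N : ℕ, {x | ∃ n ≤ N, v (n + 0) (r^[n] x) < ε}) = ρ := by
      rw [Measure.restrict_congr_set (t := univ), Measure.restrict_univ]
      filter_upwards [h] with x hx
      obtain ⟨n, hn⟩ := hx ε hε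
      exact eq_true (mem_iUnion.2 ⟨n, n, le_rfl, hn⟩)
    rw [← huniv, setLIntegral_iUnion_of_directed _ hmono.directed_le]
    refine iSup_le fun N => ?_
    refine (hρ.setLIntegral_exists_lt_le hs hf hr hv hstep ε N 0).trans ?_
    exact mul_le_of_le_one_right' prob_le_one
  rw [← lintegral_eq_zero_iff' (hv 0)]
  exact le_antisymm (le_of_forall_gt_imp_ge_of_dense fun ε hε => hbound ε hε) zero_le

end IsStronglyInvariant


/-! ### The alternative behind the trivial intersection. -/

namespace IsStronglyInvariant

variable {X : Type*} [MeasurableSpace X] {r : X → X} {ρ : Measure X} [IsProbabilityMeasure ρ]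
  (hρ : IsStronglyInvariant r ρ) (hs : Function.Surjective r)
  (hf : ∀ x, (r ⁻¹' {x}).Finite)
  {h m : X → ℝ} (h0 : ∀ x, 0 ≤ h x) (h1 : ∀ x, h x ≤ 1) (hh : AEMeasurable h ρ)
  (m0 : ∀ x, 0 ≤ m x) (hm : AEMeasurable m ρ)
  (hharm : ∀ x, fiberMean hf (fun y => (m y * √(h y)) ^ 2) x = h x)

section Defect

variable {b : ℕ → X → ℝ≥0∞} (hb : ∀ n, AEMeasurable (b n) ρ)
  (hrel : ∀ n, ∀ᵐ x ∂ρ, h x ≠ 0 → b n x = ENNReal.ofReal (m x) * b (n + 1) (r x))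

include m0 hrel in
omit [IsProbabilityMeasure ρ] in
-- The factor `√h` absorbs the restriction to `h ≠ 0` in the recursion for `b`.
lemma mul_sqrt_ae_eq (n : ℕ) : ∀ᵐ x ∂ρ, b n x * ENNReal.ofReal (√(h x)) =
    b (n + 1) (r x) * ENNReal.ofReal (m x * √(h x)) := by
  filter_upwards [hrel n] with x hx
  by_cases hx0 : h x = 0
  · simp [hx0]
  · rw [hx hx0, ENNReal.ofReal_mul (m0 x)]
    ring

include hρ hs hf h0 m0 hharm hrel

/-- The factor `b (n + 1) ∘ r` is constant on fibres and leaves the average; what remains is the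
harmonicity of `h`. -/
lemma fiberAvg_sq_ae_eq (n : ℕ) : fiberAvg r (fun x => b n x ^ 2 * ENNReal.ofReal (h x)) =ᵐ[ρ]
    fun x => b (n + 1) x ^ 2 * ENNReal.ofReal (h x) := by
  have h2 : (fun x => b n x ^ 2 * ENNReal.ofReal (h x)) =ᵐ[ρ]
      fun x => b (n + 1) (r x) ^ 2 * ENNReal.ofReal ((m x * √(h x)) ^ 2) := by
    filter_upwards [mul_sqrt_ae_eq m0 hrel n] with x hx
    have h3 : ENNReal.ofReal (h x) = ENNReal.ofReal (√(h x)) ^ 2 := by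
      rw [← ENNReal.ofReal_pow (Real.sqrt_nonneg _), Real.sq_sqrt (h0 x)]
    rw [h3, ← mul_pow, hx, mul_pow,
      ENNReal.ofReal_pow (mul_nonneg (m0 x) (Real.sqrt_nonneg _))]
  filter_upwards [hρ.fiberAvg_ae_eq hs hf h2] with x hx
  rw [hx, fiberAvg_comp_mul (fun y => ENNReal.ofReal ((m y * √(h y)) ^ 2)) (fun y => b (n + 1) y ^ 2),
    fiberAvg_ofReal hs hf (fun y => sq_nonneg _), hharm]

include hb hh

lemma lintegral_sq_eq (n : ℕ) : ∫⁻ x, b n x ^ 2 * ENNReal.ofReal (h x) ∂ρ =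
    ∫⁻ x, b 0 x ^ 2 * ENNReal.ofReal (h x) ∂ρ := by
  induction n with
  | zero => rfl
  | succ n ih =>
    rw [← ih, ← hρ.lintegral_fiberAvg hs hf
      (f := fun x => b n x ^ 2 * ENNReal.ofReal (h x)) (((hb n).pow_const 2).mul hh.ennreal_ofReal)]
    exact (lintegral_congr_ae
      (hρ.fiberAvg_sq_ae_eq hs hf h0 m0 hharm hrel n)).symm

omit hrel hb h0 hharm in
lemma aemeasurable_fiberMean_mul_sqrt (hm : AEMeasurable m ρ) :
    AEMeasurable (fiberMean hf fun y => m y * √(h y)) ρ := by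
  have h2 := (hρ.aemeasurable_fiberAvg hs hf
    (f := fun y => ENNReal.ofReal (m y * √(h y))) (hm.mul hh.sqrt).ennreal_ofReal).ennreal_toReal
  refine h2.congr (Eventually.of_forall fun x => ?_)
  dsimp only
  rw [fiberAvg_ofReal hs hf (fun y => mul_nonneg (m0 y) (Real.sqrt_nonneg _)),
    ENNReal.toReal_ofReal (fiberMean_nonneg hf
      (fun y => mul_nonneg (m0 y) (Real.sqrt_nonneg _)) x)]

omit hρ h0 m0 hh hb hrel [IsProbabilityMeasure ρ] [MeasurableSpace X] in
lemma fiberMean_mul_sqrt_le (x : X) : fiberMean hf (fun y => m y * √(h y)) x ≤ √(h x) := by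
  refine Real.le_sqrt_of_sq_le ?_
  rw [← hharm x]
  exact fiberMean_sq_le hs hf _ x

omit h0 in
-- Averaging `b n * √h` over fibres gives `b (n + 1)` times the mean of `m √h`, which falls short of
-- `√h` by the Cauchy–Schwarz defect.
lemma lintegral_mul_sqrt_succ (hm : AEMeasurable m ρ) (n : ℕ) :
    ∫⁻ x, b (n + 1) x * ENNReal.ofReal (√(h x)) ∂ρ =
      ∫⁻ x, b n x * ENNReal.ofReal (√(h x)) ∂ρ +
      ∫⁻ x, b (n + 1) x *
        ENNReal.ofReal (√(h x) - fiberMean hf (fun y => m y * √(h y)) x) ∂ρ := by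
  have ha : ∀ y, 0 ≤ m y * √(h y) := fun y => mul_nonneg (m0 y) (Real.sqrt_nonneg _)
  have hmean := hρ.aemeasurable_fiberMean_mul_sqrt hs hf hh m0 hm
  have h2 : ∫⁻ x, b n x * ENNReal.ofReal (√(h x)) ∂ρ =
      ∫⁻ x, b (n + 1) x * ENNReal.ofReal (fiberMean hf (fun y => m y * √(h y)) x) ∂ρ := by
    rw [← hρ.lintegral_fiberAvg hs hf
      (f := fun x => b n x * ENNReal.ofReal (√(h x))) ((hb n).mul hh.sqrt.ennreal_ofReal)]
    refine lintegral_congr_ae ?_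
    filter_upwards [hρ.fiberAvg_ae_eq hs hf (mul_sqrt_ae_eq m0 hrel n)] with x hx
    rw [hx, fiberAvg_comp_mul (fun y => ENNReal.ofReal (m y * √(h y))), fiberAvg_ofReal hs hf ha]
  have hbm : AEMeasurable (fun x => b (n + 1) x *
      ENNReal.ofReal (fiberMean hf (fun y => m y * √(h y)) x)) ρ :=
    (hb (n + 1)).mul hmean.ennreal_ofReal
  rw [h2, ← lintegral_add_left' hbm]
  refine lintegral_congr fun x => ?_
  rw [← mul_add, ← ENNReal.ofReal_add (fiberMean_nonneg hf ha x)
    (sub_nonneg.2 (fiberMean_mul_sqrt_le hs hf hharm x)), add_sub_cancel]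

include h1

/-- If the densities `b_n² h` do not vanish, then `m √h` is constant on the fibres. -/
lemma ae_fiberMean_eq_or_ae_eq_zero (hr : Measurable r) (hm : AEMeasurable m ρ)
    (he : Ergodic r ρ) (hfin : ∫⁻ x, b 0 x ^ 2 * ENNReal.ofReal (h x) ∂ρ ≠ ∞) :
    (∀ᵐ x ∂ρ, fiberMean hf (fun y => m y * √(h y)) x = √(h x)) ∨
      ∀ᵐ x ∂ρ, b 0 x ^ 2 * ENNReal.ofReal (h x) = 0 := by
  set D : X → ℝ := fun x => √(h x) - fiberMean hf (fun y => m y * √(h y)) x with hD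
  have hp := hρ.measurePreserving hs hf hr
  have hDm : AEMeasurable D ρ :=
    hh.sqrt.sub (hρ.aemeasurable_fiberMean_mul_sqrt hs hf hh m0 hm)
  have hD0 : ∀ x, 0 ≤ D x := fun x => sub_nonneg.2 (fiberMean_mul_sqrt_le hs hf hharm x)
  refine or_iff_not_imp_left.2 fun hne => ?_
  have hpos : ∃ j : ℕ, ρ {x | 1 / ((j : ℝ) + 1) < D x} ≠ 0 := by
    by_contra! hcon
    refine hne ?_
    have h2 : ∀ᵐ x ∂ρ, ∀ j : ℕ, ¬ 1 / ((j : ℝ) + 1) < D x :=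
      ae_all_iff.2 fun j => measure_eq_zero_iff_ae_notMem.1 (hcon j)
    filter_upwards [h2] with x hx
    by_contra hx0
    have hx1 : 0 < D x := lt_of_le_of_ne (hD0 x) fun h3 => hx0 (sub_eq_zero.1 h3.symm).symm
    obtain ⟨j, hj⟩ := exists_nat_one_div_lt hx1
    exact hx j hj
  obtain ⟨j, hj⟩ := hpos
  set δ : ℝ := 1 / ((j : ℝ) + 1) with hδ
  have hδ0 : 0 < δ := by positivity
  have hfreq := he.ae_frequently_mem (nullMeasurableSet_lt aemeasurable_const hDm) hj
  have hbound : ∀ N : ℕ, ∑ n ∈ Finset.range N, ∫⁻ x, b (n + 1) x * ENNReal.ofReal (D x) ∂ρ ≤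
      ∫⁻ x, b N x * ENNReal.ofReal (√(h x)) ∂ρ := by
    intro N
    induction N with
    | zero => simp
    | succ N ih =>
      rw [Finset.sum_range_succ,
        hρ.lintegral_mul_sqrt_succ hs hf hh m0 hharm hb hrel hm N]
      gcongr
  -- From `t ≤ 1 + t²` and the conservation of `∫ b_N² h`: a bound independent of `N`.
  have hbound2 : ∀ N : ℕ, ∫⁻ x, b N x * ENNReal.ofReal (√(h x)) ∂ρ ≤
      1 + ∫⁻ x, b 0 x ^ 2 * ENNReal.ofReal (h x) ∂ρ := by
    intro N
    rw [← hρ.lintegral_sq_eq hs hf h0 hh m0 hharm hb hrel N]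
    have h2 : ∀ x, b N x * ENNReal.ofReal (√(h x)) ≤ 1 + b N x ^ 2 * ENNReal.ofReal (h x) := by
      intro x
      have h3 : ENNReal.ofReal (h x) = ENNReal.ofReal (√(h x)) ^ 2 := by
        rw [← ENNReal.ofReal_pow (Real.sqrt_nonneg _), Real.sq_sqrt (h0 x)]
      rw [h3, ← mul_pow]
      rcases le_total (b N x * ENNReal.ofReal (√(h x))) 1 with h4 | h4
      · exact h4.trans le_self_add
      · exact (le_self_pow h4 two_ne_zero).trans le_add_self
    refine (lintegral_mono h2).trans ?_
    rw [lintegral_add_left measurable_const]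
    simp
  have hbD : ∀ n, AEMeasurable (fun x => b (n + 1) x * ENNReal.ofReal (D x)) ρ := fun n =>
    (hb (n + 1)).mul hDm.ennreal_ofReal
  have hbDr : ∀ n : ℕ, AEMeasurable (fun x =>
      b (n + 1) (r^[n + 1] x) * ENNReal.ofReal (D (r^[n + 1] x))) ρ := fun n =>
    (hbD n).comp_quasiMeasurePreserving (hp.iterate (n + 1)).quasiMeasurePreserving
  -- Invariance of `ρ` places all the terms on a single orbit, so that they tend to zero along
  -- almost every orbit.
  have hsum : ∫⁻ x, ∑' n : ℕ, b (n + 1) (r^[n + 1] x) * ENNReal.ofReal (D (r^[n + 1] x)) ∂ρ ≠ ∞ := by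
    rw [lintegral_tsum hbDr]
    have h2 : ∀ n, ∫⁻ x, b (n + 1) (r^[n + 1] x) * ENNReal.ofReal (D (r^[n + 1] x)) ∂ρ =
        ∫⁻ x, b (n + 1) x * ENNReal.ofReal (D x) ∂ρ := by
      intro n
      have h3 := (hp.iterate (n + 1)).map_eq
      have h4 := hbD n
      rw [← h3] at h4
      conv_rhs => rw [← h3]
      rw [lintegral_map' h4 (hp.iterate (n + 1)).aemeasurable]
    simp only [h2]
    rw [ENNReal.tsum_eq_iSup_nat]
    refine ne_top_of_le_ne_top (b := 1 + ∫⁻ x, b 0 x ^ 2 * ENNReal.ofReal (h x) ∂ρ) ?_ ?_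
    · exact ENNReal.add_ne_top.2 ⟨ENNReal.one_ne_top, hfin⟩
    · exact iSup_le fun N => (hbound N).trans (hbound2 N)
  have hsum' : ∀ᵐ x ∂ρ, ∑' n : ℕ, b (n + 1) (r^[n + 1] x) *
      ENNReal.ofReal (D (r^[n + 1] x)) < ∞ :=
    ae_lt_top' (AEMeasurable.tsum hbDr) hsum
  refine hρ.ae_eq_zero_of_forall_exists_lt hs hf hr
    (v := fun n x => b n x ^ 2 * ENNReal.ofReal (h x))
    (fun n => ((hb n).pow_const 2).mul hh.ennreal_ofReal)
    (fun n => hρ.fiberAvg_sq_ae_eq hs hf h0 m0 hharm hrel n) ?_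
  filter_upwards [hfreq, hsum'] with x hx1 hx2 ε hε
  have hlim : Tendsto (fun n : ℕ => b n (r^[n] x) * ENNReal.ofReal (D (r^[n] x))) atTop (𝓝 0) :=
    (tendsto_add_atTop_iff_nat 1).1 (ENNReal.tendsto_atTop_zero_of_tsum_ne_top hx2.ne)
  -- At the infinitely many times when `D` exceeds `δ`, a small product forces `b_n` below `min ε
  -- 1`. The bound by 1 gives `b_n² ≤ b_n`.
  have hε' : 0 < ENNReal.ofReal δ * min ε 1 :=
    ENNReal.mul_pos (ENNReal.ofReal_pos.2 hδ0).ne' (lt_min hε one_pos).ne'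
  obtain ⟨n, hn1, hn2⟩ := (hx1.and_eventually (hlim.eventually (gt_mem_nhds hε'))).exists
  refine ⟨n, ?_⟩
  have h5 : b n (r^[n] x) < min ε 1 := by
    by_contra! h6
    refine hn2.not_ge ?_
    rw [mul_comm]
    gcongr
  calc b n (r^[n] x) ^ 2 * ENNReal.ofReal (h (r^[n] x))
      ≤ b n (r^[n] x) ^ 2 * 1 := by
        gcongr
        exact ENNReal.ofReal_le_one.2 (h1 _)
    _ = b n (r^[n] x) * b n (r^[n] x) := by rw [mul_one, sq]
    _ ≤ b n (r^[n] x) * 1 := by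
        gcongr
        exact (h5.trans_le (min_le_right _ _)).le
    _ < ε := by
        rw [mul_one]
        exact h5.trans_le (min_le_left _ _)

end Defect

include hρ hs hf h0 h1 hh m0 hm hharm

omit h1 in
/-- If `m √h` is constant on the fibres, then `h` is invariant and `m = 1` where `h ≠ 0`. -/
lemma ae_eq_one_of_fiberMean_eq (hr : Measurable r)
    (hm1 : ∀ x, fiberMean hf (fun y => m y ^ 2) x = 1)
    (hconst : ∀ᵐ x ∂ρ, fiberMean hf (fun y => m y * √(h y)) x = √(h x)) :
    ∀ᵐ x ∂ρ, h (r x) = m x ^ 2 * h x ∧ (h x = 0 ∨ m x = 1) := by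
  have hp := hρ.measurePreserving hs hf hr
  have hcob : ∀ᵐ x ∂ρ, h (r x) = m x ^ 2 * h x := by
    filter_upwards [hp.quasiMeasurePreserving.ae hconst] with x hx
    have h2 : m x * √(h x) = √(h (r x)) := eq_of_fiberMean_sq_eq hs hf hx
      (by rw [hharm, Real.sq_sqrt (h0 _)]) rfl
    rw [← Real.sq_sqrt (h0 (r x)), ← h2, mul_pow, Real.sq_sqrt (h0 x)]
  -- `Q` is the surplus term in `hid`, chosen so that all other terms cancel after integration. It
  -- vanishes only where `h = 0` or `m² = 1`.
  set Q : X → ℝ := fun x => h x * (m x ^ 2 - 1) ^ 2 / ((1 + h x) * (1 + h (r x)) ^ 2) with hQ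
  have hhr : AEMeasurable (fun x => h (r x)) ρ :=
    hh.comp_quasiMeasurePreserving hp.quasiMeasurePreserving
  have hQ0 : ∀ x, 0 ≤ Q x := fun x => by
    have := h0 x
    have := h0 (r x)
    positivity
  have hQm : AEMeasurable Q ρ :=
    (hh.mul (((hm.pow_const 2).sub_const 1).pow_const 2)).div
      ((hh.const_add 1).mul ((hhr.const_add 1).pow_const 2))
  -- Bounded functions of `h`, so that the integrals to be cancelled are finite without using a
  -- bound on `h`.
  let k₁ : ℝ → ℝ := fun t => t / (1 + t)
  let k₂ : ℝ → ℝ := fun t => t / (1 + t) ^ 2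
  have hk₁ : Measurable k₁ := by fun_prop
  have hk₂ : Measurable k₂ := by fun_prop
  have hk₁0 : ∀ x, 0 ≤ k₁ (h x) := fun x => by
    have := h0 x
    positivity
  have hk₂0 : ∀ x, 0 ≤ k₂ (h x) := fun x => by
    have := h0 x
    positivity
  have hk₁1 : ∀ x, k₁ (h x) ≤ 1 := fun x => by
    have := h0 x
    exact div_le_one_of_le₀ (by linarith) (by linarith)
  have hk₂1 : ∀ x, k₂ (h x) ≤ 1 := fun x => by
    have := h0 x
    exact div_le_one_of_le₀ (by nlinarith) (by positivity)
  have hid : ∀ᵐ x ∂ρ, ENNReal.ofReal (k₁ (h x)) +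
      ENNReal.ofReal (k₂ (h (r x))) * ENNReal.ofReal (m x ^ 2) =
      ENNReal.ofReal (k₁ (h (r x))) + ENNReal.ofReal (k₂ (h (r x))) + ENNReal.ofReal (Q x) := by
    filter_upwards [hcob] with x hx
    have hx0 := h0 x
    have hx1 := h0 (r x)
    rw [← ENNReal.ofReal_mul (hk₂0 _), ← ENNReal.ofReal_add (hk₁0 _) (mul_nonneg (hk₂0 _)
      (sq_nonneg _)), ← ENNReal.ofReal_add (hk₁0 _) (hk₂0 _),
      ← ENNReal.ofReal_add (add_nonneg (hk₁0 _) (hk₂0 _)) (hQ0 x)]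
    congr 1
    have hne1 : 1 + h x ≠ 0 := by positivity
    have hne2 : 1 + m x ^ 2 * h x ≠ 0 := by positivity
    simp only [k₁, k₂, hQ, hx]
    field_simp
    ring
  have hcomp : ∀ k : ℝ → ℝ, Measurable k → ∫⁻ x, ENNReal.ofReal (k (h (r x))) ∂ρ =
      ∫⁻ x, ENNReal.ofReal (k (h x)) ∂ρ := by
    intro k hk
    rw [← hρ.lintegral_fiberAvg hs hf
      (f := fun x => ENNReal.ofReal (k (h (r x)))) (hk.comp_aemeasurable hhr).ennreal_ofReal]
    exact lintegral_congr fun x => fiberAvg_comp hs hf (fun y => ENNReal.ofReal (k (h y))) x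
  -- The quadrature condition, mean of `m²` equal to 1 on every fibre, enters here.
  have hweight : ∫⁻ x, ENNReal.ofReal (k₂ (h (r x))) * ENNReal.ofReal (m x ^ 2) ∂ρ =
      ∫⁻ x, ENNReal.ofReal (k₂ (h x)) ∂ρ := by
    rw [← hρ.lintegral_fiberAvg hs hf
      (f := fun x => ENNReal.ofReal (k₂ (h (r x))) * ENNReal.ofReal (m x ^ 2))
      ((hk₂.comp_aemeasurable hhr).ennreal_ofReal.mul (hm.pow_const 2).ennreal_ofReal)]
    refine lintegral_congr fun x => ?_
    rw [fiberAvg_comp_mul (fun y => ENNReal.ofReal (m y ^ 2)) (fun y => ENNReal.ofReal (k₂ (h y))),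
      fiberAvg_ofReal hs hf (fun y => sq_nonneg _), hm1, ENNReal.ofReal_one, mul_one]
  have hlt : ∀ k : ℝ → ℝ, (∀ x, k (h x) ≤ 1) → ∫⁻ x, ENNReal.ofReal (k (h x)) ∂ρ ≠ ∞ := by
    intro k hk
    refine ne_top_of_le_ne_top ENNReal.one_ne_top
      ((lintegral_mono fun x => ENNReal.ofReal_le_one.2 (hk x)).trans ?_)
    simp
  have hint := lintegral_congr_ae hid
  have hk₁h : AEMeasurable (fun x => ENNReal.ofReal (k₁ (h x))) ρ :=
    (hk₁.comp_aemeasurable hh).ennreal_ofReal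
  have hk₁hr : AEMeasurable (fun x => ENNReal.ofReal (k₁ (h (r x)))) ρ :=
    (hk₁.comp_aemeasurable hhr).ennreal_ofReal
  rw [lintegral_add_left' hk₁h, lintegral_add_right' _ hQm.ennreal_ofReal,
    lintegral_add_left' hk₁hr, hweight, hcomp k₁ hk₁,
    hcomp k₂ hk₂] at hint
  have hQint : ∫⁻ x, ENNReal.ofReal (Q x) ∂ρ = 0 := by
    refine (ENNReal.add_right_inj
      (ENNReal.add_ne_top.2 ⟨hlt k₁ hk₁1, hlt k₂ hk₂1⟩)).1 ?_
    rw [add_zero]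
    exact hint.symm
  rw [lintegral_eq_zero_iff' hQm.ennreal_ofReal] at hQint
  filter_upwards [hcob, hQint] with x hx hxQ
  refine ⟨hx, ?_⟩
  have hx0 := h0 x
  have hx1 := h0 (r x)
  have hQx : Q x = 0 := le_antisymm (ENNReal.ofReal_eq_zero.1 hxQ) (hQ0 x)
  have hden : (1 + h x) * (1 + h (r x)) ^ 2 ≠ 0 := by positivity
  simp only [hQ, div_eq_zero_iff, hden, or_false, mul_eq_zero, pow_eq_zero_iff two_ne_zero] at hQx
  refine hQx.imp_right fun h2 => ?_
  have h3 : (m x - 1) * (m x + 1) = 0 := by linarith [h2]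
  rcases mul_eq_zero.1 h3 with h4 | h4
  · linarith
  · linarith [m0 x]

/-- A consistent sequence of densities vanishes unless `m = 1` almost everywhere. -/
lemma ae_eq_one_or_ae_eq_zero (hr : Measurable r) (he : Ergodic r ρ)
    (hm1 : ∀ x, fiberMean hf (fun y => m y ^ 2) x = 1) {b : ℕ → X → ℝ≥0∞}
    (hb : ∀ n, AEMeasurable (b n) ρ)
    (hrel : ∀ n, ∀ᵐ x ∂ρ, h x ≠ 0 → b n x = ENNReal.ofReal (m x) * b (n + 1) (r x))
    (hfin : ∫⁻ x, b 0 x ^ 2 * ENNReal.ofReal (h x) ∂ρ ≠ ∞) :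
    (∀ᵐ x ∂ρ, m x = 1) ∨ ∀ᵐ x ∂ρ, b 0 x ^ 2 * ENNReal.ofReal (h x) = 0 := by
  rcases hρ.ae_fiberMean_eq_or_ae_eq_zero hs hf h0 h1 hh m0 hharm hb hrel hr hm he hfin with
    hconst | hzero
  · have h2 := hρ.ae_eq_one_of_fiberMean_eq hs hf h0 hh m0 hm hharm hr hm1 hconst
    have hinv : h ∘ r =ᵐ[ρ] h := by
      filter_upwards [h2] with x hx
      rw [Function.comp_apply, hx.1]
      rcases hx.2 with h3 | h3
      · rw [h3, mul_zero]
      · rw [h3, one_pow, one_mul]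
    obtain ⟨a, ha⟩ := he.ae_eq_const_of_ae_eq_comp_ae hh.aestronglyMeasurable hinv
    by_cases ha0 : a = 0
    · right
      filter_upwards [ha] with x hx
      simp [hx, ha0]
    · left
      filter_upwards [ha, h2] with x hx hx2
      exact hx2.2.resolve_left (by rw [hx]; exact ha0)
  · exact Or.inr hzero

end IsStronglyInvariant


/-! ### Vectors of V₀ and the intersection of the V_n. -/

section CoreSpace

variable {X : Type*} [TopologicalSpace X] [MeasurableSpace X] {ρ : Measure X} {r : X → X} {p : ℕ}
  {c : ZMod p → X}

/-- The vectors of `V₀` are the products of `φ` with functions of the starting point. -/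
lemma exists_eq_mul_of_mem_coreSpace {φ η : PathL2 ρ r c} (h : η ∈ coreSpace ρ r c φ) :
    ∃ g : X → ℂ, StronglyMeasurable g ∧ η =ᵐ[lambdaC ρ r c] fun ω => g (start ω) * φ ω := by
  obtain ⟨u, hu, hlim⟩ := mem_closure_iff_seq_limit.1 h
  choose f hf using hu
  obtain ⟨ns, -, hns⟩ := (tendstoInMeasure_of_tendsto_Lp hlim).exists_seq_tendsto_ae
  -- Along an almost everywhere convergent subsequence the multipliers converge at the starting
  -- points of paths with `φ ω ≠ 0`. Where `φ ω = 0`, the value of the limit is irrelevant.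
  refine ⟨fun x => limUnder atTop fun k => f (ns k) x,
    StronglyMeasurable.limUnder fun k => Lp.stronglyMeasurable _, ?_⟩
  filter_upwards [hns, ae_all_iff.2 fun k => coeFn_piRep ρ r c (f (ns k)) φ] with ω h1 h2
  simp only [hf, h2] at h1
  by_cases h0 : φ ω = 0
  · simp only [h0, mul_zero] at h1 ⊢
    exact tendsto_nhds_unique h1 tendsto_const_nhds
  · have h3 : Tendsto (fun k => f (ns k) (start ω)) atTop (𝓝 (η ω / φ ω)) := by
      simpa [h0] using h1.div_const (φ ω)
    rw [h3.limUnder_eq, div_mul_cancel₀ _ h0]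

end CoreSpace

namespace LowPassSystem

variable {X : Type*} [TopologicalSpace X] [PolishSpace X] [MeasurableSpace X]
  [BorelSpace X] {r : X → X} {ρ : Measure X} [IsProbabilityMeasure ρ] {p : ℕ} [NeZero p]
  {c : ZMod p → X} {α : ZMod p → ℂ} {m₀ : X → ℂ} (S : LowPassSystem r ρ c α m₀)

include S

omit [PolishSpace X] [BorelSpace X] [IsProbabilityMeasure ρ] [NeZero p] in
lemma fiberAvg_norm_sq_mul (g : X → ℝ≥0∞) (x : X) :
    fiberAvg r (fun y => ENNReal.ofReal (‖m₀ y‖ ^ 2) * g y) x =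
      fiberSum r (fun y => ENNReal.ofReal (filterWeight r m₀ y) * g y) x := by
  have hpos : (0 : ℝ) < fiberCard r x := by
    exact_mod_cast fiberCard_pos S.surjective S.finite_fiber x
  rw [fiberAvg, ← fiberSum_const_mul]
  refine fiberSum_congr fun y hy => ?_
  rw [filterWeight, hy, ENNReal.ofReal_div_of_pos hpos, ENNReal.ofReal_natCast,
    ENNReal.div_eq_inv_mul, mul_assoc]

omit [PolishSpace X] [BorelSpace X] [IsProbabilityMeasure ρ] [NeZero p] in
lemma fiberMean_norm_sq (x : X) : fiberMean S.finite_fiber (fun y => ‖m₀ y‖ ^ 2) x = 1 := by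
  have h1 := S.fiberAvg_norm_sq_mul (fun _ => 1) x
  simp only [mul_one] at h1
  rw [fiberAvg_ofReal S.surjective S.finite_fiber fun y => sq_nonneg _, S.sum_weight x] at h1
  exact ENNReal.ofReal_eq_one.1 h1

omit [IsProbabilityMeasure ρ] in
lemma fiberMean_norm_mul_sqrt_harmonicFun (x : X) :
    fiberMean S.finite_fiber
      (fun y => (‖m₀ y‖ * √(harmonicFun r (filterWeight r m₀) c y)) ^ 2) x =
      harmonicFun r (filterWeight r m₀) c x := by
  have h1 := S.fiberAvg_norm_sq_mul
    (fun y => ENNReal.ofReal (harmonicFun r (filterWeight r m₀) c y)) x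
  simp only [← ENNReal.ofReal_mul (sq_nonneg _)] at h1
  rw [fiberAvg_ofReal S.surjective S.finite_fiber
    (fun y => mul_nonneg (sq_nonneg _) (harmonicFun_nonneg y))] at h1
  simp only [mul_pow, Real.sq_sqrt (harmonicFun_nonneg _)]
  refine (ENNReal.ofReal_eq_ofReal_iff (fiberMean_nonneg _
    (fun y => mul_nonneg (sq_nonneg _) (harmonicFun_nonneg y)) x) (harmonicFun_nonneg x)).1 ?_
  rw [h1, ← S.fiberSum_weight_mul_harmonicFun x]

lemma lintegral_mul_phiHat {g : X → ℂ} (hg : StronglyMeasurable g) :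
    ∫⁻ ω, ‖g (start ω) * phiHat c α m₀ ω‖ₑ ^ 2 ∂(lambdaC ρ r c) =
      ∫⁻ x, ‖g x‖ₑ ^ 2 * ENNReal.ofReal (harmonicFun r (filterWeight r m₀) c x) ∂ρ := by
  have hm : AEMeasurable (fun ω : PathSpace r => ‖g (start ω) * phiHat c α m₀ ω‖ₑ ^ 2)
      (lambdaC ρ r c) :=
    ((hg.comp_measurable measurable_start).aestronglyMeasurable.mul
      S.aestronglyMeasurable_phiHat).enorm.pow_const 2
  rw [S.lintegral_lambdaC hm]
  refine lintegral_congr fun x => ?_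
  rw [S.ofReal_harmonicFun, ← ENNReal.tsum_mul_left]
  refine tsum_congr fun ω => ?_
  have : start (ω : PathSpace r) = x := ω.2.1
  rw [enorm_mul, mul_pow, this]

/-- A function of the starting point is determined, where `h_C ≠ 0`, by its product with `φ̂`. -/
lemma ae_eq_of_mul_phiHat_ae_eq {f g : X → ℂ}
    (h : (fun ω => f (start ω) * phiHat (r := r) c α m₀ ω) =ᵐ[lambdaC ρ r c]
      fun ω => g (start ω) * phiHat c α m₀ ω) :
    ∀ᵐ x ∂ρ, harmonicFun r (filterWeight r m₀) c x ≠ 0 → f x = g x := by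
  filter_upwards [S.ae_cyclePaths h] with x hx h0
  by_contra hne
  refine h0 ?_
  have h1 : ENNReal.ofReal (harmonicFun r (filterWeight r m₀) c x) = 0 := by
    rw [S.ofReal_harmonicFun]
    refine ENNReal.tsum_eq_zero.2 fun ω => ?_
    have h2 := hx ω ω.2
    have h3 : start (ω : PathSpace r) = x := ω.2.1
    simp only [h3] at h2
    have h4 : phiHat c α m₀ (ω : PathSpace r) = 0 := by
      by_contra h5
      exact hne (mul_right_cancel₀ h5 h2)
    simp [h4]
  exact le_antisymm (ENNReal.ofReal_eq_zero.1 h1) (harmonicFun_nonneg x)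

variable {U : PathL2 ρ r c ≃ₗᵢ[ℂ] PathL2 ρ r c}
  (hU : ∀ ξ : PathL2 ρ r c, U ξ =ᵐ[lambdaC ρ r c] scaleFun c α ξ)

include hU

/-- Covariance combined with the scaling equation, for multipliers that need not be bounded, as they
arise from the closure in V₀. -/
lemma map_ae_eq_mul {η : PathL2 ρ r c} {g : X → ℂ}
    (h : η =ᵐ[lambdaC ρ r c] fun ω => g (start ω) * phiHat c α m₀ ω) :
    U η =ᵐ[lambdaC ρ r c] fun ω => (m₀ (start ω) * g (r (start ω))) * phiHat c α m₀ ω := by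
  refine (hU η).trans ((S.scaleFun_congr h).trans (S.ae_of_forall_mem fun ω hω => ?_))
  have h1 := S.scaleFun_phiHat hω
  simp only [scaleFun, start_shift] at h1 ⊢
  rw [mul_right_comm (m₀ _), ← h1]
  ring

/-- If `ρ` is ergodic and `|m₀|` is not almost everywhere equal to one, then the intersection of
the spaces `V_n` is trivial. -/
lemma iInter_resolutionSpace (he : Ergodic r ρ) (hne : ρ {x | ‖m₀ x‖ ≠ 1} ≠ 0) :
    ⋂ n : ℤ, resolutionSpace ρ r c U S.memLp_phiHat.toLp n = {0} := by
  set Φ := S.memLp_phiHat.toLp with hΦ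
  refine Subset.antisymm (fun ξ hξ => ?_) ?_
  · rw [mem_iInter] at hξ
    have hex : ∀ n : ℕ, ∃ η ∈ coreSpace ρ r c Φ, (U ^ n) η = ξ := by
      intro n
      -- Only V_{-n} = Uⁿ V₀ with n ≥ 0 are used.
      obtain ⟨η, hη, h⟩ := hξ (-n)
      refine ⟨η, hη, ?_⟩
      rwa [neg_neg, zpow_natCast] at h
    choose η hη hηξ using hex
    have hstep : ∀ n, U (η (n + 1)) = η n := by
      intro n
      refine (U ^ n).injective ?_
      rw [hηξ n, ← hηξ (n + 1), pow_succ]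
      rfl
    choose g hgm hg using fun n => exists_eq_mul_of_mem_coreSpace (hη n)
    have hg' : ∀ n, η n =ᵐ[lambdaC ρ r c] fun ω => g n (start ω) * phiHat c α m₀ ω := by
      intro n
      filter_upwards [hg n, S.memLp_phiHat.coeFn_toLp] with ω h1 h2
      rw [h1, h2]
    have hrel : ∀ n, ∀ᵐ x ∂ρ, harmonicFun r (filterWeight r m₀) c x ≠ 0 →
        ‖g n x‖ₑ = ENNReal.ofReal ‖m₀ x‖ * ‖g (n + 1) (r x)‖ₑ := by
      intro n
      have h1 := S.map_ae_eq_mul hU (hg' (n + 1))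
      rw [hstep] at h1
      filter_upwards [S.ae_eq_of_mul_phiHat_ae_eq (f := g n)
        (g := fun x => m₀ x * g (n + 1) (r x)) ((hg' n).symm.trans h1)] with x hx h0
      rw [hx h0, enorm_mul, ofReal_norm]
    have hnorm : ∫⁻ x, ‖g 0 x‖ₑ ^ 2 *
        ENNReal.ofReal (harmonicFun r (filterWeight r m₀) c x) ∂ρ = ‖ξ‖ₑ ^ 2 := by
      have h1 : η 0 = ξ := hηξ 0
      have h2 : eLpNorm (η 0) 2 (lambdaC ρ r c) ^ 2 = ∫⁻ ω, ‖η 0 ω‖ₑ ^ 2 ∂(lambdaC ρ r c) := by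
        have := eLpNorm_nnreal_pow_eq_lintegral (f := η 0) (μ := lambdaC ρ r c) (p := 2)
          two_ne_zero
        simpa using this
      rw [← S.lintegral_mul_phiHat (hgm 0), ← h1, Lp.enorm_def, h2]
      refine lintegral_congr_ae ?_
      filter_upwards [hg' 0] with ω hω
      rw [hω]
    have halt := S.invariant.ae_eq_one_or_ae_eq_zero S.surjective S.finite_fiber
      (h := harmonicFun r (filterWeight r m₀) c) (m := fun x => ‖m₀ x‖) harmonicFun_nonneg
      S.harmonicFun_le_one S.aemeasurable_harmonicFun (fun x => norm_nonneg _)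
      S.memLp.1.norm.aemeasurable S.fiberMean_norm_mul_sqrt_harmonicFun S.measurable he
      S.fiberMean_norm_sq (b := fun n x => ‖g n x‖ₑ)
      (fun n => (hgm n).aestronglyMeasurable.enorm) hrel
      (by rw [hnorm]; exact ENNReal.pow_ne_top enorm_ne_top)
    rcases halt with h | h
    · exact absurd (ae_iff.1 h) hne
    · rw [lintegral_congr_ae h, lintegral_zero] at hnorm
      exact enorm_eq_zero.1 (pow_eq_zero_iff two_ne_zero |>.1 hnorm.symm)
  · rintro _ rfl
    refine mem_iInter.2 fun n => ⟨0, subset_closure ?_, map_zero _⟩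
    exact (cyclicSubmodule Φ).zero_mem

end LowPassSystem

/-! ### Assembling the system from the hypotheses. -/

section Construction

variable {X : Type*} [MetricSpace X] [MeasurableSpace X] {r : X → X} {ρ : Measure X} {p : ℕ}
  [NeZero p] {c : ZMod p → X} {α : ZMod p → ℂ} {m₀ : X → ℂ}

lemma IsRepellingCycle.lowPassSystem (hr_meas : Measurable r) (hr_surj : Function.Surjective r)
    (hr_fin : ∀ x, (r ⁻¹' {x}).Finite) (hρ : IsStronglyInvariant r ρ) (hc : IsRepellingCycle r c)
    (hr_cont : ∀ i, ContinuousAt r (c i)) (hcard_cont : ∀ i, ContinuousAt (fiberCard r) (c i))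
    (hα : ∀ i, ‖α i‖ = 1) (hm₀ : MemLp m₀ ∞ ρ) (hm₀_lip : ∀ i, IsBetaLipschitzAt m₀ (c i))
    (hqmf : ∀ x, (1 / (fiberCard r x : ℝ)) * ∑ᶠ y ∈ r ⁻¹' {x}, ‖m₀ y‖ ^ 2 = 1)
    (hlow : ∀ i, m₀ (c i) = α i * (Real.sqrt (fiberCard r (r (c i))) : ℂ)) :
    LowPassSystem r ρ c α m₀ where
  measurable := hr_meas
  surjective := hr_surj
  finite_fiber := hr_fin
  invariant := hρ
  cycle := hc.1
  continuousAt := hr_cont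
  exists_injOn := by
    -- The weight is continuous at the cycle with value 1 there, so this open set contains the
    -- cycle.
    refine ⟨interior {y | 1 / 2 < filterWeight r m₀ y}, isOpen_interior, fun i => ?_,
      (injOn_of_half_lt_filterWeight (fiberSum_filterWeight hr_fin hqmf)).mono interior_subset⟩
    refine mem_interior_iff_mem_nhds.2 ?_
    have h1 := continuousAt_filterWeight hr_surj hr_fin hc.1 hr_cont hcard_cont
      (fun i => (hm₀_lip i).continuousAt) i
    refine h1.eventually (lt_mem_nhds ?_)
    rw [filterWeight_cycle hr_surj hr_fin hα hlow i]
    norm_num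
  norm_phase := hα
  memLp := hm₀
  sum_weight := fiberSum_filterWeight hr_fin hqmf
  summable _ hω := summable_norm_phiFactor_sub_one hr_surj hr_fin hc hr_cont hcard_cont hα hm₀_lip
    hlow hω

end Construction

end RepellingCycle

open RepellingCycle in
theorem mainTheorem1 {X : Type*} [MetricSpace X] [CompactSpace X] [MeasurableSpace X]
    [BorelSpace X] (r : X → X) (hr_meas : Measurable r) (hr_surj : Function.Surjective r)
    (hr_fin : ∀ x, (r ⁻¹' {x}).Finite)
    (ρ : Measure X) [IsProbabilityMeasure ρ] (hρ : IsStronglyInvariant r ρ)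
    (p : ℕ) [NeZero p] (c : ZMod p → X) (hc : IsRepellingCycle r c)
    (hr_cont : ∀ i, ContinuousAt r (c i))
    (hcard_cont : ∀ i, ContinuousAt (fiberCard r) (c i))
    (α : ZMod p → ℂ) (hα : ∀ i, ‖α i‖ = 1)
    (m₀ : X → ℂ) (hm₀ : MemLp m₀ ∞ ρ) (hm₀_lip : ∀ i, IsBetaLipschitzAt m₀ (c i))
    (hqmf : ∀ x, (1 / (fiberCard r x : ℝ)) * ∑ᶠ y ∈ r ⁻¹' {x}, ‖m₀ y‖ ^ 2 = 1)
    (hlow : ∀ i, m₀ (c i) = α i * (Real.sqrt (fiberCard r (r (c i))) : ℂ)) :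
    -- the sets `N_C(x)` are countable and `λ_C` is given by its defining formula
    (∀ x, (cyclePaths r c x).Countable) ∧
    (∀ F : PathSpace r → ℝ≥0∞, Measurable F →
      AEMeasurable (fun x => ∑' ω : cyclePaths r c x, F ω) ρ ∧
      ∫⁻ ω, F ω ∂(lambdaC ρ r c) = ∫⁻ x, ∑' ω : cyclePaths r c x, F ω ∂ρ) ∧
    -- the infinite product converges at every path that tends to the cycle
    (∀ x, ∀ ω ∈ cyclePaths r c x, Multipliable fun k : ℕ => phiFactor c α m₀ ω (k + 1)) ∧
    IsWCycle r (filterWeight r m₀) c ∧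
    -- `U` is a well-defined unitary operator on `L²(X_∞, λ_C)`, and `φ̂` lies in this space
    ∃ (U : PathL2 ρ r c ≃ₗᵢ[ℂ] PathL2 ρ r c)
      (hφ : MemLp (phiHat (r := r) c α m₀) 2 (lambdaC ρ r c)),
      (∀ ξ : PathL2 ρ r c, U ξ =ᵐ[lambdaC ρ r c] scaleFun c α ξ) ∧
      -- the scaling equation
      U hφ.toLp = piRep ρ r c hm₀.toLp hφ.toLp ∧
      -- the correlation formula for `⟨π(f) φ̂, φ̂⟩` (linear in the first slot); `inner ℂ` is linear
      -- in its second argument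
      (∀ f : Lp ℂ ∞ ρ,
        Integrable (fun x => f x * (harmonicFun r (filterWeight r m₀) c x : ℂ)) ρ ∧
        inner ℂ hφ.toLp (piRep ρ r c f hφ.toLp) =
          ∫ x, f x * (harmonicFun r (filterWeight r m₀) c x : ℂ) ∂ρ) ∧
      -- the multiresolution
      (∀ n : ℤ, resolutionSpace ρ r c U hφ.toLp n ⊆ resolutionSpace ρ r c U hφ.toLp (n + 1)) ∧
      closure (⋃ n : ℤ, resolutionSpace ρ r c U hφ.toLp n) = Set.univ ∧
      (Ergodic r ρ → ρ {x | ‖m₀ x‖ ≠ 1} ≠ 0 →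
        ⋂ n : ℤ, resolutionSpace ρ r c U hφ.toLp n = {0}) := by
  have S := hc.lowPassSystem hr_meas hr_surj hr_fin hρ hr_cont hcard_cont hα hm₀ hm₀_lip hqmf hlow
  obtain ⟨U, hU⟩ := S.exists_scale_unitary hα
  exact ⟨S.countable, fun F hF => ⟨S.aemeasurable_tsum hF.aemeasurable,
    S.lintegral_lambdaC hF.aemeasurable⟩, fun x ω hω => S.multipliable_phiFactor hω.2,
    ⟨hc.1, filterWeight_cycle hr_surj hr_fin hα hlow⟩, U, S.memLp_phiHat, hU,
    S.scaling_equation hU, fun f => ⟨S.integrable_mul_harmonicFun f, S.inner_piRep_phiHat f⟩,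
    S.resolutionSpace_subset hU, S.closure_iUnion_resolutionSpace hU,
    S.iInter_resolutionSpace hU⟩
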